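/- Let $\mathbb K$ be a field and let $G$ be a finite, connected, simple, non-bipartite graph. Its toric ideal $I_G\subseteq\mathbb K[x_e : e\in E(G)]$ is the ideal generated by all binomials $x^{p}-x^{q}$ with $\sum_e p_e a_e=\sum_e q_e a_e$, where $a_e=\mathbf e_u+\mathbf e_v\in\mathbb N^{V(G)}$ for an edge $e=\{u,v\}$. A Markov basis of $I_G$ is an inclusion-minimal generating set consisting of binomials $x^p-x^q$. The ideal $I_G$ is called generalized robust if its universal Gröbner basis (the union of its reduced Gröbner bases over all term orders) equals its universal Markov basis (the union of its Markov bases), binomials being considered up to sign. It is generated by quadrics if it is generated by homogeneous polynomials of degree $2$ (possibly by the empty set). A cut vertex (cut edge) of a graph is a vertex (edge) whose removal increases the number of connected components; a graph is biconnected if it is connected and has no cut vertex, and a block is a maximal biconnected subgraph. The following families of graphs (up to isomorphism) are considered. - $K_4$, and $K_{2,\ell}$ with $\ell\ge 2$. - $K_{2,\ell}\cup\{e\}$ with $\ell\ge 2$: the graph $K_{2,\ell}$ together with one additional edge $e$ joining two distinct non-adjacent vertices of $K_{2,\ell}$. - A double-$K_{2,(r,s)}$ with $r,s\ge 2$: a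 graph obtained from disjoint copies of $K_{2,r}\cup\{e\}$ and $K_{2,s}$ by identifying the edge $e$ with an edge of $K_{2,s}$ (the identified edge is kept). - A necklace-$K_{2,\ell}$: let $R$ be a finite bipartite graph whose block tree (the bipartite graph on the blocks and the cut vertices of $R$ in which a block is adjacent to the cut vertices it contains) is a path, with blocks $B_1,\dots,B_k$ in this order, $k\ge 2$, each $B_i$ being a $K_{2,n_i}$ with $n_i\ge 2$ or a cut edge of $R$; let $x_1\in V(B_1)$ and $x_2\in V(B_k)$ be non-adjacent vertices of $R$ at odd distance, neither of which is a cut vertex of $R$. The necklace is the graph obtained from $R$ by identifying $x_1$ and $x_2$. Then $I_G$ is generalized robust and generated by quadrics if and only if $G$ has exactly one non-bipartite block, this block is a $K_4$, a $K_{2,\ell}\cup\{e\}$ with $\ell\ge2$, a double-$K_{2,(r,s)}$ with $r,s\ge2$, or a necklace-$K_{2,\ell}$, and every bipartite block of $G$ is a $K_{2,\ell}$ with $\ell\ge 2$ or a cut edge of $G$. -/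

import Mathlib

universe u v

namespace ToricGraph

/-! ### Toric ideals and their bases -/

section Toric

variable {σ : Type u} {τ : Type v} (K : Type*) [Field K]

/-- The pure-difference binomial `x^p - x^q`. -/
noncomputable def binomial (p q : σ →₀ ℕ) : MvPolynomial σ K :=
  MvPolynomial.monomial p 1 - MvPolynomial.monomial q 1

/-- The toric ideal of the family of vectors `a`: it is generated by the binomials `x^p - x^q`
with `∑ p_i a_i = ∑ q_i a_i`. -/
noncomputable def toricIdeal (a : σ → τ → ℕ) : Ideal (MvPolynomial σ K) :=
  Ideal.span {f | ∃ p q : σ →₀ ℕ,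
    Finsupp.linearCombination ℕ a p = Finsupp.linearCombination ℕ a q ∧ f = binomial K p q}

variable {K}

/-- A Markov basis of `I`: an inclusion-minimal set of binomials generating `I`. -/
def IsMarkovBasis (I : Ideal (MvPolynomial σ K)) (M : Set (MvPolynomial σ K)) : Prop :=
  Minimal (fun S : Set (MvPolynomial σ K) =>
    (∀ f ∈ S, ∃ p q : σ →₀ ℕ, f = binomial K p q) ∧ Ideal.span S = I) M

/-- The union of all Markov bases of `I`. -/
def universalMarkovBasis (I : Ideal (MvPolynomial σ K)) : Set (MvPolynomial σ K) :=
  {f | ∃ M, IsMarkovBasis I M ∧ f ∈ M}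

/-- `S` is the reduced Gröbner basis of `I` with respect to the term order `m`. -/
structure IsReducedGroebnerBasis (m : MonomialOrder.{u, u} σ) (I : Ideal (MvPolynomial σ K))
    (S : Set (MvPolynomial σ K)) : Prop where
  subset : S ⊆ I
  span_leadingTerm :
    Ideal.span (m.leadingTerm '' S) = Ideal.span (m.leadingTerm '' (I : Set (MvPolynomial σ K)))
  monic : ∀ f ∈ S, m.Monic f
  /-- No monomial of an element is divisible by the leading monomial of another element. -/
  reduced : ∀ f ∈ S, ∀ g ∈ S, g ≠ f → ∀ p ∈ f.support, ¬ m.degree g ≤ p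

/-- The union of all reduced Gröbner bases of `I`, over all term orders. -/
def universalGroebnerBasis (I : Ideal (MvPolynomial σ K)) : Set (MvPolynomial σ K) :=
  {f | ∃ (m : MonomialOrder.{u, u} σ) (S : Set (MvPolynomial σ K)),
    IsReducedGroebnerBasis m I S ∧ f ∈ S}

/-- The universal Gröbner basis equals the universal Markov basis. As usual for toric ideals,
a binomial is identified with its negative; the universal Markov basis is closed under negation
by definition, the universal Gröbner basis is closed up under it here. -/
def IsGeneralizedRobust (I : Ideal (MvPolynomial σ K)) : Prop :=
  {f | f ∈ universalGroebnerBasis I ∨ -f ∈ universalGroebnerBasis I} = universalMarkovBasis I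

/-- `I` has a generating set of homogeneous polynomials of degree two. -/
def IsGeneratedByQuadrics (I : Ideal (MvPolynomial σ K)) : Prop :=
  ∃ S : Set (MvPolynomial σ K), (∀ f ∈ S, f.IsHomogeneous 2) ∧ Ideal.span S = I

end Toric

/-- The vector `v_i + v_j` of an edge `{v_i, v_j}`. -/
noncomputable def edgeVector {V : Type u} (G : SimpleGraph V) (e : G.edgeSet) : V → ℕ :=
  Set.indicator {w | w ∈ (e : Sym2 V)} 1

/-- The toric ideal `I_G` of a graph, in the polynomial ring whose variables are the edges. -/
noncomputable def graphIdeal {V : Type u} (K : Type*) [Field K] (G : SimpleGraph V) :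
    Ideal (MvPolynomial G.edgeSet K) :=
  toricIdeal K (edgeVector G)

/-! ### Blocks -/

section Blocks

variable {V : Type u}

/-- Removing `x` disconnects two other vertices that were in the same component, i.e. it increases
the number of connected components. -/
def IsCutVertex (G : SimpleGraph V) (x : V) : Prop :=
  ∃ (a b : V) (ha : a ∈ ({x}ᶜ : Set V)) (hb : b ∈ ({x}ᶜ : Set V)),
    G.Reachable a b ∧ ¬ (G.induce ({x}ᶜ : Set V)).Reachable ⟨a, ha⟩ ⟨b, hb⟩

/-- Connected and without cut vertices. -/
def IsBiconnected (G : SimpleGraph V) : Prop :=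
  G.Connected ∧ ∀ x, ¬ IsCutVertex G x

/-- A block is a maximal biconnected subgraph. -/
def IsBlock (G : SimpleGraph V) (B : G.Subgraph) : Prop :=
  Maximal (fun H : G.Subgraph => IsBiconnected H.coe) B

/-- The subgraph `B` consists of a single edge, and this edge is a cut edge of `G`. -/
def IsCutEdge (G : SimpleGraph V) (B : G.Subgraph) : Prop :=
  ∃ (a b : V) (h : G.Adj a b), G.IsBridge s(a, b) ∧ B = G.subgraphOfAdj h

/-- The block tree: blocks on one side, cut vertices on the other, adjacency is membership. -/
def blockTree (G : SimpleGraph V) :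
    SimpleGraph ({B : G.Subgraph // IsBlock G B} ⊕ {x : V // IsCutVertex G x}) where
  Adj
    | .inl B, .inr x => (x : V) ∈ (B : G.Subgraph).verts
    | .inr x, .inl B => (x : V) ∈ (B : G.Subgraph).verts
    | _, _ => False
  symm := ⟨by rintro (_ | _) (_ | _) h <;> exact h⟩
  loopless := ⟨by rintro (_ | _) h <;> exact h⟩

end Blocks

/-! ### The graphs occurring in the classification -/

section Families

variable {V : Type u}

/-- `H` is a complete graph on four vertices. -/
def IsK4 (H : SimpleGraph V) : Prop :=
  Nonempty (H ≃g (⊤ : SimpleGraph (Fin 4)))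

/-- The standard `K_{2,n}`. -/
abbrev K2 (n : ℕ) : SimpleGraph (Fin 2 ⊕ Fin n) :=
  completeBipartiteGraph (Fin 2) (Fin n)

/-- `H` is a `K_{2,ℓ}` for some `ℓ ≥ 2`. -/
def IsK2l (H : SimpleGraph V) : Prop :=
  ∃ l : ℕ, 2 ≤ l ∧ Nonempty (H ≃g K2 l)

/-- `H` is a `K_{2,ℓ} ∪ {e}`, with `ℓ ≥ 2` and `e` a new edge joining two vertices of the
`K_{2,ℓ}`. -/
def IsK2lPlusEdge (H : SimpleGraph V) : Prop :=
  ∃ (l : ℕ) (a b : Fin 2 ⊕ Fin l), 2 ≤ l ∧ a ≠ b ∧ ¬ (K2 l).Adj a b ∧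
    Nonempty (H ≃g (K2 l ⊔ SimpleGraph.edge a b))

/-- `H` is the 2-clique sum of `G₁` and `G₂` obtained by identifying the edge `ab` of `G₁` with the
edge `cd` of `G₂` (`a` with `c` and `b` with `d`). -/
def IsTwoCliqueSum {W₁ W₂ : Type*} (G₁ : SimpleGraph W₁) (a b : W₁) (G₂ : SimpleGraph W₂)
    (c d : W₂) (H : SimpleGraph V) : Prop :=
  G₁.Adj a b ∧ G₂.Adj c d ∧
  ∃ (f : W₁ → V) (g : W₂ → V), Function.Injective f ∧ Function.Injective g ∧
    Set.range f ∪ Set.range g = Set.univ ∧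
    (∀ x y, f x = g y ↔ (x = a ∧ y = c) ∨ (x = b ∧ y = d)) ∧
    ∀ p q, H.Adj p q ↔
      (∃ x y, G₁.Adj x y ∧ f x = p ∧ f y = q) ∨ (∃ x y, G₂.Adj x y ∧ g x = p ∧ g y = q)

/-- `H` is a double-`K_{2,(r,s)}` for some `r, s ≥ 2`. -/
def IsDoubleK2 (H : SimpleGraph V) : Prop :=
  ∃ (r s : ℕ) (a b : Fin 2 ⊕ Fin r) (c d : Fin 2 ⊕ Fin s),
    2 ≤ r ∧ 2 ≤ s ∧ a ≠ b ∧ ¬ (K2 r).Adj a b ∧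
    IsTwoCliqueSum (K2 r ⊔ SimpleGraph.edge a b) a b (K2 s) c d H

/-- `H` is obtained from `R` by identifying the vertices `x₁` and `x₂`; `π` is the quotient map. -/
def IsVertexIdentification {W : Type*} (R : SimpleGraph W) (x₁ x₂ : W) (H : SimpleGraph V) :
    Prop :=
  ∃ π : W → V, Function.Surjective π ∧
    (∀ a b, π a = π b ↔ a = b ∨ (a = x₁ ∧ b = x₂) ∨ (a = x₂ ∧ b = x₁)) ∧
    ∀ p q, H.Adj p q ↔ ∃ a b, R.Adj a b ∧ π a = p ∧ π b = q

/-- `H` is a necklace-`K_{2,ℓ}`: it arises from a bipartite graph `R` whose block tree is a path,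
with at least two blocks, all of them cut edges or of type `K_{2,n}` with `n ≥ 2`, by identifying
two non-adjacent vertices at odd distance that lie in the two end blocks and are not cut
vertices. -/
def IsNecklaceK2 (H : SimpleGraph V) : Prop :=
  ∃ (W : Type u) (_ : Finite W) (R : SimpleGraph W) (x₁ x₂ : W)
    (n : ℕ) (φ : blockTree R ≃g SimpleGraph.pathGraph (n + 1))
    (B₁ B₂ : {B : R.Subgraph // IsBlock R B}),
    R.IsBipartite ∧
    (∀ B, IsBlock R B → IsK2l B.coe ∨ IsCutEdge R B) ∧
    φ (.inl B₁) = 0 ∧ φ (.inl B₂) = Fin.last n ∧ B₁ ≠ B₂ ∧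
    x₁ ∈ B₁.1.verts ∧ x₂ ∈ B₂.1.verts ∧
    ¬ IsCutVertex R x₁ ∧ ¬ IsCutVertex R x₂ ∧
    ¬ R.Adj x₁ x₂ ∧ Odd (R.dist x₁ x₂) ∧
    IsVertexIdentification R x₁ x₂ H

end Families

end ToricGraph

namespace ToricGraph

/-! ### Kernel functions of the incidence matrix -/

section Kernel

variable {V : Type*} {W : Type*}

/-! Two monomials in one fiber differ by an integer edge weighting with vanishing sums at all
vertices (`IsKernel`), so the statement about ideals becomes one about such weightings. The hinge is
`HasQuadraticInitialIdeals`: for every term order the initial ideal is generated in degree two.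
Robustness puts the elements of each reduced Gröbner basis into Markov bases, which are quadratic
when the ideal is generated by quadrics (`hasQuadraticInitialIdeals`). Conversely, if all initial
ideals are quadratic, both universal bases consist, up to sign, of the nonzero quadratic binomials
of the ideal (`HasQuadraticInitialIdeals.isGeneralizedRobust`).

On the graph side this property is squeezed between two others: it follows from
`HasConformalSquares`, by exchanging opposite edges of alternating squares, and it implies
`HasSquares`, by elimination orders adapted to the support of a weighting.

Necessity uses `HasSquares` on the alternating weights of even closed walks. Every even cycle is
then a square, and two odd cycles share at least two vertices, so just one block is non-bipartite.
Moreover, two edges at x that are joined by an even walk avoiding x lie on a square. This makes a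
biconnected bipartite graph on at least three vertices a K_{2,l}, and makes the non-bipartite block
a K_4 if no vertex deletion turns it bipartite. If deleting x does, then splitting x gives a
bipartite graph with squares whose block tree is a path, and the block is a necklace
(`isNecklaceK2_of_del_isBipartite`).

Sufficiency rests on one fact: in a bipartite graph the signed sum of the row sums vanishes
(`sum_sign_mul_sum_eq_zero`). Hence kernel weightings restrict to kernel weightings of the blocks,
and inside the listed families to those of the pieces glued together. Only K_{2,l}, K_4 and a single
edge remain to be checked by hand. -/

/-- An edge weighting of `G`, as a symmetric function, in the kernel of the incidence matrix. -/
structure IsKernel (G : SimpleGraph V) (z : V → V → ℤ) : Prop where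
  symm : ∀ x y, z x y = z y x
  adj : ∀ x y, z x y ≠ 0 → G.Adj x y
  sum : ∀ x, ∑ᶠ y, z x y = 0

/-- Every nonzero kernel element is sign-compatible with a 4-cycle. -/
def HasConformalSquares (G : SimpleGraph V) : Prop :=
  ∀ z, IsKernel G z → ∀ x y, z x y ≠ 0 →
    ∃ a b c d, 0 < z a b ∧ z b c < 0 ∧ 0 < z c d ∧ z d a < 0

/-- Every edge in the support of a kernel element lies on a 4-cycle inside that support. -/
def HasSquares (G : SimpleGraph V) : Prop :=
  ∀ z, IsKernel G z → ∀ a b, z a b ≠ 0 →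
    ∃ c d, c ≠ a ∧ d ≠ b ∧ z b c ≠ 0 ∧ z c d ≠ 0 ∧ z d a ≠ 0

open scoped Classical in
/-- The push-forward of a weighting along a map of vertices. -/
noncomputable def push [Fintype W] (f : W → V) (z : W → W → ℤ) (p q : V) : ℤ :=
  ∑ a, ∑ b, if f a = p ∧ f b = q then z a b else 0

lemma push_ne_zero [Fintype W] {f : W → V} {z : W → W → ℤ} {p q : V} (h : push f z p q ≠ 0) :
    ∃ a b, f a = p ∧ f b = q ∧ z a b ≠ 0 := by
  classical
  obtain ⟨a, -, ha⟩ := Finset.exists_ne_zero_of_sum_ne_zero h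
  obtain ⟨b, -, hb⟩ := Finset.exists_ne_zero_of_sum_ne_zero ha
  rw [ite_ne_right_iff] at hb
  exact ⟨a, b, hb.1.1, hb.1.2, hb.2⟩

lemma push_eq [Fintype W] {f : W → V} {z : W → W → ℤ} {p q : V} (a b : W) (ha : f a = p)
    (hb : f b = q) (h : ∀ a' b', f a' = p → f b' = q → z a' b' ≠ 0 → a' = a ∧ b' = b) :
    push f z p q = z a b := by
  classical
  unfold push
  rw [Finset.sum_eq_single a, Finset.sum_eq_single b]
  · simp [ha, hb]
  · intro b' _ hb'
    by_contra h0
    rw [← ne_eq, ite_ne_right_iff] at h0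
    exact hb' (h a b' h0.1.1 h0.1.2 h0.2).2
  · simp
  · intro a' _ ha'
    refine Finset.sum_eq_zero fun b' _ => ?_
    by_contra h0
    rw [← ne_eq, ite_ne_right_iff] at h0
    exact ha' (h a' b' h0.1.1 h0.1.2 h0.2).1
  · simp

lemma push_symm [Fintype W] {f : W → V} {z : W → W → ℤ} (h : ∀ x y, z x y = z y x) (p q : V) :
    push f z p q = push f z q p := by
  classical
  unfold push
  rw [Finset.sum_comm]
  refine Finset.sum_congr rfl fun a _ => Finset.sum_congr rfl fun b _ => ?_
  rw [h b a, ite_congr (propext and_comm) (fun _ => rfl) (fun _ => rfl)]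

-- Row sums add up over the fibers of `f`, so vanishing row sums are preserved even when `f`
-- identifies vertices.
open scoped Classical in
lemma sum_push [Fintype V] [Fintype W] (f : W → V) (z : W → W → ℤ) (p : V) :
    ∑ q, push f z p q = ∑ a, if f a = p then ∑ b, z a b else 0 := by
  unfold push
  rw [Finset.sum_comm]
  refine Finset.sum_congr rfl fun a _ => ?_
  rw [Finset.sum_comm]
  split_ifs with h
  · refine Finset.sum_congr rfl fun b _ => ?_
    simp [h]
  · simp [h]

lemma IsKernel.push [Finite V] [Fintype W] {G : SimpleGraph V} {H : SimpleGraph W} {f : W → V}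
    (hf : ∀ a b, H.Adj a b → G.Adj (f a) (f b)) {z : W → W → ℤ} (hz : IsKernel H z) :
    IsKernel G (push f z) where
  symm := push_symm hz.symm
  adj p q h := by
    obtain ⟨a, b, rfl, rfl, h'⟩ := push_ne_zero h
    exact hf _ _ (hz.adj _ _ h')
  sum p := by
    classical
    cases nonempty_fintype V
    rw [finsum_eq_sum_of_fintype, sum_push]
    refine Finset.sum_eq_zero fun a _ => ?_
    rw [← finsum_eq_sum_of_fintype, hz.sum]
    simp

lemma push_apply_of_injective [Fintype W] {f : W → V} (hf : Function.Injective f)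
    (z : W → W → ℤ) (a b : W) : push f z (f a) (f b) = z a b :=
  push_eq a b rfl rfl fun _ _ h h' _ => ⟨hf h, hf h'⟩

/-- In a bipartite weighting the signed sum of the row sums vanishes. -/
lemma sum_sign_mul_sum_eq_zero [Fintype V] {z : V → V → ℤ} (hz : ∀ x y, z x y = z y x)
    (ε : V → ℤ) (hε : ∀ x y, z x y ≠ 0 → ε x = - ε y) : ∑ x, ε x * ∑ y, z x y = 0 := by
  -- Exchanging the summations changes the sign of every term, so the sum is its own negative.
  have h : ∑ x, ε x * ∑ y, z x y = - ∑ x, ε x * ∑ y, z x y := by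
    simp_rw [Finset.mul_sum]
    conv_lhs => rw [Finset.sum_comm]
    rw [← Finset.sum_neg_distrib]
    refine Finset.sum_congr rfl fun x _ => ?_
    rw [← Finset.sum_neg_distrib]
    refine Finset.sum_congr rfl fun y _ => ?_
    by_cases h : z x y = 0
    · simp [h, hz y x]
    · rw [hz y x, hε x y h]; ring
  omega

/-- The push-forward is supported on the image of `H`, so a square in its support pulls back. -/
lemma HasSquares.of_injective_hom [Finite V] [Finite W] {G : SimpleGraph V} {H : SimpleGraph W}
    (hG : HasSquares G) (f : W → V) (hf : Function.Injective f)
    (hadj : ∀ a b, H.Adj a b → G.Adj (f a) (f b)) : HasSquares H := by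
  cases nonempty_fintype W
  intro z hz a b hab
  rw [← push_apply_of_injective hf z] at hab
  obtain ⟨c, d, hc, hd, h1, h2, h3⟩ := hG _ (hz.push hadj) _ _ hab
  obtain ⟨b', c', hb', rfl, h1'⟩ := push_ne_zero h1
  obtain ⟨d', a', rfl, ha', h3'⟩ := push_ne_zero h3
  rw [push_apply_of_injective hf] at h1 h2 h3
  exact ⟨c', d', fun h => hc (by rw [h]), fun h => hd (by rw [h]), h1, h2, h3⟩

lemma HasConformalSquares.of_iso {G : SimpleGraph V} {H : SimpleGraph W}
    (hG : HasConformalSquares G) (e : H ≃g G) : HasConformalSquares H := by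
  intro z hz x y hxy
  have hz' : IsKernel G fun a b => z (e.symm a) (e.symm b) :=
    ⟨fun _ _ => hz.symm _ _, fun a b h => e.symm.map_adj_iff.1 (hz.adj _ _ h), fun a =>
      (finsum_comp_equiv e.symm.toEquiv (f := fun b => z (e.symm a) b)).trans (hz.sum _)⟩
  obtain ⟨a, b, c, d, h⟩ := hG _ hz' (e x) (e y) (by simpa using hxy)
  exact ⟨_, _, _, _, h⟩

/-- Every kernel weighting that is nonzero at an edge has a sign change at each of its ends. -/
lemma IsKernel.exists_neg [Finite V] {G : SimpleGraph V} {z : V → V → ℤ} (hz : IsKernel G z)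
    {x y : V} (h : 0 < z x y) : ∃ w, z x w < 0 := by
  cases nonempty_fintype V
  by_contra! hn
  have h0 := hz.sum x
  rw [finsum_eq_sum_of_fintype] at h0
  have := (Finset.sum_eq_zero_iff_of_nonneg fun i _ => hn i).1 h0 y (Finset.mem_univ _)
  omega

lemma IsKernel.neg {G : SimpleGraph V} {z : V → V → ℤ} (hz : IsKernel G z) :
    IsKernel G fun x y => - z x y :=
  ⟨fun x y => by rw [hz.symm], fun x y h => hz.adj x y (by simpa using h),
    fun x => by rw [finsum_neg_distrib, hz.sum, neg_zero]⟩

lemma IsKernel.exists_pos [Finite V] {G : SimpleGraph V} {z : V → V → ℤ} (hz : IsKernel G z)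
    {x y : V} (h : z x y < 0) : ∃ w, 0 < z x w := by
  obtain ⟨w, hw⟩ := hz.neg.exists_neg (x := x) (y := y) (by simpa using h)
  exact ⟨w, by simpa using hw⟩

end Kernel

/-! ### Alternating weightings of walks -/

section Walks

variable {V : Type*} {G : SimpleGraph V}

open SimpleGraph Walk

open scoped Classical in
/-- The alternating sum of the edges of a walk. -/
noncomputable def altWeight : ∀ {u v : V}, G.Walk u v → V → V → ℤ
  | _, _, .nil => fun _ _ => 0
  | u, _, .cons (v := v) _ p => fun x y => (if s(x, y) = s(u, v) then 1 else 0) - altWeight p x y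

lemma altWeight_symm {u v : V} (p : G.Walk u v) (x y : V) : altWeight p x y = altWeight p y x := by
  classical
  induction p with
  | nil => rfl
  | cons h p ih =>
    simp only [altWeight, ih]
    rw [if_congr (by rw [Sym2.eq_swap]) rfl rfl]

-- Signs are invisible modulo two; hence an edge traversed exactly once has nonzero weight, whatever
-- its position in the walk.
open scoped Classical in
lemma altWeight_modEq {u v : V} (p : G.Walk u v) (x y : V) :
    altWeight p x y ≡ p.edges.count s(x, y) [ZMOD 2] := by
  induction p with
  | nil => simp [altWeight]
  | cons h p ih =>
    simp only [altWeight, edges_cons, List.count_cons, beq_iff_eq]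
    rw [Int.modEq_iff_dvd] at *
    push_cast
    split_ifs with h1 h2 h2
    · omega
    · exact absurd h1.symm h2
    · exact absurd h2.symm h1
    · omega

lemma mem_edges_of_altWeight_ne_zero {u v : V} (p : G.Walk u v) {x y : V}
    (h : altWeight p x y ≠ 0) : s(x, y) ∈ p.edges := by
  induction p with
  | nil => simp [altWeight] at h
  | cons h' p ih =>
    simp only [altWeight] at h
    rw [edges_cons, List.mem_cons]
    by_cases h0 : altWeight p x y = 0
    · left
      by_contra h1
      simp [h0, h1] at h
    · exact .inr (ih h0)

open scoped Classical in
lemma altWeight_ne_zero {u v : V} (p : G.Walk u v) {x y : V}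
    (h : p.edges.count s(x, y) = 1) : altWeight p x y ≠ 0 := by
  have := altWeight_modEq p x y
  rw [h, Int.modEq_iff_dvd] at this
  omega

-- The sum telescopes: interior visits of the walk cancel, and the ends survive with signs given by
-- the parity of the length.
open scoped Classical in
lemma sum_altWeight [Fintype V] {u v : V} (p : G.Walk u v) (x : V) :
    ∑ y, altWeight p x y =
      (if x = u then 1 else 0) - (-1) ^ p.length * (if x = v then 1 else 0) := by
  induction p with
  | nil => simp [altWeight]
  | @cons u v w h p ih =>
    simp only [altWeight, Finset.sum_sub_distrib, ih, length_cons, pow_succ]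
    have h1 : ∑ y, (if s(x, y) = s(u, v) then (1 : ℤ) else 0) =
        (if x = u then 1 else 0) + if x = v then 1 else 0 := by
      by_cases hu : x = u
      · subst hu
        simp [h.ne]
      · by_cases hv : x = v
        · subst hv
          simp [hu]
        · simp [hu, hv]
    rw [h1]
    ring

lemma isKernel_altWeight [Finite V] {u : V} (p : G.Walk u u) (hp : Even p.length) :
    IsKernel G (altWeight p) where
  symm := altWeight_symm p
  adj x y h := p.adj_of_mem_edges (mem_edges_of_altWeight_ne_zero p h)
  sum x := by
    classical
    cases nonempty_fintype V
    rw [finsum_eq_sum_of_fintype, sum_altWeight, hp.neg_one_pow]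
    simp

/-- Two edges at `x` that are joined by an even walk avoiding `x` lie on a common 4-cycle. -/
lemma HasSquares.exists_common_neighbor [Finite V] (hG : HasSquares G) {x a b : V} (hab : a ≠ b)
    (ha : G.Adj x a) (hb : G.Adj x b) (p : G.Walk a b) (hx : x ∉ p.support)
    (hp : Even p.length) : ∃ c, c ≠ x ∧ G.Adj c a ∧ G.Adj c b := by
  classical
  -- In this even closed walk xa and xb are the only edges at x, each traversed once; a square
  -- through xa in the support must therefore return through xb.
  let w : G.Walk x x := cons ha (p.concat hb.symm)
  have hw : Even w.length := by simpa [w, length_concat, Nat.even_add_one] using hp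
  have hker := isKernel_altWeight w hw
  have hxp : ∀ y, s(x, y) ∉ p.edges := fun y h => hx (p.fst_mem_support_of_mem_edges h)
  have hmem : ∀ y, altWeight w x y ≠ 0 → y = a ∨ y = b := by
    intro y hy
    have := mem_edges_of_altWeight_ne_zero w hy
    simp only [w, edges_cons, edges_concat, List.concat_eq_append, List.mem_cons, List.mem_append,
      hxp, false_or, List.not_mem_nil, or_false] at this
    rcases this with h | h
    · exact .inl (Sym2.congr_right.1 h)
    · right
      rw [Sym2.eq_swap (a := b)] at h
      exact Sym2.congr_right.1 h
  have h1 : altWeight w x a ≠ 0 := by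
    apply altWeight_ne_zero
    simp only [w, edges_cons, edges_concat, List.concat_eq_append, List.count_cons_self,
      List.count_append, List.count_eq_zero_of_not_mem (hxp a), List.count_singleton,
      zero_add]
    rw [Sym2.eq_swap (a := b)]
    rw [if_neg (by rw [beq_iff_eq, Sym2.congr_right]; exact hab.symm)]
  obtain ⟨c, d, hc, hd, h2, h3, h4⟩ := hG _ hker _ _ h1
  rw [hker.symm] at h4
  obtain rfl : d = b := (hmem d h4).resolve_left hd
  exact ⟨c, hc, (hker.adj _ _ h2).symm, hker.adj _ _ h3⟩

/-- A cycle completed to an even closed walk by a closed walk meeting it in its base point only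
has length four. -/
lemma HasSquares.length_eq_four [Finite V] (hG : HasSquares G) {v : V} (c w : G.Walk v v)
    (hc : c.IsCycle) (hw : ∀ y ∈ c.support, y ∈ w.support → y = v)
    (hlen : Even (c.length + w.length)) : c.length = 4 := by
  classical
  have hker := isKernel_altWeight (c.append w) (by simpa using hlen)
  set z := altWeight (c.append w)
  have h3 := hc.three_le_length
  -- Away from the base point the support has only edges of `c`. A square starting with the first
  -- edge of `c` is thus forced along vertices 1, 2, 3 of `c`, and closing up makes vertex 4 the
  -- base point.
  have hsub : ∀ i, i ≠ 0 → i < c.length → ∀ y, z (c.getVert i) y ≠ 0 →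
      y = c.getVert (i - 1) ∨ y = c.getVert (i + 1) := by
    intro i h0 hi y hy
    have := mem_edges_of_altWeight_ne_zero _ hy
    rw [edges_append, List.mem_append] at this
    have hne : c.getVert i ≠ v := fun h =>
      h0 (hc.getVert_injOn' (by simp; omega) (by simp) (h.trans c.getVert_zero.symm))
    have hmem : s(c.getVert i, y) ∈ c.edges := this.resolve_right fun h =>
      hne (hw _ (c.getVert_mem_support i) (w.fst_mem_support_of_mem_edges h))
    rw [← adj_toSubgraph_iff_mem_edges, ← Subgraph.mem_neighborSet,
      hc.neighborSet_toSubgraph_internal h0 hi] at hmem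
    simpa using hmem
  have h01 : z v (c.getVert 1) ≠ 0 := by
    have hadj : s(v, c.getVert 1) ∈ c.edges := by
      rw [← adj_toSubgraph_iff_mem_edges]
      simpa using c.toSubgraph_adj_getVert (i := 0) (by omega)
    have hne : c.getVert 1 ≠ v := fun h => absurd
      (hc.getVert_injOn' (by simp; omega) (by simp) (h.trans c.getVert_zero.symm)) (by simp)
    apply altWeight_ne_zero
    rw [edges_append, List.count_append, List.count_eq_one_of_mem hc.edges_nodup hadj,
      List.count_eq_zero_of_not_mem]
    exact fun h => hne (hw _ (c.getVert_mem_support 1) (w.snd_mem_support_of_mem_edges h))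
  obtain ⟨x, y, hx, hy, h1, h2, h4⟩ := hG _ hker _ _ h01
  obtain rfl : x = c.getVert 2 :=
    (hsub 1 (by omega) (by omega) x h1).resolve_left (by simpa using hx)
  obtain rfl : y = c.getVert 3 := (hsub 2 (by omega) (by omega) y h2).resolve_left hy
  by_cases hl : c.length = 3
  · rw [← hl, c.getVert_length] at h4
    exact absurd rfl (hker.adj _ _ h4).ne
  rcases hsub 3 (by omega) (by omega) v h4 with h | h
  · exact absurd h.symm hx
  · by_contra hl'
    have : c.getVert 4 = c.getVert 0 := by rw [← h, c.getVert_zero]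
    have := hc.getVert_injOn' (by simp; omega) (by simp) this
    omega

lemma HasSquares.no_hexagon [Finite V] (hG : HasSquares G) {a b c d e f : V}
    (h : [a, b, c, d, e, f].Nodup) (h1 : G.Adj a b) (h2 : G.Adj b c) (h3 : G.Adj c d)
    (h4 : G.Adj d e) (h5 : G.Adj e f) (h6 : G.Adj f a) : False := by
  have hc : (cons h1 (cons h2 (cons h3 (cons h4 (cons h5 (cons h6 nil)))))).IsCycle := by
    rw [cons_isCycle_iff]
    simp_all [cons_isPath_iff]
    grind
  have := hG.length_eq_four _ nil hc (by simp) ⟨3, by simp⟩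
  simp at this

/-- Two triangles sharing one vertex form an even closed walk, so `HasSquares.length_eq_four` would
give a triangle length four. -/
lemma HasSquares.no_bowtie [Finite V] (hG : HasSquares G) {s a b c d : V}
    (h : [s, a, b, c, d].Nodup) (h1 : G.Adj s a) (h2 : G.Adj a b) (h3 : G.Adj b s)
    (h4 : G.Adj s c) (h5 : G.Adj c d) (h6 : G.Adj d s) : False := by
  have hc : (cons h1 (cons h2 (cons h3 nil))).IsCycle := by
    rw [cons_isCycle_iff]
    simp_all [cons_isPath_iff]
    grind
  have := hG.length_eq_four _ (cons h4 (cons h5 (cons h6 nil))) hc (by simp; grind) ⟨3, by simp⟩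
  simp at this

/-- A walk can be replaced by a path of the same parity unless its component contains an odd
cycle. -/
lemma exists_path_or_odd_cycle {u v : V} (p : G.Walk u v) :
    (∃ q : G.Walk u v, q.IsPath ∧ (Even q.length ↔ Even p.length)) ∨
      ∃ (x : V) (c : G.Walk x x), c.IsCycle ∧ Odd c.length ∧ G.Reachable u x := by
  classical
  induction p with
  | nil => exact .inl ⟨nil, by simp, Iff.rfl⟩
  | @cons u w v h p ih =>
    refine ih.elim (fun ⟨q, hq, hqe⟩ => ?_) fun ⟨x, c, hc, ho, hr⟩ =>
      .inr ⟨x, c, hc, ho, h.reachable.trans hr⟩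
    -- If q returns to u, the new edge and the part of q up to u form a closed walk: either an odd
    -- cycle, or even and hence removable without changing the parity.
    by_cases hu : u ∈ q.support
    · have hlen := congrArg length (q.take_spec hu)
      rw [length_append] at hlen
      by_cases he : Even (q.takeUntil u hu).length
      · right
        refine ⟨u, cons h (q.takeUntil u hu), ?_, by simpa using he.add_one, .rfl⟩
        rw [cons_isCycle_iff]
        refine ⟨hq.takeUntil hu, fun hmem => ?_⟩
        rw [Sym2.eq_swap] at hmem
        rw [(hq.takeUntil hu).length_eq_one_of_mem_edges hmem] at he
        simp at he
      · left
        refine ⟨q.dropUntil u hu, hq.dropUntil hu, ?_⟩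
        rw [length_cons, Nat.even_add_one, ← hqe, ← hlen, Nat.even_add]
        tauto
    · left
      refine ⟨cons h q, (cons_isPath_iff h q).2 ⟨hq, hu⟩, ?_⟩
      simp [Nat.even_add_one, hqe]

lemma exists_odd_cycle_of_odd_loop {u : V} (w : G.Walk u u) (hw : Odd w.length) :
    ∃ (x : V) (c : G.Walk x x), c.IsCycle ∧ Odd c.length ∧ G.Reachable u x := by
  refine (exists_path_or_odd_cycle w).resolve_left ?_
  rintro ⟨q, hq, hqe⟩
  rw [isPath_iff_nil, ← length_eq_zero_iff] at hq
  exact Nat.not_even_iff_odd.2 hw (hqe.1 (by simp [hq]))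

lemma exists_odd_cycle (hG : ¬ G.IsBipartite) :
    ∃ (x : V) (c : G.Walk x x), c.IsCycle ∧ Odd c.length := by
  have h := mt two_colorable_iff_forall_loop_even.2 hG
  push Not at h
  obtain ⟨u, w, hw⟩ := h
  obtain ⟨x, c, hc, ho, -⟩ := exists_odd_cycle_of_odd_loop w (Nat.not_even_iff_odd.1 hw)
  exact ⟨x, c, hc, ho⟩

end Walks

/-! ### Blocks of a graph -/

section BlockTheory

variable {V : Type*}

open SimpleGraph

/-- The graph `G` with all edges at `x` removed. -/
def del (G : SimpleGraph V) (x : V) : SimpleGraph V where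
  Adj u v := G.Adj u v ∧ u ≠ x ∧ v ≠ x
  symm := ⟨fun _ _ h => ⟨h.1.symm, h.2.2, h.2.1⟩⟩
  loopless := ⟨fun _ h => h.1.ne rfl⟩

lemma del_le (G : SimpleGraph V) (x : V) : del G x ≤ G := fun _ _ h => h.1

lemma del_mono {G H : SimpleGraph V} (h : G ≤ H) (x : V) : del G x ≤ del H x :=
  fun _ _ h' => ⟨h h'.1, h'.2⟩

/-- Deletions and subgraphs are handled on the ambient vertex type, where walks are easy to compare.
This passes back to graphs on a subtype: a walk starting in `S` cannot leave it. -/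
lemma reachable_lift {Γ : SimpleGraph V} {S : Set V} {Δ : SimpleGraph S}
    (h : ∀ (u : V) (hu : u ∈ S) (v : V), Γ.Adj u v → ∃ hv : v ∈ S, Δ.Adj ⟨u, hu⟩ ⟨v, hv⟩)
    {a b : V} (ha : a ∈ S) (hab : Γ.Reachable a b) :
    ∃ hb : b ∈ S, Δ.Reachable ⟨a, ha⟩ ⟨b, hb⟩ := by
  obtain ⟨p⟩ := hab
  induction p with
  | nil => exact ⟨ha, .rfl⟩
  | cons h' p ih =>
    obtain ⟨hv, hadj⟩ := h _ ha _ h'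
    obtain ⟨hb, hr⟩ := ih hv
    exact ⟨hb, hadj.reachable.trans hr⟩

lemma reachable_of_map {S : Set V} {Γ : SimpleGraph V} {Δ : SimpleGraph S}
    (h : ∀ u v : S, Δ.Adj u v → Γ.Adj u v) {a b : S} (hab : Δ.Reachable a b) :
    Γ.Reachable a b :=
  hab.map ⟨Subtype.val, fun {u v} => h u v⟩

lemma reachable_induce_compl_iff {G : SimpleGraph V} {x a b : V} (ha : a ∈ ({x}ᶜ : Set V))
    (hb : b ∈ ({x}ᶜ : Set V)) :
    (G.induce ({x}ᶜ : Set V)).Reachable ⟨a, ha⟩ ⟨b, hb⟩ ↔ (del G x).Reachable a b := by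
  refine ⟨fun h => reachable_of_map (Γ := del G x) (fun u v h => ⟨h, u.2, v.2⟩) h, fun h => ?_⟩
  exact (reachable_lift (S := {x}ᶜ) (Γ := del G x) (fun u hu v h => ⟨h.2.2, h.1⟩) ha h).2

lemma isCutVertex_iff {G : SimpleGraph V} {x : V} :
    IsCutVertex G x ↔ ∃ a b, a ≠ x ∧ b ≠ x ∧ G.Reachable a b ∧ ¬ (del G x).Reachable a b := by
  constructor
  · rintro ⟨a, b, ha, hb, h1, h2⟩
    exact ⟨a, b, ha, hb, h1, mt (reachable_induce_compl_iff ha hb).2 h2⟩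
  · rintro ⟨a, b, ha, hb, h1, h2⟩
    exact ⟨a, b, ha, hb, h1, mt (reachable_induce_compl_iff ha hb).1 h2⟩

lemma isBiconnected_iff {G : SimpleGraph V} :
    IsBiconnected G ↔ G.Connected ∧ ∀ x a b, a ≠ x → b ≠ x → (del G x).Reachable a b := by
  unfold IsBiconnected
  refine and_congr_right fun hc => forall_congr' fun x => ?_
  rw [isCutVertex_iff]
  push Not
  exact forall₄_congr fun a b _ _ => ⟨fun h => h (hc.preconnected a b), fun h _ => h⟩

lemma not_mem_support_of_del {G : SimpleGraph V} {x a b : V} (ha : a ≠ x)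
    (p : (del G x).Walk a b) : x ∉ p.support := by
  induction p with
  | nil => simpa using ha.symm
  | cons hadj p ih =>
    rw [Walk.support_cons, List.mem_cons, not_or]
    exact ⟨ha.symm, ih hadj.2.2⟩

lemma exists_path_of_reachable_del {G : SimpleGraph V} {x a b : V} (ha : a ≠ x)
    (h : (del G x).Reachable a b) : ∃ p : G.Walk a b, p.IsPath ∧ x ∉ p.support := by
  obtain ⟨p, hp⟩ := h.exists_isPath
  exact ⟨p.mapLe (del_le G x), by simpa using hp, by
    simpa using not_mem_support_of_del ha p⟩

/-! ### Biconnected subgraphs and blocks -/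

variable {G : SimpleGraph V}

/-- Biconnectedness of a subgraph, expressed in the ambient vertex type. -/
structure IsBiconnectedSubgraph (D : G.Subgraph) : Prop where
  nonempty : D.verts.Nonempty
  reachable : ∀ a ∈ D.verts, ∀ b ∈ D.verts, D.spanningCoe.Reachable a b
  reachable_del : ∀ x, ∀ a ∈ D.verts, ∀ b ∈ D.verts, a ≠ x → b ≠ x →
    (del D.spanningCoe x).Reachable a b

lemma reachable_coe_iff {D : G.Subgraph} {a b : D.verts} :
    D.coe.Reachable a b ↔ D.spanningCoe.Reachable (a : V) b :=
  ⟨fun h => reachable_of_map (fun _ _ h => h) h,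
    fun h => (reachable_lift (S := D.verts) (fun _ _ _ h => ⟨D.edge_vert h.symm, h⟩) a.2 h).2⟩

lemma reachable_del_coe_iff {D : G.Subgraph} {x a b : D.verts} :
    (del D.coe x).Reachable a b ↔ (del D.spanningCoe x).Reachable (a : V) b :=
  ⟨fun h => reachable_of_map (Γ := del D.spanningCoe x) (Δ := del D.coe x) (fun _ _ h =>
      ⟨h.1, fun h' => h.2.1 (Subtype.ext h'), fun h' => h.2.2 (Subtype.ext h')⟩) h,
    fun h => (reachable_lift (S := D.verts) (Γ := del D.spanningCoe x)
      (Δ := del D.coe x) (fun _ _ _ h => ⟨D.edge_vert h.1.symm, h.1,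
      fun h' => h.2.1 (congrArg Subtype.val h'), fun h' => h.2.2 (congrArg Subtype.val h')⟩)
      a.2 h).2⟩

lemma isBiconnected_coe_iff {D : G.Subgraph} :
    IsBiconnected D.coe ↔ IsBiconnectedSubgraph D := by
  rw [isBiconnected_iff]
  constructor
  · rintro ⟨hc, h⟩
    have hr : ∀ a ∈ D.verts, ∀ b ∈ D.verts, D.spanningCoe.Reachable a b := fun a ha b hb =>
      reachable_coe_iff (a := ⟨a, ha⟩) (b := ⟨b, hb⟩).1 (hc.preconnected _ _)
    refine ⟨Set.nonempty_coe_sort.1 hc.nonempty, hr, fun x a ha b hb hax hbx => ?_⟩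
    by_cases hx : x ∈ D.verts
    · exact reachable_del_coe_iff (x := ⟨x, hx⟩) (a := ⟨a, ha⟩) (b := ⟨b, hb⟩).1
        (h _ _ _ (fun h => hax (congrArg Subtype.val h)) (fun h => hbx (congrArg Subtype.val h)))
    · refine (hr a ha b hb).mono fun u v h => ⟨h, ?_, ?_⟩
      · rintro rfl; exact hx (D.edge_vert h)
      · rintro rfl; exact hx (D.edge_vert h.symm)
  · rintro ⟨hn, hr, h⟩
    have := hn.to_subtype
    refine ⟨⟨fun a b => reachable_coe_iff.2 (hr _ a.2 _ b.2)⟩, fun x a b ha hb => ?_⟩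
    exact reachable_del_coe_iff.2 (h _ _ a.2 _ b.2 (fun h => ha (Subtype.ext h))
      fun h => hb (Subtype.ext h))

/-- After deletion of x everything in `E` is anchored in what remains of `D`, which is connected.
The two vertices u, v give connectedness of `E` itself: deleting v handles every vertex but v. -/
lemma IsBiconnectedSubgraph.of_anchor {D E : G.Subgraph} (hD : IsBiconnectedSubgraph D)
    (hDE : D ≤ E) {u v : V} (huv : u ≠ v) (hu : u ∈ D.verts) (hv : v ∈ D.verts)
    (h : ∀ x, ∀ a ∈ E.verts, a ≠ x → ∃ b ∈ D.verts, b ≠ x ∧ (del E.spanningCoe x).Reachable a b) :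
    IsBiconnectedSubgraph E := by
  have hle : D.spanningCoe ≤ E.spanningCoe := Subgraph.spanningCoe_le_of_le hDE
  have key : ∀ x, ∀ a ∈ E.verts, ∀ b ∈ E.verts, a ≠ x → b ≠ x →
      (del E.spanningCoe x).Reachable a b := by
    intro x a ha b hb hax hbx
    obtain ⟨a', ha', hax', h1⟩ := h x a ha hax
    obtain ⟨b', hb', hbx', h2⟩ := h x b hb hbx
    exact (h1.trans ((hD.reachable_del x a' ha' b' hb' hax' hbx').mono (del_mono hle x))).trans
      h2.symm
  refine ⟨hD.nonempty.mono hDE.1, fun a ha b hb => ?_, key⟩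
  by_cases hab : a = b
  · exact hab ▸ .rfl
  have hto : ∀ c ∈ E.verts, E.spanningCoe.Reachable c u := by
    intro c hc
    by_cases hcv : c = v
    · subst hcv
      exact (hD.reachable c hv u hu).mono hle
    · exact (key v c hc u (hDE.1 hu) hcv huv).mono (del_le _ _)
  exact (hto a ha).trans (hto b hb).symm

/-- One of the two common vertices survives any deletion and links the two parts. -/
lemma IsBiconnectedSubgraph.sup {D E : G.Subgraph} (hD : IsBiconnectedSubgraph D)
    (hE : IsBiconnectedSubgraph E) {u v : V} (huv : u ≠ v) (hu : u ∈ D.verts) (hv : v ∈ D.verts)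
    (hu' : u ∈ E.verts) (hv' : v ∈ E.verts) : IsBiconnectedSubgraph (D ⊔ E) := by
  refine hD.of_anchor le_sup_left huv hu hv fun x a ha hax => ?_
  rcases ha with ha | ha
  · exact ⟨a, ha, hax, .rfl⟩
  · have hle : E.spanningCoe ≤ (D ⊔ E).spanningCoe := Subgraph.spanningCoe_le_of_le le_sup_right
    by_cases hx : u = x
    · exact ⟨v, hv, fun h => huv (hx.trans h.symm), (hE.reachable_del x a ha v hv' hax
        fun h => huv (hx.trans h.symm)).mono (del_mono hle x)⟩
    · exact ⟨u, hu, hx, (hE.reachable_del x a ha u hu' hax hx).mono (del_mono hle x)⟩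

lemma reachable_del_toSubgraph {u v x : V} (p : G.Walk u v) (hx : x ∉ p.support) :
    (del p.toSubgraph.spanningCoe x).Reachable u v := by
  induction p with
  | nil => exact .rfl
  | @cons u v w hadj p ih =>
    rw [Walk.support_cons, List.mem_cons, not_or] at hx
    refine Reachable.trans (Adj.reachable (v := v) ⟨?_, Ne.symm hx.1, ?_⟩) ((ih hx.2).mono ?_)
    · simp [Walk.toSubgraph, hadj.ne]
    · exact fun hv => hx.2 (hv ▸ p.start_mem_support)
    · exact del_mono (Subgraph.spanningCoe_le_of_le le_sup_right) x

/-- Adding a path between two distinct vertices keeps a subgraph biconnected. -/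
lemma IsBiconnectedSubgraph.sup_path {D : G.Subgraph} (hD : IsBiconnectedSubgraph D) {u v : V}
    (huv : u ≠ v) (hu : u ∈ D.verts) (hv : v ∈ D.verts) (p : G.Walk u v) (hp : p.IsPath) :
    IsBiconnectedSubgraph (D ⊔ p.toSubgraph) := by
  classical
  refine hD.of_anchor le_sup_left huv hu hv fun x a ha hax => ?_
  rcases ha with ha | ha
  · exact ⟨a, ha, hax, .rfl⟩
  rw [Walk.mem_verts_toSubgraph] at ha
  -- A path visits x at most once, so one of the two arcs from a to the ends of p avoids x.
  by_cases hx : x ∈ (p.takeUntil a ha).support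
  · have hx' : x ∉ (p.dropUntil a ha).support := by
      intro h
      have hnd := hp.support_nodup
      rw [← p.take_spec ha, Walk.support_append, List.nodup_append] at hnd
      rw [← Walk.cons_tail_support, List.mem_cons] at h
      exact h.elim (fun h => hax h.symm) fun h => hnd.2.2 x hx x h rfl
    refine ⟨v, hv, fun h => hx' (h ▸ Walk.end_mem_support _), ?_⟩
    refine (reachable_del_toSubgraph _ hx').mono (del_mono (Subgraph.spanningCoe_le_of_le ?_) x)
    refine le_sup_of_le_right ?_
    conv_rhs => rw [← p.take_spec ha, Walk.toSubgraph_append]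
    exact le_sup_right
  · refine ⟨u, hu, fun h => hx (h ▸ Walk.start_mem_support _), Reachable.symm ?_⟩
    refine (reachable_del_toSubgraph _ hx).mono (del_mono (Subgraph.spanningCoe_le_of_le ?_) x)
    refine le_sup_of_le_right ?_
    conv_rhs => rw [← p.take_spec ha, Walk.toSubgraph_append]
    exact le_sup_left

lemma isBiconnectedSubgraph_subgraphOfAdj {a b : V} (h : G.Adj a b) :
    IsBiconnectedSubgraph (G.subgraphOfAdj h) := by
  have hadj : (G.subgraphOfAdj h).spanningCoe.Adj a b := by simp [h.ne]
  refine ⟨⟨a, by simp⟩, ?_, ?_⟩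
  · simp only [subgraphOfAdj_verts, Set.mem_insert_iff, Set.mem_singleton_iff]
    rintro c (rfl | rfl) d (rfl | rfl)
    exacts [.rfl, hadj.reachable, hadj.reachable.symm, .rfl]
  · simp only [subgraphOfAdj_verts, Set.mem_insert_iff, Set.mem_singleton_iff]
    rintro x c (rfl | rfl) d (rfl | rfl) hc hd
    exacts [.rfl, Adj.reachable ⟨hadj, hc, hd⟩, Adj.reachable ⟨hadj.symm, hc, hd⟩, .rfl]

lemma IsBlock.isBiconnectedSubgraph {B : G.Subgraph} (hB : IsBlock G B) :
    IsBiconnectedSubgraph B := isBiconnected_coe_iff.1 hB.1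

lemma IsBlock.eq_of_le {B D : G.Subgraph} (hB : IsBlock G B) (hD : IsBiconnectedSubgraph D)
    (h : B ≤ D) : D = B :=
  le_antisymm (hB.2 (isBiconnected_coe_iff.2 hD) h) h

lemma exists_block_ge [Finite V] {D : G.Subgraph} (hD : IsBiconnectedSubgraph D) :
    ∃ B, IsBlock G B ∧ D ≤ B := by
  obtain ⟨B, hB, h⟩ := (Set.toFinite {H : G.Subgraph | IsBiconnected H.coe}).exists_le_maximal
    (isBiconnected_coe_iff.2 hD)
  exact ⟨B, h, hB⟩

lemma exists_block_adj [Finite V] {a b : V} (h : G.Adj a b) : ∃ B, IsBlock G B ∧ B.Adj a b := by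
  obtain ⟨B, hB, hle⟩ := exists_block_ge (isBiconnectedSubgraph_subgraphOfAdj h)
  exact ⟨B, hB, hle.2 (by simp)⟩

lemma exists_block_cycle [Finite V] {u : V} (c : G.Walk u u) (hc : c.IsCycle) :
    ∃ B, IsBlock G B ∧ c.toSubgraph ≤ B := by
  cases c with
  | nil => simp at hc
  | cons h p =>
    rw [Walk.cons_isCycle_iff] at hc
    exact exists_block_ge ((isBiconnectedSubgraph_subgraphOfAdj h).sup_path h.ne.symm (by simp)
      (by simp) p hc.1)

/-- A path between two distinct vertices of a block stays in the block. -/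
lemma IsBlock.path_le {B : G.Subgraph} (hB : IsBlock G B) {u v : V} (huv : u ≠ v)
    (hu : u ∈ B.verts) (hv : v ∈ B.verts) (p : G.Walk u v) (hp : p.IsPath) :
    p.toSubgraph ≤ B := by
  have := hB.eq_of_le (hB.isBiconnectedSubgraph.sup_path huv hu hv p hp) le_sup_left
  rw [← this]
  exact le_sup_right

lemma IsBlock.eq_of_mem {B D : G.Subgraph} (hB : IsBlock G B) (hD : IsBlock G D) {u v : V}
    (huv : u ≠ v) (hu : u ∈ B.verts) (hv : v ∈ B.verts) (hu' : u ∈ D.verts)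
    (hv' : v ∈ D.verts) : B = D := by
  have h := hB.isBiconnectedSubgraph.sup hD.isBiconnectedSubgraph huv hu hv hu' hv'
  exact (hB.eq_of_le h le_sup_left).symm.trans (hD.eq_of_le h le_sup_right)

lemma IsBlock.exists_adj [Finite V] {B : G.Subgraph} (hB : IsBlock G B)
    (hG : ∀ u, ∃ v, G.Adj u v) {u : V} (hu : u ∈ B.verts) : ∃ v, B.Adj u v := by
  by_cases h : ∃ v ∈ B.verts, v ≠ u
  · obtain ⟨v, hv, hvu⟩ := h
    obtain ⟨p⟩ := hB.isBiconnectedSubgraph.reachable u hu v hv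
    cases p with
    | nil => exact absurd rfl hvu
    | cons h p => exact ⟨_, h⟩
  -- A block with a single vertex would not be maximal, because that vertex lies on an edge.
  · push Not at h
    obtain ⟨v, huv⟩ := hG u
    have hle : B ≤ G.subgraphOfAdj huv := by
      refine ⟨fun w hw => by simp [h w hw], fun w x hwx => absurd ?_ hwx.ne⟩
      rw [h w (B.edge_vert hwx), h x (B.edge_vert hwx.symm)]
    rw [← hB.eq_of_le (isBiconnectedSubgraph_subgraphOfAdj huv) hle]
    exact ⟨v, by simp⟩

/-- A path from d to d' avoiding u, continued by the edge d'u, joins two vertices of `B` and so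
stays in `B`. Then the blocks share u and d'. -/
lemma IsBlock.eq_of_reachable_del {B D : G.Subgraph} (hB : IsBlock G B) (hD : IsBlock G D)
    {u d d' : V} (hd : B.Adj u d) (hd' : D.Adj u d') (h : (del G u).Reachable d d') : B = D := by
  obtain ⟨p, hp, hu⟩ := exists_path_of_reachable_del hd.ne.symm h
  have hle := hB.path_le hd.ne.symm (B.edge_vert hd.symm) (B.edge_vert hd)
    (p.concat hd'.adj_sub.symm) (hp.concat hu _)
  refine hB.eq_of_mem hD hd'.ne (B.edge_vert hd) (hle.1 ?_) (D.edge_vert hd')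
    (D.edge_vert hd'.symm)
  rw [Walk.mem_verts_toSubgraph, Walk.support_concat]
  simp

lemma IsBlock.isCutVertex_of_ne [Finite V] {B D : G.Subgraph} (hB : IsBlock G B)
    (hD : IsBlock G D) (hG : ∀ u, ∃ v, G.Adj u v) (hne : B ≠ D) {u : V} (hu : u ∈ B.verts)
    (hu' : u ∈ D.verts) : IsCutVertex G u := by
  obtain ⟨d, hd⟩ := hB.exists_adj hG hu
  obtain ⟨d', hd'⟩ := hD.exists_adj hG hu'
  rw [isCutVertex_iff]
  exact ⟨d, d', hd.ne.symm, hd'.ne.symm, hd.adj_sub.reachable.symm.trans hd'.adj_sub.reachable,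
    fun h => hne (hB.eq_of_reachable_del hD hd hd' h)⟩

/-- The gate of a block: a vertex of the block through which `x` reaches the block. -/
lemma IsBlock.exists_gate {B : G.Subgraph} (hB : IsBlock G B) (hG : G.Connected) (x : V) :
    ∃ g ∈ B.verts, ∀ c ∈ B.verts, c ≠ g → (del G c).Reachable x g := by
  obtain ⟨y, hy⟩ := hB.isBiconnectedSubgraph.nonempty
  obtain ⟨p⟩ := hG.preconnected x y
  induction p with
  | nil => exact ⟨_, hy, fun _ _ _ => .rfl⟩
  | @cons u v w h p ih =>
    by_cases hu : u ∈ B.verts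
    · exact ⟨u, hu, fun _ _ _ => .rfl⟩
    · have step : ∀ c ∈ B.verts, v ≠ c → (del G c).Reachable u v := fun c hc hv =>
        Adj.reachable (G := del G c) ⟨h, fun h' => hu (h' ▸ hc), hv⟩
      by_cases hv : v ∈ B.verts
      · exact ⟨v, hv, fun c hc hcv => step c hc hcv.symm⟩
      · obtain ⟨g, hg, hg'⟩ := ih hy
        exact ⟨g, hg, fun c hc hcg => (step c hc fun h' => hv (h' ▸ hc)).trans (hg' c hc hcg)⟩

end BlockTheory

/-! ### Graphs in which two edges at a vertex always lie on a 4-cycle -/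

section Cherries

variable {V : Type*} {G : SimpleGraph V}

open SimpleGraph

/-- Any two edges with a common end lie on a 4-cycle. -/
def HasCherrySquares (G : SimpleGraph V) : Prop :=
  ∀ x a b, a ≠ b → G.Adj x a → G.Adj x b → ∃ c, c ≠ x ∧ G.Adj c a ∧ G.Adj c b

/-- A square through t-a-i, with i a common neighbour and s the fourth vertex, closes up badly: if s
is a common neighbour, the triangles sat and sbi form a bowtie; otherwise t-a-j-b-i-s is a hexagon
for a second common neighbour j. -/
lemma not_adj_of_maximal_pair [Finite V] (hG : HasSquares G) (hch : HasCherrySquares G) {a b : V}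
    (hab : a ≠ b) (h2 : 2 ≤ (G.commonNeighbors a b).ncard) {t : V}
    (ht : t ∉ G.commonNeighbors a b) (hta : t ≠ a) (htb : t ≠ b) : ¬ G.Adj a t := by
  intro hat
  obtain ⟨i, hi, j, hj, hij⟩ := (Set.one_lt_ncard).1 h2
  rw [mem_commonNeighbors] at hi hj ht
  have hti : t ≠ i := by rintro rfl; exact ht hi
  have htj : t ≠ j := by rintro rfl; exact ht hj
  obtain ⟨s, hsa, hst, hsi⟩ := hch a t i hti hat hi.1
  have hsb : s ≠ b := by rintro rfl; exact ht ⟨hat, hst⟩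
  by_cases hs : G.Adj a s ∧ G.Adj b s
  · refine hG.no_bowtie (s := s) (a := a) (b := t) (c := b) (d := i) ?_ hs.1.symm hat hst.symm
      hs.2.symm hi.2 hsi.symm
    have := hst.ne; have := hsi.ne; have := hi.1.ne; have := hi.2.ne
    grind
  · refine hG.no_hexagon (a := t) (b := a) (c := j) (d := b) (e := i) (f := s) ?_ hat.symm hj.1
      hj.2.symm hi.2 hsi.symm hst
    have := hst.ne; have := hsi.ne; have := hi.1.ne; have := hi.2.ne; have := hj.1.ne
    have := hj.2.ne
    have : s ≠ j := by rintro rfl; exact hs hj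
    grind

/-- A connected graph with squares through all cherries is spanned by a complete bipartite graph
with a side of size two. -/
lemma exists_spanning_pair [Finite V] (hG : HasSquares G) (hch : HasCherrySquares G)
    (hconn : G.Connected) {x y w : V} (hxy : x ≠ y) (hx : G.Adj w x) (hy : G.Adj w y) :
    ∃ a b, a ≠ b ∧ 2 ≤ (G.commonNeighbors a b).ncard ∧
      ∀ t, t ≠ a → t ≠ b → t ∈ G.commonNeighbors a b := by
  -- Take a pair with the most common neighbours; the square on the given cherry shows that there
  -- are at least two.
  have hfin : (Set.toFinite {q : V × V | q.1 ≠ q.2}).toFinset.Nonempty :=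
    ⟨(x, y), by simpa using hxy⟩
  obtain ⟨⟨a, b⟩, hab, hmax⟩ := Finset.exists_max_image _
    (fun q => (G.commonNeighbors q.1 q.2).ncard) hfin
  simp only [Set.Finite.mem_toFinset, Set.mem_ofPred_eq, Prod.forall] at hab hmax
  have h2 : 2 ≤ (G.commonNeighbors a b).ncard := by
    refine le_trans ?_ (hmax x y hxy)
    obtain ⟨c, hc, hcx, hcy⟩ := hch w x y hxy hx hy
    exact (Set.one_lt_ncard).2 ⟨c, ⟨hcx.symm, hcy.symm⟩, w, ⟨hx.symm, hy.symm⟩, hc⟩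
  refine ⟨a, b, hab, h2, ?_⟩
  by_contra! hcon
  obtain ⟨t₀, hta, htb, ht⟩ := hcon
  -- By connectedness some edge dt leaves the set formed by a, b and their common neighbours.
  obtain ⟨d, t, hd, ht, hdt⟩ : ∃ d t, (d = a ∨ d = b ∨ d ∈ G.commonNeighbors a b) ∧
      ¬ (t = a ∨ t = b ∨ t ∈ G.commonNeighbors a b) ∧ G.Adj d t := by
    obtain ⟨p⟩ := hconn.preconnected a t₀
    obtain ⟨e, he, h1, h2⟩ := p.exists_boundary_dart
      {d | d = a ∨ d = b ∨ d ∈ G.commonNeighbors a b} (by simp) (by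
        simp only [Set.mem_ofPred_eq]; tauto)
    exact ⟨_, _, h1, h2, e.adj⟩
  push Not at ht
  obtain ⟨hta, htb, ht⟩ := ht
  rcases hd with rfl | rfl | hd
  · exact not_adj_of_maximal_pair hG hch hab h2 ht hta htb hdt
  · rw [commonNeighbors_symm] at h2 ht
    exact not_adj_of_maximal_pair hG hch hab.symm h2 ht htb hta hdt
  obtain ⟨j, hj, hjd⟩ := Set.exists_ne_of_one_lt_ncard h2 d
  rw [mem_commonNeighbors] at hd hj ht
  have htj : t ≠ j := by rintro rfl; exact ht hj
  have hts : t ≠ d := hdt.ne.symm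
  -- Here d is a common neighbour. If there is a third one besides d and j, the square on the cherry
  -- t-d-a again yields a bowtie or a hexagon.
  by_cases h3 : ∃ k ∈ G.commonNeighbors a b, k ≠ d ∧ k ≠ j
  · obtain ⟨k, hk, hkd, hkj⟩ := h3
    rw [mem_commonNeighbors] at hk
    have := hd.1.ne; have := hd.2.ne; have := hj.1.ne; have := hj.2.ne
    have := hk.1.ne; have := hk.2.ne
    have htk : t ≠ k := by rintro rfl; exact ht hk
    obtain ⟨s, hsd, hst, hsa⟩ := hch d t a hta hdt hd.1.symm
    have := hst.ne; have := hsa.ne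
    by_cases hsb : s = b
    · subst hsb
      exact hG.no_bowtie (s := s) (a := t) (b := d) (c := a) (d := k) (by grind) hst hdt.symm
        hd.2.symm hsa hk.1 hk.2.symm
    by_cases hs : G.Adj a s ∧ G.Adj b s
    · obtain ⟨l, hl, hld, hls⟩ : ∃ l, (G.Adj a l ∧ G.Adj b l) ∧ l ≠ d ∧ l ≠ s := by
        by_cases h : s = j
        · exact ⟨k, hk, hkd, fun h' => hkj (h'.trans h)⟩
        · exact ⟨j, hj, hjd, fun h' => h h'.symm⟩
      have htl : t ≠ l := by rintro rfl; exact ht hl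
      have := hl.1.ne; have := hl.2.ne
      exact hG.no_hexagon (a := d) (b := t) (c := s) (d := a) (e := l) (f := b) (by grind) hdt
        hst.symm hsa hl.1 hl.2.symm hd.2
    · have : s ≠ j := by rintro rfl; exact hs hj
      exact hG.no_hexagon (a := t) (b := d) (c := b) (d := j) (e := a) (f := s) (by grind)
        hdt.symm hd.2.symm hj.2 hj.1.symm hsa.symm hst
  -- Now d and j are the only common neighbours of a and b. By maximality a and b are the only ones
  -- of d and j, and the pair d, j excludes the edge dt.
  · push Not at h3
    have hL : G.commonNeighbors a b = {d, j} := by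
      ext k
      simp only [Set.mem_insert_iff, Set.mem_singleton_iff]
      constructor
      · intro hk
        by_cases h : k = d
        · exact .inl h
        · exact .inr (h3 k hk h)
      · rintro (rfl | rfl)
        exacts [hd, hj]
    have hsub : ({a, b} : Set V) ⊆ G.commonNeighbors d j := by
      rintro k (rfl | rfl)
      exacts [⟨hd.1.symm, hj.1.symm⟩, ⟨hd.2.symm, hj.2.symm⟩]
    have hle := hmax d j hjd.symm
    rw [hL, Set.ncard_pair hjd.symm] at hle
    have heq := Set.eq_of_subset_of_ncard_le hsub (by rwa [Set.ncard_pair hab])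
    refine not_adj_of_maximal_pair hG hch hjd.symm ?_ (t := t) ?_ hts htj hdt
    · rw [← heq, Set.ncard_pair hab]
    · rw [← heq]
      simp [hta, htb]

/-- A common neighbour forces one colour on a and b and the other colour on all remaining vertices,
which leaves no room for further edges. -/
lemma isK2l_of_spanning_pair [Finite V] (hbip : G.IsBipartite) {a b : V} (hab : a ≠ b)
    (h2 : 2 ≤ (G.commonNeighbors a b).ncard)
    (hL : ∀ t, t ≠ a → t ≠ b → t ∈ G.commonNeighbors a b) : IsK2l G := by
  classical
  obtain ⟨c⟩ := hbip
  have hcol : ∀ x y, G.Adj x y → c x ≠ c y := fun x y h => c.valid h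
  have hLn : ∀ t ∈ G.commonNeighbors a b, t ≠ a ∧ t ≠ b := fun t ht =>
    ⟨ht.1.ne.symm, ht.2.ne.symm⟩
  obtain ⟨i, hi⟩ : (G.commonNeighbors a b).Nonempty := by
    rw [← Set.ncard_pos]; omega
  have hba : c b = c a := by
    have h1 := hcol _ _ hi.1
    have h2 := hcol _ _ hi.2
    revert h1 h2
    generalize c a = p; generalize c b = q; generalize c i = r
    revert p q r; decide
  have hLc : ∀ t ∈ G.commonNeighbors a b, c t ≠ c a := fun t ht => (hcol _ _ ht.1).symm
  let e : G.commonNeighbors a b ≃ Fin (G.commonNeighbors a b).ncard := Finite.equivFin _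
  let f : Fin 2 ⊕ Fin (G.commonNeighbors a b).ncard → V :=
    Sum.elim ![a, b] fun k => (e.symm k : V)
  have hf : Function.Bijective f := by
    constructor
    · rintro (k | k) (l | l) h
      · fin_cases k <;> fin_cases l <;> simp_all [f]
      · have := hLn _ (e.symm l).2
        fin_cases k
        exacts [absurd h.symm this.1, absurd h.symm this.2]
      · have := hLn _ (e.symm k).2
        fin_cases l
        exacts [absurd h this.1, absurd h this.2]
      · simpa [f, Subtype.val_inj] using h
    · intro t
      by_cases hta : t = a
      · exact ⟨.inl 0, hta.symm⟩
      by_cases htb : t = b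
      · exact ⟨.inl 1, htb.symm⟩
      exact ⟨.inr (e ⟨t, hL t hta htb⟩), by simp [f]⟩
  have hcf0 : ∀ k, c (f (.inl k)) = c a := by
    intro k
    fin_cases k
    exacts [rfl, hba]
  have hcf1 : ∀ k, c (f (.inr k)) ≠ c a := fun k => hLc _ (e.symm k).2
  have hadj : ∀ k l, G.Adj (f (.inl k)) (f (.inr l)) := by
    intro k l
    fin_cases k
    exacts [(e.symm l).2.1, (e.symm l).2.2]
  refine ⟨_, h2, ⟨RelIso.symm ⟨Equiv.ofBijective f hf, ?_⟩⟩⟩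
  rintro (k | k) (l | l)
  · simpa using fun h => hcol _ _ h ((hcf0 k).trans (hcf0 l).symm)
  · simpa using hadj k l
  · simpa using (hadj l k).symm
  · have h1 := hcf1 k
    have h2 := hcf1 l
    suffices c (f (.inr k)) = c (f (.inr l)) by simpa using fun h => hcol _ _ h this
    revert h1 h2
    generalize c (f (.inr k)) = p; generalize c (f (.inr l)) = q; generalize c a = r
    revert p q r; decide

lemma isK4_of_spanning_pair [Finite V] (hG : HasSquares G) {a b : V} (hab : a ≠ b)
    (h2 : 2 ≤ (G.commonNeighbors a b).ncard)
    (hL : ∀ t, t ≠ a → t ≠ b → t ∈ G.commonNeighbors a b)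
    (hdel : ∀ x, ¬ (del G x).IsBipartite) : IsK4 G := by
  classical
  have hLn : ∀ t ∈ G.commonNeighbors a b, t ≠ a ∧ t ≠ b := fun t ht =>
    ⟨ht.1.ne.symm, ht.2.ne.symm⟩
  -- Without such an edge, colouring a and b against the rest would be proper on `del G x`; the
  -- condition on x ensures that the edge ab does not interfere.
  have hedge : ∀ x, (x = a ∨ x = b ∨ ¬ G.Adj a b) → ∃ i ∈ G.commonNeighbors a b,
      ∃ j ∈ G.commonNeighbors a b, G.Adj i j ∧ i ≠ x ∧ j ≠ x := by
    intro x hx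
    by_contra! hno
    refine hdel x ⟨Coloring.mk (fun t => if t = a ∨ t = b then (0 : Fin 2) else 1) ?_⟩
    rintro u v ⟨huv, hu, hv⟩
    by_cases hu' : u = a ∨ u = b <;> by_cases hv' : v = a ∨ v = b
    · exfalso
      have hxab : ¬ G.Adj a b ∨ x = a ∨ x = b := by tauto
      have := huv.ne
      have := huv.symm
      rcases hu' with rfl | rfl <;> rcases hv' with rfl | rfl <;>
        rcases hxab with h | rfl | rfl <;> contradiction
    · simp [hu', hv']
    · simp [hu', hv']
    · push Not at hu' hv'
      exact absurd (hno u (hL u hu'.1 hu'.2) v (hL v hv'.1 hv'.2) huv hu) (by simpa using hv)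
  -- If a and b are adjacent, a vertex t besides a, b, i, j would give the bowtie of the triangles
  -- abt and aij.
  by_cases hadj : G.Adj a b
  · obtain ⟨i, hi, j, hj, hij, -, -⟩ := hedge a (.inl rfl)
    have hia := hLn i hi
    have hja := hLn j hj
    have hV : ∀ t, t = a ∨ t = b ∨ t = i ∨ t = j := by
      intro t
      by_contra! ht
      obtain ⟨hta, htb, hti, htj⟩ := ht
      have htL := hL t hta htb
      exact hG.no_bowtie (s := a) (a := b) (b := t) (c := i) (d := j)
        (by have := hij.ne; grind) hadj htL.2 htL.1.symm hi.1 hij hj.1.symm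
    have htop : G = ⊤ := by
      ext u v
      simp only [top_adj]
      refine ⟨fun h => h.ne, fun h => ?_⟩
      have h1 := hi.1; have h2 := hi.2; have h3 := hj.1; have h4 := hj.2
      rcases hV u with rfl | rfl | rfl | rfl <;> rcases hV v with rfl | rfl | rfl | rfl <;>
        simp_all [G.adj_comm]
    have hcard : Nat.card V = 4 := by
      rw [← Set.ncard_univ, show (Set.univ : Set V) = {a, b, i, j} by
        ext t; simpa using hV t]
      rw [Set.ncard_insert_of_notMem, Set.ncard_insert_of_notMem, Set.ncard_pair hij.ne] <;>
        simp [hab, hia.1.symm, hia.2.symm, hja.1.symm, hja.2.symm]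
    rw [htop]
    exact ⟨Iso.completeGraph (Finite.equivFinOfCardEq hcard)⟩
  -- If they are not, deleting i leaves another edge kl among the common neighbours; ij and kl
  -- produce a bowtie when they meet and a hexagon when they are disjoint.
  · exfalso
    obtain ⟨i, hi, j, hj, hij, -, -⟩ := hedge a (.inl rfl)
    obtain ⟨k, hk, l, hl, hkl, hki, hli⟩ := hedge i (.inr (.inr hadj))
    have := hLn i hi; have := hLn j hj; have := hLn k hk; have := hLn l hl
    have := hij.ne; have := hkl.ne
    by_cases hjk : j = k
    · subst hjk
      exact hG.no_bowtie (s := j) (a := a) (b := i) (c := b) (d := l) (by grind) hj.1.symm hi.1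
        hij hj.2.symm hl.2 hkl.symm
    by_cases hjl : j = l
    · subst hjl
      exact hG.no_bowtie (s := j) (a := a) (b := i) (c := b) (d := k) (by grind) hj.1.symm hi.1
        hij hj.2.symm hk.2 hkl
    exact hG.no_hexagon (a := i) (b := j) (c := a) (d := k) (e := l) (f := b) (by grind) hij
      hj.1.symm hk.1 hkl hl.2.symm hi.2

/-- A detour around the odd closed walk changes the parity. -/
lemma exists_even_walk {a b : V} (hab : G.Reachable a b) {u : V} (w : G.Walk u u)
    (hw : Odd w.length) (hu : G.Reachable a u) : ∃ p : G.Walk a b, Even p.length := by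
  obtain ⟨p⟩ := hab
  obtain ⟨q⟩ := hu
  by_cases hp : Even p.length
  · exact ⟨p, hp⟩
  · refine ⟨((q.append w).append q.reverse).append p, ?_⟩
    simp only [Walk.length_append, Walk.length_reverse]
    rw [Nat.not_even_iff_odd] at hp
    obtain ⟨m, hm⟩ := hp
    obtain ⟨n, hn⟩ := hw
    exact ⟨q.length + n + m + 1, by omega⟩

lemma exists_two_neighbors [Finite V] (hconn : G.Connected) {x y z : V} (hxy : x ≠ y)
    (hyz : y ≠ z) (hxz : x ≠ z) : ∃ w a b, a ≠ b ∧ G.Adj w a ∧ G.Adj w b := by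
  have : Nontrivial V := ⟨x, y, hxy⟩
  obtain ⟨a, ha⟩ := hconn.preconnected.exists_adj_of_nontrivial x
  by_contra! hno
  have hstep : ∀ t, G.Reachable x t → t = x ∨ t = a := by
    rintro t ⟨p⟩
    by_contra ht
    obtain ⟨e, -, h1, h2⟩ := p.exists_boundary_dart {x, a} (by simp) ht
    simp only [Set.mem_insert_iff, Set.mem_singleton_iff, not_or] at h1 h2
    rcases h1 with h1 | h1
    · exact hno x a e.snd (Ne.symm h2.2) ha (h1 ▸ e.adj)
    · exact hno a x e.snd (Ne.symm h2.1) ha.symm (h1 ▸ e.adj)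
  have h1 := hstep y (hconn.preconnected _ _)
  have h2 := hstep z (hconn.preconnected _ _)
  grind

/-- Biconnectedness provides a walk from a to b avoiding x. In a bipartite graph it is even, since
closing it through x adds two edges; otherwise an odd closed walk in `del G x` corrects its parity.
-/
lemma hasCherrySquares_of_isBiconnected [Finite V] (hG : HasSquares G) (hbi : IsBiconnected G)
    (h : G.IsBipartite ∨ ∀ x, ¬ (del G x).IsBipartite) : HasCherrySquares G := by
  rw [isBiconnected_iff] at hbi
  intro x a b hab ha hb
  have hr := hbi.2 x a b ha.ne.symm hb.ne.symm
  obtain ⟨p, hp⟩ : ∃ p : (del G x).Walk a b, Even p.length := by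
    rcases h with hc | h
    · obtain ⟨p⟩ := hr
      refine ⟨p, ?_⟩
      have := two_colorable_iff_forall_loop_even.1 hc x
        (Walk.cons ha ((p.mapLe (del_le G x)).concat hb.symm))
      simpa [Walk.length_concat, Nat.even_add_one] using this
    · have := mt two_colorable_iff_forall_loop_even.2 (h x)
      push Not at this
      obtain ⟨u, w, hw⟩ := this
      rw [Nat.not_even_iff_odd] at hw
      refine exists_even_walk hr w hw (hbi.2 x a u ha.ne.symm ?_)
      cases w with
      | nil => simp at hw
      | cons h _ => exact h.2.1
  refine hG.exists_common_neighbor hab ha hb (p.mapLe (del_le G x)) ?_ (by simpa using hp)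
  simpa using not_mem_support_of_del ha.ne.symm p

theorem isK2l_of_isBiconnected [Finite V] (hG : HasSquares G) (hbi : IsBiconnected G)
    (hbip : G.IsBipartite) {x y z : V} (hxy : x ≠ y) (hyz : y ≠ z) (hxz : x ≠ z) : IsK2l G := by
  obtain ⟨w, p, q, hpq, hp, hq⟩ := exists_two_neighbors hbi.1 hxy hyz hxz
  obtain ⟨a, b, hab, h2, hL⟩ := exists_spanning_pair hG
    (hasCherrySquares_of_isBiconnected hG hbi (.inl hbip)) hbi.1 hpq hp hq
  exact isK2l_of_spanning_pair hbip hab h2 hL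

theorem isK4_of_isBiconnected [Finite V] (hG : HasSquares G) (hbi : IsBiconnected G)
    (hdel : ∀ x, ¬ (del G x).IsBipartite) : IsK4 G := by
  obtain ⟨w, p, q, hpq, hp, hq⟩ : ∃ w a b, a ≠ b ∧ G.Adj w a ∧ G.Adj w b := by
    obtain ⟨x⟩ := hbi.1.nonempty
    obtain ⟨y, c, hc, -⟩ := exists_odd_cycle (hdel x)
    refine ⟨y, c.snd, c.penultimate, hc.snd_ne_penultimate, ?_, ?_⟩
    · exact (c.adj_snd hc.not_nil).1
    · exact (c.adj_penultimate hc.not_nil).1.symm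
  obtain ⟨a, b, hab, h2, hL⟩ := exists_spanning_pair hG
    (hasCherrySquares_of_isBiconnected hG hbi (.inr hdel)) hbi.1 hpq hp hq
  exact isK4_of_spanning_pair hG hab h2 hL hdel

end Cherries

/-! ### Blocks of graphs with squares -/

section BlockClassification

variable {V : Type*} {G : SimpleGraph V}

open SimpleGraph

lemma HasSquares.coe_subgraph [Finite V] (hG : HasSquares G) (B : G.Subgraph) :
    HasSquares B.coe :=
  hG.of_injective_hom Subtype.val Subtype.val_injective fun _ _ h => B.adj_sub h

/-- With a third vertex the block is a K_{2,l}, by the biconnected case. With only two it is an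
edge, and a bridge: another path between its ends would stay in the block. -/
lemma IsBlock.isK2l_or_isCutEdge [Finite V] (hG : HasSquares G) (hadj : ∀ u, ∃ v, G.Adj u v)
    {B : G.Subgraph} (hB : IsBlock G B) (hbip : B.coe.IsBipartite) :
    IsK2l B.coe ∨ IsCutEdge G B := by
  obtain ⟨u, hu⟩ := hB.isBiconnectedSubgraph.nonempty
  obtain ⟨v, huv⟩ := hB.exists_adj hadj hu
  have hv := B.edge_vert huv.symm
  by_cases h3 : ∃ w ∈ B.verts, w ≠ u ∧ w ≠ v
  · obtain ⟨w, hw, hwu, hwv⟩ := h3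
    left
    exact isK2l_of_isBiconnected (hG.coe_subgraph B) hB.1 hbip (x := ⟨u, hu⟩) (y := ⟨v, hv⟩)
      (z := ⟨w, hw⟩) (by simpa using huv.ne) (by simpa using hwv.symm) (by simpa using hwu.symm)
  · right
    push Not at h3
    have hmem : ∀ w ∈ B.verts, w = u ∨ w = v := fun w hw => by
      by_cases h : w = u
      · exact .inl h
      · exact .inr (h3 w hw h)
    refine ⟨u, v, huv.adj_sub, ?_, ?_⟩
    · rw [isBridge_iff]
      intro hr
      obtain ⟨p, hp⟩ := hr.exists_isPath
      have hle := hB.path_le huv.ne hu hv (p.mapLe (deleteEdges_le _)) (by simpa using hp)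
      cases p with
      | nil => exact huv.ne rfl
      | @cons _ w _ h p =>
        rw [deleteEdges_adj] at h
        have hw : w ∈ B.verts := hle.1 (by simp)
        rcases hmem w hw with rfl | rfl
        · exact h.1.ne rfl
        · exact h.2 rfl
    · ext a b
      · simp only [subgraphOfAdj_verts, Set.mem_insert_iff, Set.mem_singleton_iff]
        exact ⟨hmem a, by rintro (rfl | rfl) <;> assumption⟩
      · simp only [subgraphOfAdj_adj, Sym2.eq_iff]
        constructor
        · intro h
          have := h.ne
          rcases hmem a (B.edge_vert h) with rfl | rfl <;>
            rcases hmem b (B.edge_vert h.symm) with rfl | rfl <;> simp_all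
        · rintro (⟨rfl, rfl⟩ | ⟨rfl, rfl⟩)
          exacts [huv, huv.symm]

lemma exists_first_hit {S : Set V} {x y : V} (p : G.Walk x y) (hy : y ∈ S) :
    ∃ v ∈ S, ∃ q : G.Walk x v, ∀ t ∈ q.support, t ∈ S → t = v := by
  induction p with
  | nil => exact ⟨_, hy, .nil, by simp⟩
  | @cons u w v h p ih =>
    by_cases hu : u ∈ S
    · exact ⟨u, hu, .nil, by simp⟩
    · obtain ⟨v', hv', q, hq⟩ := ih hy
      refine ⟨v', hv', .cons h q, fun t ht htS => ?_⟩
      rw [Walk.support_cons, List.mem_cons] at ht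
      rcases ht with rfl | ht
      · exact absurd htS hu
      · exact hq t ht htS

/-- Otherwise the closed walk around `c`, over to `d`, around `d` and back is even and its second
part meets `c` only in the base point. `HasSquares.length_eq_four` then gives the odd cycle `c`
length four. -/
lemma HasSquares.exists_two_common_vertices [Finite V] (hG : HasSquares G) (hconn : G.Connected)
    {u v : V} (c : G.Walk u u) (d : G.Walk v v) (hc : c.IsCycle) (hco : Odd c.length)
    (hdo : Odd d.length) : ∃ a b, a ≠ b ∧ a ∈ c.support ∧ a ∈ d.support ∧ b ∈ c.support ∧
      b ∈ d.support := by
  classical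
  by_contra! hno
  -- The connection q touches `c` only at its end w; it is trivial if the cycles meet.
  obtain ⟨y, hy, w, hw, q, hq, hyw⟩ : ∃ y ∈ d.support, ∃ w ∈ c.support, ∃ q : G.Walk y w,
      (∀ t ∈ q.support, t ∈ c.support → t = w) ∧ (y ∈ c.support ∨
        ∀ t ∈ d.support, t ∉ c.support) := by
    by_cases h : ∃ y ∈ d.support, y ∈ c.support
    · obtain ⟨y, hy, hy'⟩ := h
      exact ⟨y, hy, y, hy', .nil, by simp, .inl hy'⟩
    · push Not at h
      obtain ⟨p⟩ := hconn.preconnected v u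
      obtain ⟨w, hw, q, hq⟩ := exists_first_hit (S := {t | t ∈ c.support}) p c.start_mem_support
      exact ⟨v, d.start_mem_support, w, hw, q, hq, .inr h⟩
  have h4 := hG.length_eq_four (c.rotate w hw) ((q.reverse.append (d.rotate y hy)).append q)
    (hc.rotate hw) ?_ ?_
  · rw [Walk.length_rotate] at h4
    rw [h4] at hco
    exact absurd hco (by decide)
  · intro t ht ht'
    have ht : t ∈ c.support := by simpa using ht
    have ht' : t ∈ q.support ∨ t ∈ d.support := by
      simp only [Walk.mem_support_append_iff, Walk.support_reverse, List.mem_reverse,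
        Walk.mem_support_rotate_iff] at ht'
      tauto
    rcases ht' with h | h
    · exact hq t h ht
    · rcases hyw with hyw | hyw
      · rw [← hq y q.start_mem_support hyw]
        by_contra hne
        exact hno t y hne ht h hyw hy
      · exact absurd ht (hyw t h)
  · simp only [Walk.length_append, Walk.length_reverse, Walk.length_rotate]
    obtain ⟨m, hm⟩ := hco
    obtain ⟨n, hn⟩ := hdo
    exact ⟨q.length + m + n + 1, by omega⟩

lemma exists_odd_cycle_in_subgraph {B : G.Subgraph} (h : ¬ B.coe.IsBipartite) :
    ∃ (x : V) (c : G.Walk x x), c.IsCycle ∧ Odd c.length ∧ ∀ t ∈ c.support, t ∈ B.verts := by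
  obtain ⟨x, c, hc, hco⟩ := exists_odd_cycle h
  refine ⟨B.hom x, c.map B.hom, hc.map Subtype.val_injective,
    (Walk.length_map B.hom c).symm ▸ hco, ?_⟩
  intro t ht
  rw [Walk.support_map, List.mem_map] at ht
  obtain ⟨s, -, rfl⟩ := ht
  exact s.2

lemma IsBlock.eq_of_not_isBipartite [Finite V] (hG : HasSquares G) (hconn : G.Connected)
    {B D : G.Subgraph} (hB : IsBlock G B) (hD : IsBlock G D) (hBn : ¬ B.coe.IsBipartite)
    (hDn : ¬ D.coe.IsBipartite) : B = D := by
  obtain ⟨x, c, hc, hco, hcB⟩ := exists_odd_cycle_in_subgraph hBn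
  obtain ⟨y, d, hd, hdo, hdD⟩ := exists_odd_cycle_in_subgraph hDn
  obtain ⟨a, b, hab, h1, h2, h3, h4⟩ := hG.exists_two_common_vertices hconn c d hc hco hdo
  exact hB.eq_of_mem hD hab (hcB a h1) (hcB b h3) (hdD a h2) (hdD b h4)

lemma not_isBipartite_of_odd_cycle_le {B : G.Subgraph} {x : V} (c : G.Walk x x)
    (hco : Odd c.length) (hle : c.toSubgraph ≤ B) : ¬ B.coe.IsBipartite := by
  rintro ⟨f⟩
  have key : ∀ (u v : V) (p : G.Walk u v) (hp : p.toSubgraph ≤ B) (hu : u ∈ B.verts)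
      (hv : v ∈ B.verts), ∃ q : B.coe.Walk ⟨u, hu⟩ ⟨v, hv⟩, q.length = p.length := by
    intro u v p
    induction p with
    | nil => exact fun _ _ _ => ⟨.nil, rfl⟩
    | @cons u v w h p ih =>
      intro hp hu hw
      have hv : v ∈ B.verts := hp.1 (by simp)
      obtain ⟨q, hq⟩ := ih (le_trans (by simp [Walk.toSubgraph]) hp) hv hw
      have hadj : B.coe.Adj ⟨u, hu⟩ ⟨v, hv⟩ := hp.2 (by simp)
      exact ⟨.cons hadj q, by simp [hq]⟩
  have hx : x ∈ B.verts := hle.1 (by simp)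
  obtain ⟨q, hq⟩ := key x x c hle hx hx
  have := two_colorable_iff_forall_loop_even.1 ⟨f⟩ _ q
  rw [hq, ← Nat.not_odd_iff_even] at this
  exact this hco

lemma exists_not_isBipartite_block [Finite V] (hG : ¬ G.IsBipartite) :
    ∃ B, IsBlock G B ∧ ¬ B.coe.IsBipartite := by
  obtain ⟨x, c, hc, hco⟩ := exists_odd_cycle hG
  obtain ⟨B, hB, hle⟩ := exists_block_cycle c hc
  exact ⟨B, hB, not_isBipartite_of_odd_cycle_le c hco hle⟩

end BlockClassification

/-! ### Block trees that are paths -/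

section BlockTree

open SimpleGraph

lemma exists_adj_dist_eq {α : Type*} {T : SimpleGraph α} (hT : T.Connected) {b v : α} {k : ℕ}
    (h : T.dist b v = k + 1) : ∃ w, T.Adj v w ∧ T.dist b w = k := by
  obtain ⟨p, hp⟩ := hT.exists_walk_length_eq_dist v b
  rw [dist_comm, h] at hp
  cases p with
  | nil => simp at hp
  | @cons _ w _ hadj q =>
    refine ⟨w, hadj, ?_⟩
    simp only [Walk.length_cons, add_left_inj] at hp
    have h1 : T.dist b w ≤ k := by rw [dist_comm, ← hp]; exact dist_le q
    have h2 := hT.dist_triangle (u := b) (v := w) (w := v)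
    rw [h, dist_eq_one_iff_adj.2 hadj.symm] at h2
    omega

/-- A connected graph of maximum degree two with two vertices of degree one is a path. -/
theorem exists_iso_pathGraph {α : Type*} {T : SimpleGraph α} (hT : T.Connected) {b e : α}
    (hbe : b ≠ e) (hb : ∀ x y, T.Adj b x → T.Adj b y → x = y)
    (he : ∀ x y, T.Adj e x → T.Adj e y → x = y)
    (h2 : ∀ v x y z, T.Adj v x → T.Adj v y → T.Adj v z → x = y ∨ x = z ∨ y = z) :
    ∃ (n : ℕ) (φ : T ≃g pathGraph (n + 1)), φ b = 0 ∧ φ e = Fin.last n := by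
  -- The distance from b is injective: by induction two vertices at distance k+1 have the same
  -- predecessor, which is b or has yet another neighbour at distance k-1.
  have hinj : ∀ k u v, T.dist b u = k → T.dist b v = k → u = v := by
    intro k
    induction k with
    | zero =>
      intro u v hu hv
      rw [hT.dist_eq_zero_iff] at hu hv
      exact hu.symm.trans hv
    | succ k ih =>
      intro u v hu hv
      obtain ⟨u', hu', hdu⟩ := exists_adj_dist_eq hT hu
      obtain ⟨v', hv', hdv⟩ := exists_adj_dist_eq hT hv
      obtain rfl := ih _ _ hdu hdv
      rcases k with - | k
      · rw [hT.dist_eq_zero_iff] at hdu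
        subst hdu
        exact hb _ _ hu'.symm hv'.symm
      · obtain ⟨w, hw, hdw⟩ := exists_adj_dist_eq hT hdu
        rcases h2 u' u v w hu'.symm hv'.symm hw with h | h | h
        · exact h
        · rw [h] at hu; omega
        · rw [h] at hv; omega
  have hlev : ∀ v k, k ≤ T.dist b v → ∃ w, T.dist b w = k := by
    intro v
    suffices ∀ j, j ≤ T.dist b v → ∃ w, T.dist b w = T.dist b v - j by
      intro k hk
      obtain ⟨w, hw⟩ := this (T.dist b v - k) (by omega)
      exact ⟨w, by omega⟩
    intro j
    induction j with
    | zero => exact fun _ => ⟨v, by simp⟩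
    | succ j ih =>
      intro hj
      obtain ⟨w, hw⟩ := ih (by omega)
      obtain ⟨w', -, hw'⟩ := exists_adj_dist_eq hT (k := T.dist b v - (j + 1))
        (by omega : T.dist b w = _)
      exact ⟨w', hw'⟩
  -- A vertex farther away than e would give e a second neighbour besides the one leading back to b.
  have hmax : ∀ v, T.dist b v ≤ T.dist b e := by
    intro v
    by_contra! hlt
    obtain ⟨w, hw⟩ := hlev v (T.dist b e + 1) (by omega)
    obtain ⟨e', hwe, he'⟩ := exists_adj_dist_eq hT hw
    obtain rfl := hinj _ _ _ he' rfl
    have hpos := hT.pos_dist_of_ne hbe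
    obtain ⟨k, hk⟩ := Nat.exists_eq_add_of_lt hpos
    rw [zero_add] at hk
    obtain ⟨w', hw', hdw'⟩ := exists_adj_dist_eq hT hk
    obtain rfl := he _ _ hwe.symm hw'
    omega
  let f : α → Fin (T.dist b e + 1) := fun v => ⟨T.dist b v, Nat.lt_succ_of_le (hmax v)⟩
  have hf : Function.Bijective f := by
    refine ⟨fun u v h => hinj _ _ _ (Fin.ext_iff.1 h) rfl, fun k => ?_⟩
    obtain ⟨w, hw⟩ := hlev e k (by omega)
    exact ⟨w, Fin.ext hw⟩
  refine ⟨T.dist b e, ⟨Equiv.ofBijective f hf, ?_⟩, ?_, ?_⟩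
  · intro u v
    rw [pathGraph_adj]
    simp only [Equiv.ofBijective_apply, f]
    constructor
    · rintro (h | h)
      · obtain ⟨w, hw, hdw⟩ := exists_adj_dist_eq hT h.symm
        rw [hinj _ _ _ hdw rfl] at hw
        exact hw.symm
      · obtain ⟨w, hw, hdw⟩ := exists_adj_dist_eq hT h.symm
        rwa [hinj _ _ _ hdw rfl] at hw
    · intro h
      have h1 := hT.dist_triangle (u := b) (v := u) (w := v)
      have h2 := hT.dist_triangle (u := b) (v := v) (w := u)
      rw [dist_eq_one_iff_adj.2 h] at h1
      rw [dist_eq_one_iff_adj.2 h.symm] at h2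
      have h3 : T.dist b u ≠ T.dist b v := fun h' => h.ne (hinj _ _ _ h' rfl)
      omega
  · exact Fin.ext (by simp [f])
  · rfl

variable {W : Type*} {R : SimpleGraph W}

/-- Consecutive edges of a walk lie in blocks that share a vertex, and a vertex shared by distinct
blocks is a cut vertex. -/
lemma blockTree_connected [Finite W] (hconn : R.Connected) (hadj : ∀ u, ∃ v, R.Adj u v) :
    (blockTree R).Connected := by
  have hsame : ∀ (D E : {B : R.Subgraph // IsBlock R B}) (u : W), u ∈ D.1.verts → u ∈ E.1.verts →
      (blockTree R).Reachable (.inl D) (.inl E) := by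
    intro D E u hD hE
    by_cases h : D = E
    · exact h ▸ .rfl
    · have hcut := D.2.isCutVertex_of_ne E.2 hadj (fun h' => h (Subtype.ext h')) hD hE
      exact (Adj.reachable (v := .inr ⟨u, hcut⟩) hD).trans
        (Adj.reachable (G := blockTree R) (u := .inr ⟨u, hcut⟩) (v := .inl E) hE)
  have hall : ∀ (u v : W) (p : R.Walk u v) (D E : {B : R.Subgraph // IsBlock R B}),
      u ∈ D.1.verts → v ∈ E.1.verts → (blockTree R).Reachable (.inl D) (.inl E) := by
    intro u v p
    induction p with
    | nil => exact fun D E => hsame D E _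
    | cons h p ih =>
      intro D E hD hE
      obtain ⟨B, hB, hB'⟩ := exists_block_adj h
      exact (hsame D ⟨B, hB⟩ _ hD (B.edge_vert hB')).trans
        (ih ⟨B, hB⟩ E (B.edge_vert hB'.symm) hE)
  have hnode : ∀ t, ∃ D, (blockTree R).Reachable t (.inl D) := by
    rintro (D | x)
    · exact ⟨D, .rfl⟩
    · obtain ⟨v, hv⟩ := hadj x
      obtain ⟨B, hB, hB'⟩ := exists_block_adj hv
      exact ⟨⟨B, hB⟩, Adj.reachable (B.edge_vert hB')⟩
  have hne : Nonempty ({B : R.Subgraph // IsBlock R B} ⊕ {x : W // IsCutVertex R x}) := by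
    obtain ⟨u⟩ := hconn.nonempty
    obtain ⟨v, hv⟩ := hadj u
    obtain ⟨B, hB, -⟩ := exists_block_adj hv
    exact ⟨.inl ⟨B, hB⟩⟩
  refine ⟨fun s t => ?_⟩
  obtain ⟨D, hD⟩ := hnode s
  obtain ⟨E, hE⟩ := hnode t
  obtain ⟨u, hu⟩ := D.2.isBiconnectedSubgraph.nonempty
  obtain ⟨v, hv⟩ := E.2.isBiconnectedSubgraph.nonempty
  obtain ⟨p⟩ := hconn.preconnected u v
  exact (hD.trans (hall u v p D E hu hv)).trans hE.symm

/-- If every vertex reaches one of `x₁`, `x₂` after deletion of any other vertex, then the block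
tree is a path from the block of `x₁` to the block of `x₂`. -/
theorem exists_blockTree_iso_pathGraph [Finite W] (hconn : R.Connected)
    (hadj : ∀ u, ∃ v, R.Adj u v) {x₁ x₂ : W}
    (hS : ∀ c a, a ≠ c → (del R c).Reachable a x₁ ∨ (del R c).Reachable a x₂)
    (h₁ : ¬ IsCutVertex R x₁) (h₂ : ¬ IsCutVertex R x₂)
    (B₁ B₂ : {B : R.Subgraph // IsBlock R B}) (hB : B₁ ≠ B₂) (hx₁ : x₁ ∈ B₁.1.verts)
    (hx₂ : x₂ ∈ B₂.1.verts) :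
    ∃ (n : ℕ) (φ : blockTree R ≃g pathGraph (n + 1)),
      φ (.inl B₁) = 0 ∧ φ (.inl B₂) = Fin.last n := by
  -- If x₁ still reached x₂ without c, every remaining vertex would reach x₁, and c would not be a
  -- cut vertex.
  have hsep : ∀ c, IsCutVertex R c → ¬ (del R c).Reachable x₁ x₂ := by
    intro c hc h
    rw [isCutVertex_iff] at hc
    obtain ⟨a, b, ha, hb, -, hab⟩ := hc
    have key : ∀ a, a ≠ c → (del R c).Reachable a x₁ := fun a ha =>
      (hS c a ha).elim id fun h' => h'.trans h.symm
    exact hab ((key a ha).trans (key b hb).symm)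
  -- Any cut vertex of D other than the gates g₁, g₂ is bypassed by the route x₁, g₁, g₂, x₂. So a
  -- block contains at most two cut vertices.
  have hgate : ∀ (D : {B : R.Subgraph // IsBlock R B}) (g₁ g₂ : W),
      (∀ c ∈ D.1.verts, c ≠ g₁ → (del R c).Reachable x₁ g₁) →
      (∀ c ∈ D.1.verts, c ≠ g₂ → (del R c).Reachable x₂ g₂) → g₁ ∈ D.1.verts →
      g₂ ∈ D.1.verts → ∀ c ∈ D.1.verts, IsCutVertex R c → c = g₁ ∨ c = g₂ := by
    intro D g₁ g₂ hg₁ hg₂ hm₁ hm₂ c hc hcut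
    by_contra! hne
    refine hsep c hcut (((hg₁ c hc hne.1).trans ?_).trans (hg₂ c hc hne.2).symm)
    exact (D.2.isBiconnectedSubgraph.reachable_del c g₁ hm₁ g₂ hm₂ hne.1.symm hne.2.symm).mono
      (del_mono (Subgraph.spanningCoe_le _) c)
  -- In a block containing x₁ or x₂ that vertex serves as one gate and is no cut vertex, which
  -- leaves at most one.
  have hend : ∀ (D : {B : R.Subgraph // IsBlock R B}), x₁ ∈ D.1.verts ∨ x₂ ∈ D.1.verts →
      ∀ s t, (blockTree R).Adj (.inl D) s → (blockTree R).Adj (.inl D) t → s = t := by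
    rintro D hD (s | ⟨s, hs⟩) (t | ⟨t, ht⟩) hDs hDt
    all_goals try exact False.elim hDs
    all_goals try exact False.elim hDt
    congr 2
    obtain ⟨g₁, hg₁, hg₁'⟩ := D.2.exists_gate hconn x₁
    obtain ⟨g₂, hg₂, hg₂'⟩ := D.2.exists_gate hconn x₂
    rcases hD with hD | hD
    · have key : ∀ c ∈ D.1.verts, IsCutVertex R c → c = g₂ := fun c hc hcut =>
        (hgate D x₁ g₂ (fun _ _ _ => .rfl) hg₂' hD hg₂ c hc hcut).resolve_left
          fun h => h₁ (h ▸ hcut)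
      rw [key s hDs hs, key t hDt ht]
    · have key : ∀ c ∈ D.1.verts, IsCutVertex R c → c = g₁ := fun c hc hcut =>
        (hgate D g₁ x₂ hg₁' (fun _ _ _ => .rfl) hg₁ hD c hc hcut).resolve_right
          fun h => h₂ (h ▸ hcut)
      rw [key s hDs hs, key t hDt ht]
  refine exists_iso_pathGraph (blockTree_connected hconn hadj) (by simpa using hB)
    (hend B₁ (.inl hx₁)) (hend B₂ (.inr hx₂)) ?_
  rintro (D | c) (x | x) (y | y) (z | z) hx hy hz
  all_goals try exact False.elim hx
  all_goals try exact False.elim hy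
  all_goals try exact False.elim hz
  · obtain ⟨g₁, hg₁, hg₁'⟩ := D.2.exists_gate hconn x₁
    obtain ⟨g₂, hg₂, hg₂'⟩ := D.2.exists_gate hconn x₂
    have key := hgate D g₁ g₂ hg₁' hg₂' hg₁ hg₂
    have h1 := key x hx x.2
    have h2 := key y hy y.2
    have h3 := key z hz z.2
    simp only [Sum.inr.injEq, Subtype.ext_iff]
    grind
  -- Of neighbours of c in three blocks, two reach the same x₁ or x₂ without c, and then their
  -- blocks coincide.
  · have hnb : ∀ D : {B : R.Subgraph // IsBlock R B}, (c : W) ∈ D.1.verts →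
        ∃ d, D.1.Adj c d ∧ ((del R c).Reachable d x₁ ∨ (del R c).Reachable d x₂) := by
      intro D hD
      obtain ⟨d, hd⟩ := D.2.exists_adj hadj hD
      exact ⟨d, hd, hS c d hd.ne.symm⟩
    have heq : ∀ (D E : {B : R.Subgraph // IsBlock R B}) (d e : W), D.1.Adj c d → E.1.Adj c e →
        (del R c).Reachable d e → (Sum.inl D : _ ⊕ {x : W // IsCutVertex R x}) = .inl E :=
      fun D E d e hd he h => congrArg _ (Subtype.ext (D.2.eq_of_reachable_del E.2 hd he h))
    obtain ⟨d, hd, hd'⟩ := hnb x hx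
    obtain ⟨e, he, he'⟩ := hnb y hy
    obtain ⟨f, hf, hf'⟩ := hnb z hz
    rcases hd' with hd' | hd' <;> rcases he' with he' | he' <;> rcases hf' with hf' | hf'
    all_goals first
      | exact .inl (heq x y d e hd he (hd'.trans he'.symm))
      | exact .inr (.inl (heq x z d f hd hf (hd'.trans hf'.symm)))
      | exact .inr (.inr (heq y z e f he hf (he'.trans hf'.symm)))

end BlockTree

/-! ### Splitting a vertex -/

section Split

variable {U : Type u} {H : SimpleGraph U}

open SimpleGraph

/-- The map contracting the two copies `some x`, `none` of `x`. -/
def unsplit (x : U) (p : Option U) : U := p.getD x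

open scoped Classical in
/-- The colours of the vertices after splitting `x`. -/
noncomputable def splitColor (x : U) (col : U → Bool) : Option U → Bool
  | none => false
  | some a => if a = x then true else col a

/-- The graph obtained from `H` by splitting the vertex `x` into `some x` and `none`, which take
over the neighbours of `x` of colour `false` and `true`, respectively. -/
def splitGraph (H : SimpleGraph U) (x : U) (col : U → Bool) : SimpleGraph (Option U) where
  Adj p q := H.Adj (unsplit x p) (unsplit x q) ∧ splitColor x col p ≠ splitColor x col q
  symm := ⟨fun _ _ h => ⟨h.1.symm, h.2.symm⟩⟩
  loopless := ⟨fun _ h => h.2 rfl⟩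

lemma unsplit_some (x a : U) : unsplit x (some a) = a := rfl

lemma unsplit_eq_iff {x : U} {p q : Option U} : unsplit x p = unsplit x q ↔
    p = q ∨ (p = some x ∧ q = none) ∨ (p = none ∧ q = some x) := by
  rcases p with - | p <;> rcases q with - | q <;> simp [unsplit, eq_comm]

lemma eq_of_unsplit_eq {x : U} {p q : Option U} (h : unsplit x p = unsplit x q)
    (hp : unsplit x p ≠ x) : p = q := by
  rcases p with - | p <;> rcases q with - | q <;> simp_all [unsplit]

lemma eq_of_splitColor_eq {x : U} {col : U → Bool} {p q : Option U}
    (h : unsplit x p = unsplit x q) (hc : splitColor x col p = splitColor x col q) : p = q := by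
  rcases unsplit_eq_iff.1 h with h | ⟨rfl, rfl⟩ | ⟨rfl, rfl⟩
  · exact h
  · simp [splitColor] at hc
  · simp [splitColor] at hc

lemma splitColor_some {x a : U} {col : U → Bool} (h : a ≠ x) :
    splitColor x col (some a) = col a := if_neg h

variable {x : U} {col : U → Bool}

lemma exists_splitGraph_adj (hcol : ∀ a b, (del H x).Adj a b → col a ≠ col b) {a b : U}
    (h : H.Adj a b) (ha : a ≠ x) : ∃ q, unsplit x q = b ∧ (splitGraph H x col).Adj (some a) q := by
  by_cases hb : b = x
  · subst hb
    by_cases hc : col a = true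
    · exact ⟨none, rfl, h, by simp [splitColor, ha, hc]⟩
    · exact ⟨some b, rfl, h, by simp [splitColor, ha, hc]⟩
  · exact ⟨some b, rfl, h, by
      rw [splitColor_some ha, splitColor_some hb]; exact hcol a b ⟨h, ha, hb⟩⟩

/-- At most one end of an edge is x, and the colour of the other end decides which copy of x is
used. -/
lemma splitGraph_lift_unique {a b a' b' : Option U} (h : (splitGraph H x col).Adj a b)
    (h' : (splitGraph H x col).Adj a' b') (ha : unsplit x a' = unsplit x a)
    (hb : unsplit x b' = unsplit x b) : a' = a ∧ b' = b := by
  have h1 := h.2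
  have h2 := h'.2
  by_cases hx : unsplit x b = x
  · have hax : unsplit x a ≠ x := fun h0 => h.1.ne (h0.trans hx.symm)
    obtain rfl := eq_of_unsplit_eq ha.symm hax
    refine ⟨rfl, eq_of_splitColor_eq (col := col) hb ?_⟩
    revert h1 h2
    cases splitColor x col a <;> cases splitColor x col b <;> cases splitColor x col b' <;> simp
  · obtain rfl := eq_of_unsplit_eq hb.symm hx
    refine ⟨eq_of_splitColor_eq (col := col) ha ?_, rfl⟩
    revert h1 h2
    cases splitColor x col a <;> cases splitColor x col b <;> cases splitColor x col a' <;> simp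

lemma isVertexIdentification_splitGraph (hcol : ∀ a b, (del H x).Adj a b → col a ≠ col b) :
    IsVertexIdentification (splitGraph H x col) (some x) none H := by
  refine ⟨unsplit x, fun a => ⟨some a, rfl⟩, fun _ _ => unsplit_eq_iff,
    fun p q => ⟨fun h => ?_, ?_⟩⟩
  · by_cases hp : p = x
    · obtain ⟨a, ha, hadj⟩ := exists_splitGraph_adj hcol h.symm
        (fun hq => h.ne (hp.trans hq.symm))
      exact ⟨a, some q, hadj.symm, ha, rfl⟩
    · obtain ⟨b, hb, hadj⟩ := exists_splitGraph_adj hcol h hp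
      exact ⟨some p, b, hadj, rfl, hb⟩
  · rintro ⟨a, b, hab, rfl, rfl⟩
    exact hab.1

/-- The square found in `H` for the push-forward lifts edge by edge. Its vertices are distinct, so
at most one is x, and only there could the lifts fail to fit. The colours alternate along the four
edges, so the two lifts of x have the same colour and agree. -/
lemma splitGraph_hasSquares [Finite U] (hH : HasSquares H) : HasSquares (splitGraph H x col) := by
  cases nonempty_fintype U
  intro z hz a b hab
  have hval : ∀ p q, z p q ≠ 0 → push (unsplit x) z (unsplit x p) (unsplit x q) = z p q :=
    fun p q hpq => push_eq p q rfl rfl fun a' b' ha hb hz' =>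
      splitGraph_lift_unique (hz.adj _ _ hpq) (hz.adj _ _ hz') ha hb
  have hker : IsKernel H (push (unsplit x) z) :=
    hz.push (fun _ _ (h : (splitGraph H x col).Adj _ _) => h.1)
  obtain ⟨c, d, hca, hdb, h1, h2, h3⟩ := hH _ hker (unsplit x a) (unsplit x b)
    (by rwa [hval a b hab])
  have hcd := (hker.adj _ _ h2).ne
  have hbc := (hker.adj _ _ h1).ne
  have hda := (hker.adj _ _ h3).ne
  obtain ⟨b₁, c₁, hb₁, hc₁, hz₁⟩ := push_ne_zero h1
  obtain ⟨c₂, d₂, hc₂, hd₂, hz₂⟩ := push_ne_zero h2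
  obtain ⟨d₃, a₃, hd₃, ha₃, hz₃⟩ := push_ne_zero h3
  have k0 := hz.adj _ _ hab
  have k1 := hz.adj _ _ hz₁
  have k2 := hz.adj _ _ hz₂
  have k3 := hz.adj _ _ hz₃
  have e0 := k0.2
  have e1 := k1.2
  have e2 := k2.2
  have e3 := k3.2
  have hab' := k0.1.ne
  have key : ∀ p q, unsplit x p = unsplit x q → unsplit x p ≠ x → p = q :=
    fun p q => eq_of_unsplit_eq
  have key' : ∀ p q, unsplit x p = unsplit x q → splitColor x col p = splitColor x col q → p = q :=
    fun p q => eq_of_splitColor_eq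
  obtain ⟨rfl, rfl, rfl, rfl⟩ : b₁ = b ∧ c₂ = c₁ ∧ d₃ = d₂ ∧ a₃ = a := by
    have ha' : unsplit x a ≠ x → a₃ = a := fun h => key _ _ ha₃ (by rwa [ha₃])
    have hb' : unsplit x b ≠ x → b₁ = b := fun h => key _ _ hb₁ (by rwa [hb₁])
    have hc' : c ≠ x → c₂ = c₁ := fun h => key _ _ (hc₂.trans hc₁.symm) (by rwa [hc₂])
    have hd' : d ≠ x → d₃ = d₂ := fun h => key _ _ (hd₃.trans hd₂.symm) (by rwa [hd₃])
    have ka := key' a₃ a ha₃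
    have kb := key' b₁ b hb₁
    have kc := key' c₂ c₁ (hc₂.trans hc₁.symm)
    have kd := key' d₃ d₂ (hd₃.trans hd₂.symm)
    clear key key' hval
    have dich : ∀ {s t r : Bool}, s ≠ t → t ≠ r → s = r := by decide
    have f0 := @dich _ _ (splitColor x col c₁) e0
    have f1 := @dich _ _ (splitColor x col d₂) e1
    have f2 := @dich _ _ (splitColor x col a₃) e2
    have f3 := @dich _ _ (splitColor x col b) e3
    grind
  exact ⟨c₂, d₃, fun h => hca (by rw [← hc₁, h]), fun h => hdb (by rw [← hd₂, h]), hz₁, hz₂, hz₃⟩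

/-- Within such a block, vertices of opposite colours are adjacent. This puts the two copies of a
split vertex into different blocks. -/
lemma not_mem_of_isK2l_or_isCutEdge {W : Type*} {R : SimpleGraph W} {c : R.Coloring Bool}
    {B : R.Subgraph} (hB : IsK2l B.coe ∨ IsCutEdge R B) {p q : W} (hpq : c p ≠ c q)
    (hadj : ¬ R.Adj p q) (hp : p ∈ B.verts) : q ∉ B.verts := by
  intro hq
  rcases hB with ⟨l, hl, ⟨e⟩⟩ | ⟨a, b, h, -, rfl⟩
  · have hno : ¬ ∃ t, (K2 l).Adj (e ⟨p, hp⟩) t ∧ (K2 l).Adj (e ⟨q, hq⟩) t := by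
      rintro ⟨t, ht1, ht2⟩
      obtain ⟨t, rfl⟩ := e.surjective t
      rw [e.map_adj_iff] at ht1 ht2
      have h1 := c.valid (B.adj_sub ht1)
      have h2 := c.valid (B.adj_sub ht2)
      revert h1 h2 hpq
      cases c p <;> cases c q <;> cases c (t : W) <;> simp
    have hna : ¬ (K2 l).Adj (e ⟨p, hp⟩) (e ⟨q, hq⟩) := by
      rw [e.map_adj_iff]
      exact fun h => hadj (B.adj_sub h)
    revert hno hna
    rcases e ⟨p, hp⟩ with i | i <;> rcases e ⟨q, hq⟩ with j | j
    · intro h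
      exact absurd ⟨.inr ⟨0, by omega⟩, by simp, by simp⟩ h
    · intro _ h
      exact absurd (by simp) h
    · intro _ h
      exact absurd (by simp) h
    · intro h
      exact absurd ⟨.inl 0, by simp, by simp⟩ h
  · simp only [subgraphOfAdj_verts, Set.mem_insert_iff, Set.mem_singleton_iff] at hp hq
    rcases hp with rfl | rfl <;> rcases hq with rfl | rfl
    · exact hpq rfl
    · exact hadj h
    · exact hadj h.symm
    · exact hpq rfl

/-- Otherwise giving x the colour i would make `H` bipartite. -/
lemma exists_neighbor_of_color (hH : ¬ H.IsBipartite)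
    (hcol : ∀ a b, (del H x).Adj a b → col a ≠ col b) (i : Bool) :
    ∃ n, H.Adj x n ∧ n ≠ x ∧ col n = i := by
  classical
  by_contra! hno
  refine hH (Coloring.colorable (α := Bool) (Coloring.mk
    (fun t => if t = x then i else col t) ?_))
  intro u v huv
  by_cases hu : u = x
  · subst hu
    simpa [huv.ne.symm] using (hno v huv huv.ne.symm).symm
  by_cases hv : v = x
  · subst hv
    simpa [huv.ne] using hno u huv.symm huv.ne
  · simpa [hu, hv] using hcol u v ⟨huv, hu, hv⟩

/-- Splitting x along a 2-colouring of `del H x` undoes the identification that forms a necklace.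
The split graph is bipartite and keeps the squares, so its blocks are known. Biconnectedness of `H`
shows that the copies of x are not cut vertices and that the block tree is a path between their
blocks. -/
theorem isNecklaceK2_of_del_isBipartite [Finite U] (hsq : HasSquares H) (hbi : IsBiconnected H)
    (hH : ¬ H.IsBipartite) {x : U} (hx : (del H x).IsBipartite) : IsNecklaceK2 H := by
  obtain ⟨c⟩ := hx
  let col : U → Bool := fun a => finTwoEquiv (c a)
  have hcol : ∀ a b, (del H x).Adj a b → col a ≠ col b := fun a b h h' =>
    c.valid h (finTwoEquiv.injective h')
  rw [isBiconnected_iff] at hbi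
  set R := splitGraph H x col with hR
  let kol : R.Coloring Bool := Coloring.mk (splitColor x col) fun h => h.2
  have hkol : kol (some x) ≠ kol none := by
    change splitColor x col (some x) ≠ splitColor x col none
    simp [splitColor]
  have hRbip : R.IsBipartite := kol.colorable
  have hRsq : HasSquares R := splitGraph_hasSquares hsq
  obtain ⟨n₁, hn₁, hn₁x, hc₁⟩ := exists_neighbor_of_color hH hcol false
  obtain ⟨n₂, hn₂, hn₂x, hc₂⟩ := exists_neighbor_of_color hH hcol true
  have hadj₁ : R.Adj (some n₁) (some x) := ⟨hn₁.symm, by simp [splitColor, hn₁x, hc₁]⟩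
  have hadj₂ : R.Adj (some n₂) none := ⟨hn₂.symm, by simp [splitColor, hn₂x, hc₂]⟩
  have hlift : ∀ y, y = some x ∨ y = none → ∀ a b, (del H x).Reachable a b →
      (del R y).Reachable (some a) (some b) := by
    intro y hy a b h
    refine h.map (G' := del R y) ⟨some, fun {u v} (huv : (del H x).Adj u v) =>
      ⟨⟨huv.1, ?_⟩, ?_, ?_⟩⟩
    · rw [splitColor_some huv.2.1, splitColor_some huv.2.2]
      exact hcol _ _ huv
    · rcases hy with rfl | rfl
      · simpa using huv.2.1
      · simp
    · rcases hy with rfl | rfl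
      · simpa using huv.2.2
      · simp
  have hto₂ : ∀ a, a ≠ some x → (del R (some x)).Reachable a none := by
    rintro (- | a) ha
    · exact .rfl
    · exact (hlift _ (.inl rfl) a n₂ (hbi.2 x a n₂ (by simpa using ha) hn₂x)).trans
        (Adj.reachable (G := del R (some x)) ⟨hadj₂, by simpa using hn₂x, by simp⟩)
  have hto₁ : ∀ a, a ≠ none → (del R none).Reachable a (some x) := by
    rintro (- | a) ha
    · exact absurd rfl ha
    · by_cases hax : a = x
      · exact hax ▸ .rfl
      · exact (hlift _ (.inr rfl) a n₁ (hbi.2 x a n₁ hax hn₁x)).trans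
          (Adj.reachable (G := del R none) ⟨hadj₁, by simp, by simp⟩)
  have hconn : R.Connected := by
    have hr : ∀ a, R.Reachable a (some x) := by
      rintro (- | a)
      · exact hadj₂.symm.reachable.trans ((hto₁ (some n₂) (by simp)).mono (del_le _ _))
      · exact (hto₁ (some a) (by simp)).mono (del_le _ _)
    exact ⟨fun a b => (hr a).trans (hr b).symm⟩
  have hRadj : ∀ u, ∃ v, R.Adj u v := by
    have : Nontrivial (Option U) := ⟨some x, none, by simp⟩
    exact fun u => hconn.preconnected.exists_adj_of_nontrivial u
  have hS : ∀ c a, a ≠ c → (del R c).Reachable a (some x) ∨ (del R c).Reachable a none := by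
    rintro (- | c) a hac
    · exact .inl (hto₁ a hac)
    by_cases hcx : c = x
    · subst hcx
      exact .inr (hto₂ a hac)
    -- Lift a walk of `H` from u to x that avoids c and stop at the first copy of x; which copy it
    -- is depends on the colour of the vertex before.
    have key : ∀ u v (p : (del H c).Walk u v), v = x → ∀ q, unsplit x q = u →
        (del R (some c)).Reachable q (some x) ∨ (del R (some c)).Reachable q none := by
      have hbase : ∀ q, unsplit x q = x →
          (del R (some c)).Reachable q (some x) ∨ (del R (some c)).Reachable q none := by
        rintro (- | q) hq
        · exact .inr .rfl
        · rw [unsplit_some] at hq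
          subst hq
          exact .inl .rfl
      intro u v p
      induction p with
      | nil => exact fun hv q hq => hbase q (hq.trans hv)
      | @cons u v w h p ih =>
        intro hw q hq
        by_cases hux : u = x
        · exact hbase q (hq.trans hux)
        obtain rfl : q = some u := eq_of_unsplit_eq (x := x) hq (by rwa [hq])
        obtain ⟨r, hr, hqr⟩ := exists_splitGraph_adj hcol h.1 hux
        have hstep : (del R (some c)).Reachable (some u) r :=
          Adj.reachable (G := del R (some c)) ⟨hqr, by simpa using h.2.1, by
            rintro rfl
            exact h.2.2 hr.symm⟩
        exact (ih hw r hr).imp hstep.trans hstep.trans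
    have hne : unsplit x a ≠ c := by
      rintro rfl
      rcases a with - | a
      · exact hcx rfl
      · exact hac rfl
    obtain ⟨p⟩ := hbi.2 c (unsplit x a) x hne (Ne.symm hcx)
    exact key _ _ p rfl a rfl
  have hcut₁ : ¬ IsCutVertex R (some x) := by
    rw [isCutVertex_iff]
    rintro ⟨a, b, ha, hb, -, hab⟩
    exact hab ((hto₂ a ha).trans (hto₂ b hb).symm)
  have hcut₂ : ¬ IsCutVertex R none := by
    rw [isCutVertex_iff]
    rintro ⟨a, b, ha, hb, -, hab⟩
    exact hab ((hto₁ a ha).trans (hto₁ b hb).symm)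
  have hblocks : ∀ B, IsBlock R B → IsK2l B.coe ∨ IsCutEdge R B := fun B hB =>
    hB.isK2l_or_isCutEdge hRsq hRadj (hRbip.of_hom B.hom)
  have hnadj : ¬ R.Adj (some x) none := fun h => h.1.ne rfl
  obtain ⟨B₁, hB₁, hB₁'⟩ := exists_block_adj hadj₁
  obtain ⟨B₂, hB₂, hB₂'⟩ := exists_block_adj hadj₂
  have hm₁ := B₁.edge_vert hB₁'.symm
  have hm₂ := B₂.edge_vert hB₂'.symm
  have hB : B₁ ≠ B₂ := by
    rintro rfl
    exact not_mem_of_isK2l_or_isCutEdge (hblocks B₁ hB₁) hkol hnadj hm₁ hm₂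
  obtain ⟨n, φ, hφ₁, hφ₂⟩ := exists_blockTree_iso_pathGraph hconn hRadj hS hcut₁ hcut₂
    ⟨B₁, hB₁⟩ ⟨B₂, hB₂⟩ (by simpa using hB) hm₁ hm₂
  refine ⟨Option U, inferInstance, R, some x, none, n, φ, ⟨B₁, hB₁⟩, ⟨B₂, hB₂⟩, hRbip, hblocks,
    hφ₁, hφ₂, by simpa using hB, hm₁, hm₂, hcut₁, hcut₂, hnadj, ?_,
    isVertexIdentification_splitGraph hcol⟩
  obtain ⟨p, hp⟩ := hconn.exists_walk_length_eq_dist (some x) none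
  rw [← hp, kol.odd_length_iff_not_congr]
  revert hkol
  cases kol (some x) <;> cases kol none <;> simp

end Split

/-! ### Kernels and blocks -/

section KernelBlocks

variable {V : Type*} {G : SimpleGraph V}

open SimpleGraph

/-- The graph `G` without the edges of a subgraph. -/
def compl (D : G.Subgraph) : SimpleGraph V where
  Adj u v := G.Adj u v ∧ ¬ D.Adj u v
  symm := ⟨fun _ _ h => ⟨h.1.symm, fun h' => h.2 h'.symm⟩⟩
  loopless := ⟨fun _ h => h.1.ne rfl⟩

lemma compl_adj {D : G.Subgraph} {u v : V} : (compl D).Adj u v ↔ G.Adj u v ∧ ¬ D.Adj u v :=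
  Iff.rfl

lemma compl_le (D : G.Subgraph) : compl D ≤ G := fun _ _ h => h.1

/-- A path between distinct vertices of `D` stays in `D`, hence uses its edges. So the part of `G`
hanging off `D` at a vertex meets `D` in that vertex only. -/
lemma IsBlock.eq_of_reachable_compl {D : G.Subgraph} (hD : IsBlock G D) {v w : V}
    (hv : v ∈ D.verts) (hw : w ∈ D.verts) (h : (compl D).Reachable v w) : v = w := by
  by_contra hne
  obtain ⟨p, hp⟩ := h.exists_isPath
  have hle := hD.path_le hne hv hw (p.mapLe (compl_le D)) (by simpa using hp)
  cases p with
  | nil => exact hne rfl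
  | cons h p => exact h.2 (hle.2 (by simp))

open scoped Classical in
/-- The restriction of a weighting to the edges of a graph. -/
noncomputable def restrictAdj {α : Type*} (Γ : SimpleGraph α) (z : α → α → ℤ) (x y : α) : ℤ :=
  if Γ.Adj x y then z x y else 0

lemma restrictAdj_ne_zero {α : Type*} {Γ : SimpleGraph α} {z : α → α → ℤ} {x y : α}
    (h : restrictAdj Γ z x y ≠ 0) : Γ.Adj x y ∧ restrictAdj Γ z x y = z x y := by
  classical
  unfold restrictAdj at *
  split_ifs at * with h' <;> simp_all

lemma restrictAdj_symm {α : Type*} {Γ : SimpleGraph α} {z : α → α → ℤ}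
    (hz : ∀ x y, z x y = z y x) (x y : α) : restrictAdj Γ z x y = restrictAdj Γ z y x := by
  classical
  unfold restrictAdj
  rw [if_congr (Γ.adj_comm x y) (hz x y) rfl]

lemma IsKernel.of_restrictAdj {α : Type*} {Γ : SimpleGraph α} {z : α → α → ℤ}
    (hz : ∀ x y, z x y = z y x) (h : ∀ x, ∑ᶠ y, restrictAdj Γ z x y = 0) :
    IsKernel Γ (restrictAdj Γ z) :=
  ⟨restrictAdj_symm hz, fun _ _ h => (restrictAdj_ne_zero h).1, h⟩

/-- A conformal square of a restriction is one of the weighting. -/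
lemma conformal_of_restrictAdj {α : Type*} {Γ : SimpleGraph α} (hΓ : HasConformalSquares Γ)
    {z : α → α → ℤ} (hz : IsKernel Γ (restrictAdj Γ z)) {x y : α} (h : restrictAdj Γ z x y ≠ 0) :
    ∃ a b c d, 0 < z a b ∧ z b c < 0 ∧ 0 < z c d ∧ z d a < 0 := by
  obtain ⟨a, b, c, d, h1, h2, h3, h4⟩ := hΓ _ hz x y h
  rw [(restrictAdj_ne_zero h1.ne').2] at h1
  rw [(restrictAdj_ne_zero h2.ne).2] at h2
  rw [(restrictAdj_ne_zero h3.ne').2] at h3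
  rw [(restrictAdj_ne_zero h4.ne).2] at h4
  exact ⟨a, b, c, d, h1, h2, h3, h4⟩

/-- Row sums of the restriction of a kernel element to a block vanish at the vertices whose
hanging part is bipartite. -/
lemma IsBlock.sum_restrictAdj_eq_zero [Fintype V] {D : G.Subgraph} (hD : IsBlock G D)
    {z : V → V → ℤ} (hz : IsKernel G z) {v : V} (hv : v ∈ D.verts)
    (heven : ∀ p : (compl D).Walk v v, Even p.length) :
    ∑ y, restrictAdj D.spanningCoe z v y = 0 := by
  classical
  -- Here t is z on the part hanging at v, and ε is its 2-colouring. The rows of t away from v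
  -- vanish, and the row of v is minus the sum in question, so the signed row sum isolates it.
  let ε : V → ℤ := fun u => if ∃ p : (compl D).Walk v u, Even p.length then 1 else -1
  let t : V → V → ℤ := fun u w =>
    if (compl D).Reachable v u ∧ (compl D).Adj u w then z u w else 0
  have ht : ∀ x y, t x y = t y x := by
    intro x y
    refine if_congr ⟨fun h => ⟨h.1.trans h.2.reachable, h.2.symm⟩,
      fun h => ⟨h.1.trans h.2.reachable, h.2.symm⟩⟩ (hz.symm x y) rfl
  have hε : ∀ x y, t x y ≠ 0 → ε x = - ε y := by
    intro x y hxy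
    obtain ⟨⟨⟨q⟩, hadj⟩, -⟩ := (ite_ne_right_iff).1 hxy
    by_cases hx : ∃ p : (compl D).Walk v x, Even p.length
    · have hy : ¬ ∃ p : (compl D).Walk v y, Even p.length := by
        rintro ⟨r, hr⟩
        obtain ⟨p, hp⟩ := hx
        have := heven ((p.concat hadj).append r.reverse)
        simp only [Walk.length_append, Walk.length_concat, Walk.length_reverse] at this
        rw [Nat.even_add, Nat.even_add_one] at this
        tauto
      simp only [ε, if_pos hx, if_neg hy]
      rfl
    · have hy : ∃ p : (compl D).Walk v y, Even p.length := by
        refine ⟨q.concat hadj, ?_⟩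
        rw [Walk.length_concat, Nat.even_add_one]
        exact fun h => hx ⟨q, h⟩
      simp only [ε, if_neg hx, if_pos hy]
  have h0 := sum_sign_mul_sum_eq_zero ht ε hε
  have hrow : ∀ u, (compl D).Reachable v u →
      ∑ y, t u y = - ∑ y, restrictAdj D.spanningCoe z u y := by
    intro u hu
    have := hz.sum u
    rw [finsum_eq_sum_of_fintype] at this
    rw [eq_neg_iff_add_eq_zero, ← Finset.sum_add_distrib, ← this]
    refine Finset.sum_congr rfl fun y _ => ?_
    by_cases hadj : G.Adj u y
    · by_cases hDadj : D.Adj u y <;> simp [t, hu, compl_adj, restrictAdj, hadj, hDadj]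
    · have hDadj : ¬ D.Adj u y := fun h => hadj h.adj_sub
      have : z u y = 0 := by
        by_contra h
        exact hadj (hz.adj _ _ h)
      simp [t, restrictAdj, this]
  rw [Finset.sum_eq_single v] at h0
  · rw [hrow v .rfl] at h0
    have hεv : ε v ≠ 0 := by simp only [ε]; split_ifs <;> decide
    simpa [hεv] using h0
  · intro u _ huv
    by_cases hu : (compl D).Reachable v u
    · have huD : u ∉ D.verts := fun h => huv (hD.eq_of_reachable_compl hv h hu).symm
      rw [hrow u hu, Finset.sum_eq_zero, neg_zero, mul_zero]
      intro y _
      by_contra h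
      exact huD (D.edge_vert (restrictAdj_ne_zero h).1)
    · rw [Finset.sum_eq_zero, mul_zero]
      intro y _
      exact if_neg fun h => hu h.1
  · simp

/-- If at most one block is not bipartite, then the restriction of a kernel element to a block is
a kernel element. -/
lemma IsBlock.sum_restrictAdj [Fintype V]
    (huniq : ∀ B D : G.Subgraph, IsBlock G B → IsBlock G D → ¬ B.coe.IsBipartite →
      ¬ D.coe.IsBipartite → B = D) {D : G.Subgraph} (hD : IsBlock G D)
    {z : V → V → ℤ} (hz : IsKernel G z) (v : V) :
    ∑ y, restrictAdj D.spanningCoe z v y = 0 := by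
  classical
  have hout : ∀ u, u ∉ D.verts → ∑ y, restrictAdj D.spanningCoe z u y = 0 := by
    intro u hu
    refine Finset.sum_eq_zero fun y _ => ?_
    by_contra h
    exact hu (D.edge_vert (restrictAdj_ne_zero h).1)
  by_cases hv : v ∈ D.verts
  swap
  · exact hout v hv
  by_cases heven : ∀ p : (compl D).Walk v v, Even p.length
  · exact hD.sum_restrictAdj_eq_zero hz hv heven
  -- An odd closed walk off the edges of D contains an odd cycle, hence reaches a non-bipartite
  -- block other than D.
  have hodd : ∀ u, (∃ p : (compl D).Walk u u, ¬ Even p.length) → ∃ B : G.Subgraph, IsBlock G B ∧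
      ¬ B.coe.IsBipartite ∧ B ≠ D ∧ ∃ t ∈ B.verts, (compl D).Reachable u t := by
    rintro u ⟨p, hp⟩
    obtain ⟨x, c, hc, ho, hr⟩ := exists_odd_cycle_of_odd_loop p (Nat.not_even_iff_odd.1 hp)
    obtain ⟨B, hB, hle⟩ := exists_block_cycle (c.mapLe (compl_le D)) (by simpa using hc)
    refine ⟨B, hB, not_isBipartite_of_odd_cycle_le _ (by simpa using ho) hle, ?_, x,
      hle.1 (by simp), hr⟩
    rintro rfl
    have hadj := c.adj_snd hc.not_nil
    refine hadj.2 (hle.2 ?_)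
    rw [Walk.adj_toSubgraph_iff_mem_edges]
    have := c.mk_start_snd_mem_edges hc.not_nil
    simpa using this
  push Not at heven
  obtain ⟨B, hB, hBn, hBD, t, ht, hvt⟩ := hodd v (by simpa using heven)
  have hDbip : D.coe.IsBipartite := by
    by_contra h
    exact hBD (huniq B D hB hD hBn h)
  have hBle : B.spanningCoe ≤ compl D := fun a b h =>
    ⟨B.adj_sub h, fun h' => hBD (hB.eq_of_mem hD h.ne (B.edge_vert h) (B.edge_vert h.symm)
      (D.edge_vert h') (D.edge_vert h'.symm))⟩
  -- The only non-bipartite block B hangs at v, so the parts hanging at the other vertices of D are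
  -- bipartite. As D is bipartite too, its signed row sum then isolates the row at v.
  have hother : ∀ u, u ≠ v → ∑ y, restrictAdj D.spanningCoe z u y = 0 := by
    intro u huv
    by_cases hu : u ∈ D.verts
    swap
    · exact hout u hu
    refine hD.sum_restrictAdj_eq_zero hz hu ?_
    by_contra hcon
    push Not at hcon
    obtain ⟨B', hB', hBn', -, t', ht', hut⟩ := hodd u (by simpa using hcon)
    obtain rfl := huniq B' B hB' hB hBn' hBn
    exact huv (hD.eq_of_reachable_compl hu hv (hut.trans
      (((hB'.isBiconnectedSubgraph.reachable t' ht' t ht).mono hBle).trans hvt.symm)))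
  obtain ⟨c⟩ := hDbip
  let ε : V → ℤ := fun u => if h : u ∈ D.verts then (if c ⟨u, h⟩ = 0 then 1 else -1) else 0
  have h0 := sum_sign_mul_sum_eq_zero (restrictAdj_symm (Γ := D.spanningCoe) hz.symm) ε (by
    intro x y hxy
    have hadj : D.Adj x y := (restrictAdj_ne_zero hxy).1
    have hx := D.edge_vert hadj
    have hy := D.edge_vert hadj.symm
    have hne : c ⟨x, hx⟩ ≠ c ⟨y, hy⟩ := c.valid (show D.coe.Adj ⟨x, hx⟩ ⟨y, hy⟩ from hadj)
    simp only [ε, dif_pos hx, dif_pos hy]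
    revert hne
    generalize c ⟨x, hx⟩ = p; generalize c ⟨y, hy⟩ = q
    revert p q; decide)
  rw [Finset.sum_eq_single v (fun u _ hu => by rw [hother u hu, mul_zero]) (by simp)] at h0
  have hεv : ε v ≠ 0 := by
    simp only [ε, dif_pos hv]
    split_ifs <;> decide
  exact (mul_eq_zero.1 h0).resolve_left hεv

/-- The restriction to the block of a support edge is again a nonzero kernel weighting, by
`IsBlock.sum_restrictAdj`. -/
theorem hasConformalSquares_of_blocks [Finite V]
    (huniq : ∀ B D : G.Subgraph, IsBlock G B → IsBlock G D → ¬ B.coe.IsBipartite →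
      ¬ D.coe.IsBipartite → B = D)
    (hblocks : ∀ B : G.Subgraph, IsBlock G B → HasConformalSquares B.coe) :
    HasConformalSquares G := by
  classical
  cases nonempty_fintype V
  intro z hz x y hxy
  obtain ⟨D, hD, hadj⟩ := exists_block_adj (hz.adj x y hxy)
  have hx := D.edge_vert hadj
  have hy := D.edge_vert hadj.symm
  let z' : D.verts → D.verts → ℤ := fun a b => z a b
  have hz' : IsKernel D.coe (restrictAdj D.coe z') := by
    refine IsKernel.of_restrictAdj (fun _ _ => hz.symm _ _) fun a => ?_
    rw [← hD.sum_restrictAdj huniq hz a, ← finsum_eq_sum_of_fintype]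
    have : ∀ b : D.verts, restrictAdj D.coe z' a b = restrictAdj D.spanningCoe z a b :=
      fun b => rfl
    simp_rw [this]
    rw [finsum_set_coe_eq_finsum_mem (f := fun b => restrictAdj D.spanningCoe z a b),
      ← finsum_mem_univ (f := fun b => restrictAdj D.spanningCoe z a b)]
    refine finsum_mem_inter_support_eq' _ _ _ fun b hb => ?_
    simpa using D.edge_vert (show D.Adj a b from (restrictAdj_ne_zero hb).1).symm
  obtain ⟨a, b, c, d, h⟩ := conformal_of_restrictAdj (hblocks D hD) hz' (x := ⟨x, hx⟩)
    (y := ⟨y, hy⟩) (by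
      have : D.coe.Adj ⟨x, hx⟩ ⟨y, hy⟩ := hadj
      rw [restrictAdj, if_pos this]
      exact hxy)
  exact ⟨a, b, c, d, h⟩

end KernelBlocks

/-! ### The graphs of the classification -/

section FamilyKernels

open SimpleGraph

variable {V : Type*} {H : SimpleGraph V}

/-- There are no nonzero kernel weightings, since the sign has to change at each end of a support
edge. -/
lemma hasConformalSquares_of_subsingleton_neighbors [Finite V]
    (h : ∀ x y w, H.Adj x y → H.Adj x w → y = w) : HasConformalSquares H := by
  intro z hz x y hxy
  exfalso
  rcases lt_or_gt_of_ne hxy with h0 | h0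
  · obtain ⟨w, hw⟩ := hz.exists_pos h0
    obtain rfl := h x y w (hz.adj _ _ hxy) (hz.adj _ _ hw.ne')
    omega
  · obtain ⟨w, hw⟩ := hz.exists_neg h0
    obtain rfl := h x y w (hz.adj _ _ hxy) (hz.adj _ _ hw.ne)
    omega

lemma IsCutEdge.hasConformalSquares [Finite V] {B : H.Subgraph} (hB : IsCutEdge H B) :
    HasConformalSquares B.coe := by
  obtain ⟨a, b, hab, -, rfl⟩ := hB
  refine hasConformalSquares_of_subsingleton_neighbors ?_
  rintro ⟨x, hx⟩ ⟨y, hy⟩ ⟨w, hw⟩ h1 h2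
  have h1 := h1.ne
  have h2 := h2.ne
  simp only [subgraphOfAdj_verts, Set.mem_insert_iff, Set.mem_singleton_iff] at hx hy hw
  simp only [ne_eq, Subtype.mk.injEq] at h1 h2 ⊢
  grind

/-- The two rows of a kernel weighting are opposite and sum to zero, so a positive entry i and a
negative entry j of one row span an alternating square. -/
lemma hasConformalSquares_K2 (l : ℕ) : HasConformalSquares (K2 l) := by
  intro z hz x y hxy
  have hcol : ∀ i, z (.inl 0) (.inr i) + z (.inl 1) (.inr i) = 0 := by
    intro i
    have h := hz.sum (.inr i)
    rw [finsum_eq_sum_of_fintype, Fintype.sum_sum_type, Fin.sum_univ_two,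
      Finset.sum_eq_zero (s := Finset.univ (α := Fin l)), add_zero] at h
    · rw [hz.symm, hz.symm (.inl 1)]
      exact h
    · intro j _
      by_contra h0
      simpa using hz.adj _ _ h0
  have hne : ∃ i, z (.inl 0) (.inr i) ≠ 0 := by
    have hk : ∀ (k : Fin 2) i, z (.inl k) (.inr i) ≠ 0 → ∃ i, z (.inl 0) (.inr i) ≠ 0 := by
      intro k i h
      have := hcol i
      refine ⟨i, ?_⟩
      fin_cases k
      · exact h
      · intro h0
        exact h (by rw [h0] at this; simpa using this)
    rcases x with k | i <;> rcases y with k' | j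
    · simpa using hz.adj _ _ hxy
    · exact hk _ _ hxy
    · exact hk k' i (by rwa [hz.symm])
    · simpa using hz.adj _ _ hxy
  have hpm : ∃ i j, 0 < z (.inl 0) (.inr i) ∧ z (.inl 0) (.inr j) < 0 := by
    obtain ⟨i, hi⟩ := hne
    rcases lt_or_gt_of_ne hi with h0 | h0
    · obtain ⟨w | w, hw⟩ := hz.exists_pos h0
      · simpa using hz.adj _ _ hw.ne'
      · exact ⟨w, i, hw, h0⟩
    · obtain ⟨w | w, hw⟩ := hz.exists_neg h0
      · simpa using hz.adj _ _ hw.ne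
      · exact ⟨i, w, h0, hw⟩
  obtain ⟨i, j, hi, hj⟩ := hpm
  have h1 := hcol i
  have h2 := hcol j
  refine ⟨.inl 0, .inr i, .inl 1, .inr j, hi, ?_, by omega, ?_⟩
  · rw [hz.symm]; omega
  · rw [hz.symm]; omega

lemma IsK2l.hasConformalSquares (h : IsK2l H) : HasConformalSquares H := by
  obtain ⟨l, -, ⟨e⟩⟩ := h
  exact (hasConformalSquares_K2 l).of_iso e

/-- Kernel weightings agree on opposite edges, which leaves three values with sum zero. Two of them
have opposite signs, and the corresponding four edges form an alternating square. -/
lemma IsK4.hasConformalSquares (h : IsK4 H) : HasConformalSquares H := by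
  obtain ⟨e⟩ := h
  refine HasConformalSquares.of_iso ?_ e
  intro z hz x y hxy
  have hd : ∀ i, z i i = 0 := fun i => by
    by_contra h
    exact (hz.adj _ _ h).ne rfl
  have h := hz.sum
  simp only [finsum_eq_sum_of_fintype, Fin.sum_univ_four] at h
  have h0 := h 0
  have h1 := h 1
  have h2 := h 2
  have h3 := h 3
  rw [hd] at h0 h1 h2 h3
  rw [hz.symm 1 0] at h1
  rw [hz.symm 2 0, hz.symm 2 1] at h2
  rw [hz.symm 3 0, hz.symm 3 1, hz.symm 3 2] at h3
  have e1 : z 2 3 = z 0 1 := by omega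
  have e2 : z 1 3 = z 0 2 := by omega
  have e3 : z 1 2 = z 0 3 := by omega
  clear h h1 h2 h3
  have hne : ¬ (z 0 1 = 0 ∧ z 0 2 = 0) := by
    rintro ⟨h1, h2⟩
    have h3 : z 0 3 = 0 := by omega
    have hall : ∀ x y, x < y → z x y = 0 := by
      have : ∀ x y : Fin 4, x < y → (x = 0 ∧ y = 1) ∨ (x = 0 ∧ y = 2) ∨ (x = 0 ∧ y = 3) ∨
        (x = 1 ∧ y = 2) ∨ (x = 1 ∧ y = 3) ∨ (x = 2 ∧ y = 3) := by decide
      intro x y h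
      rcases this x y h with ⟨rfl, rfl⟩ | ⟨rfl, rfl⟩ | ⟨rfl, rfl⟩ | ⟨rfl, rfl⟩ | ⟨rfl, rfl⟩ |
        ⟨rfl, rfl⟩
      exacts [h1, h2, h3, e3.trans h3, e2.trans h2, e1.trans h1]
    rcases lt_trichotomy x y with h | rfl | h
    · exact hxy (hall x y h)
    · exact hxy (hd x)
    · exact hxy ((hz.symm x y).trans (hall y x h))
  have hs : (0 < z 0 1 ∧ z 0 2 < 0) ∨ (0 < z 0 2 ∧ z 0 1 < 0) ∨ (0 < z 0 1 ∧ z 0 3 < 0) ∨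
      (0 < z 0 3 ∧ z 0 1 < 0) ∨ (0 < z 0 2 ∧ z 0 3 < 0) ∨ (0 < z 0 3 ∧ z 0 2 < 0) := by omega
  rcases hs with ⟨h, h'⟩ | ⟨h, h'⟩ | ⟨h, h'⟩ | ⟨h, h'⟩ | ⟨h, h'⟩ | ⟨h, h'⟩
  · exact ⟨0, 1, 3, 2, h, e2 ▸ h', hz.symm 3 2 ▸ e1 ▸ h, hz.symm 2 0 ▸ h'⟩
  · exact ⟨0, 2, 3, 1, h, e1 ▸ h', hz.symm 3 1 ▸ e2 ▸ h, hz.symm 1 0 ▸ h'⟩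
  · exact ⟨0, 1, 2, 3, h, e3 ▸ h', e1 ▸ h, hz.symm 3 0 ▸ h'⟩
  · exact ⟨0, 3, 2, 1, h, hz.symm 3 2 ▸ e1 ▸ h', hz.symm 2 1 ▸ e3 ▸ h, hz.symm 1 0 ▸ h'⟩
  · exact ⟨0, 2, 1, 3, h, hz.symm 2 1 ▸ e3 ▸ h', e2 ▸ h, hz.symm 3 0 ▸ h'⟩
  · exact ⟨0, 3, 1, 2, h, hz.symm 3 1 ▸ e2 ▸ h', e3 ▸ h, hz.symm 2 0 ▸ h'⟩

/-- Gluing two bipartite graphs in two vertices that have equal colours in the first and opposite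
colours in the second one. -/
lemma hasConformalSquares_of_gluing [Finite V] {W₁ W₂ : Type*} [Finite W₁] [Finite W₂]
    {Γ₁ : SimpleGraph W₁} {Γ₂ : SimpleGraph W₂} (h₁ : HasConformalSquares Γ₁)
    (h₂ : HasConformalSquares Γ₂) (ε₁ : W₁ → ℤ) (ε₂ : W₂ → ℤ)
    (hε₁ : ∀ x y, Γ₁.Adj x y → ε₁ x = - ε₁ y) (hε₂ : ∀ x y, Γ₂.Adj x y → ε₂ x = - ε₂ y)
    {a b : W₁} {c d : W₂} (hab : a ≠ b) (hab' : ¬ Γ₁.Adj a b) (hcd : c ≠ d) (ha : ε₁ a ≠ 0)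
    (hc : ε₂ c ≠ 0) (hεab : ε₁ a = ε₁ b) (hεcd : ε₂ c = - ε₂ d) {f : W₁ → V} {g : W₂ → V}
    (hf : Function.Injective f) (hg : Function.Injective g)
    (hfg : ∀ x y, f x = g y ↔ (x = a ∧ y = c) ∨ (x = b ∧ y = d))
    (hH : ∀ p q, H.Adj p q → (∃ x y, Γ₁.Adj x y ∧ f x = p ∧ f y = q) ∨
      ∃ x y, Γ₂.Adj x y ∧ g x = p ∧ g y = q) : HasConformalSquares H := by
  classical
  cases nonempty_fintype V
  cases nonempty_fintype W₁
  cases nonempty_fintype W₂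
  intro z hz x y hxy
  set z₁ := restrictAdj Γ₁ fun x y => z (f x) (f y) with hz₁
  set z₂ := restrictAdj Γ₂ fun x y => z (g x) (g y) with hz₂
  have hno : ∀ x y x' y', Γ₁.Adj x y → Γ₂.Adj x' y' → f x = g x' → f y = g y' → False := by
    intro x y x' y' hxy hxy' hx hy
    rw [hfg] at hx hy
    rcases hx with ⟨rfl, rfl⟩ | ⟨rfl, rfl⟩ <;> rcases hy with ⟨rfl, rfl⟩ | ⟨rfl, rfl⟩
    exacts [hxy.ne rfl, hab' hxy, hab' hxy.symm, hxy.ne rfl]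
  have hpush₁ : ∀ p q, push f z₁ p q ≠ 0 → ∃ x y, Γ₁.Adj x y ∧ f x = p ∧ f y = q ∧
      push f z₁ p q = z p q := by
    intro p q h
    obtain ⟨x, y, rfl, rfl, h'⟩ := push_ne_zero h
    obtain ⟨hadj, heq⟩ := restrictAdj_ne_zero h'
    exact ⟨x, y, hadj, rfl, rfl, by rw [push_apply_of_injective hf]; exact heq⟩
  have hpush₂ : ∀ p q, push g z₂ p q ≠ 0 → ∃ x y, Γ₂.Adj x y ∧ g x = p ∧ g y = q ∧
      push g z₂ p q = z p q := by
    intro p q h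
    obtain ⟨x, y, rfl, rfl, h'⟩ := push_ne_zero h
    obtain ⟨hadj, heq⟩ := restrictAdj_ne_zero h'
    exact ⟨x, y, hadj, rfl, rfl, by rw [push_apply_of_injective hg]; exact heq⟩
  have hsum : ∀ p q, z p q = push f z₁ p q + push g z₂ p q := by
    intro p q
    by_cases k1 : push f z₁ p q = 0 <;> by_cases k2 : push g z₂ p q = 0
    · rw [k1, k2, add_zero]
      by_contra h0
      rcases hH p q (hz.adj _ _ h0) with ⟨x, y, hadj, rfl, rfl⟩ | ⟨x, y, hadj, rfl, rfl⟩
      · rw [push_apply_of_injective hf, hz₁, restrictAdj, if_pos hadj] at k1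
        exact h0 k1
      · rw [push_apply_of_injective hg, hz₂, restrictAdj, if_pos hadj] at k2
        exact h0 k2
    · obtain ⟨-, -, -, -, -, h⟩ := hpush₂ p q k2
      rw [k1, h, zero_add]
    · obtain ⟨-, -, -, -, -, h⟩ := hpush₁ p q k1
      rw [k2, h, add_zero]
    · obtain ⟨x, y, hadj, hx, hy, -⟩ := hpush₁ p q k1
      obtain ⟨x', y', hadj', hx', hy', -⟩ := hpush₂ p q k2
      exact (hno x y x' y' hadj hadj' (hx.trans hx'.symm) (hy.trans hy'.symm)).elim
  have hrow : ∀ p, (∑ w, if f w = p then ∑ y, z₁ w y else 0) +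
      (∑ w, if g w = p then ∑ y, z₂ w y else 0) = 0 := by
    intro p
    rw [← sum_push, ← sum_push, ← Finset.sum_add_distrib]
    simp_rw [← hsum]
    rw [← finsum_eq_sum_of_fintype, hz.sum]
  have hf1 : ∀ w, (∑ w', if f w' = f w then ∑ y, z₁ w' y else 0) = ∑ y, z₁ w y := by
    intro w
    simp [hf.eq_iff]
  have hg1 : ∀ w, (∑ w', if g w' = g w then ∑ y, z₂ w' y else 0) = ∑ y, z₂ w y := by
    intro w
    simp [hg.eq_iff]
  have hr₁ : ∀ w, w ≠ a → w ≠ b → ∑ y, z₁ w y = 0 := by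
    intro w hwa hwb
    have := hrow (f w)
    rw [hf1, Finset.sum_eq_zero (s := Finset.univ (α := W₂)), add_zero] at this
    · exact this
    · intro w' _
      refine if_neg fun h => ?_
      rcases (hfg w w').1 h.symm with h | h
      exacts [hwa h.1, hwb h.1]
  have hr₂ : ∀ w, w ≠ c → w ≠ d → ∑ y, z₂ w y = 0 := by
    intro w hwa hwb
    have := hrow (g w)
    rw [hg1, Finset.sum_eq_zero (s := Finset.univ (α := W₁)), zero_add] at this
    · exact this
    · intro w' _
      refine if_neg fun h => ?_
      rcases (hfg w' w).1 h with h | h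
      exacts [hwa h.2, hwb h.2]
  have hac : ∑ y, z₁ a y + ∑ y, z₂ c y = 0 := by
    have := hrow (f a)
    rwa [hf1, (hfg a c).2 (.inl ⟨rfl, rfl⟩), hg1] at this
  have hbd : ∑ y, z₁ b y + ∑ y, z₂ d y = 0 := by
    have := hrow (f b)
    rwa [hf1, (hfg b d).2 (.inr ⟨rfl, rfl⟩), hg1] at this
  -- With r for row sums, the colourings give r(a) + r(b) = 0 and r(c) - r(d) = 0. Together with
  -- r(a) + r(c) = 0 and r(b) + r(d) = 0 this makes all four vanish.
  have hs₁ := sum_sign_mul_sum_eq_zero (restrictAdj_symm (Γ := Γ₁)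
    (z := fun x y => z (f x) (f y)) fun _ _ => hz.symm _ _) ε₁
    fun x y h => hε₁ x y (restrictAdj_ne_zero h).1
  have hs₂ := sum_sign_mul_sum_eq_zero (restrictAdj_symm (Γ := Γ₂)
    (z := fun x y => z (g x) (g y)) fun _ _ => hz.symm _ _) ε₂
    fun x y h => hε₂ x y (restrictAdj_ne_zero h).1
  rw [← hz₁, Fintype.sum_eq_add a b hab fun w hw => by rw [hr₁ w hw.1 hw.2, mul_zero], ← hεab,
    ← mul_add] at hs₁
  rw [← hz₂, Fintype.sum_eq_add c d hcd fun w hw => by rw [hr₂ w hw.1 hw.2, mul_zero]] at hs₂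
  have hs₁ := (mul_eq_zero.1 hs₁).resolve_left ha
  have hs₂ : ∑ y, z₂ c y - ∑ y, z₂ d y = 0 := by
    have : ε₂ c * (∑ y, z₂ c y - ∑ y, z₂ d y) = 0 := by
      rw [← hs₂, hεcd]; ring
    exact (mul_eq_zero.1 this).resolve_left hc
  have hker₁ : IsKernel Γ₁ z₁ := by
    refine .of_restrictAdj (fun _ _ => hz.symm _ _) fun w => ?_
    rw [finsum_eq_sum_of_fintype, ← hz₁]
    by_cases hwa : w = a
    · subst hwa; omega
    by_cases hwb : w = b
    · subst hwb; omega
    exact hr₁ w hwa hwb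
  have hker₂ : IsKernel Γ₂ z₂ := by
    refine .of_restrictAdj (fun _ _ => hz.symm _ _) fun w => ?_
    rw [finsum_eq_sum_of_fintype, ← hz₂]
    by_cases hwa : w = c
    · subst hwa; omega
    by_cases hwb : w = d
    · subst hwb; omega
    exact hr₂ w hwa hwb
  rw [hsum] at hxy
  by_cases k1 : push f z₁ x y = 0
  · rw [k1, zero_add] at hxy
    obtain ⟨p, q, -, -, h⟩ := push_ne_zero hxy
    obtain ⟨_, _, _, _, h⟩ := conformal_of_restrictAdj h₂ hker₂ h
    exact ⟨_, _, _, _, h⟩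
  · obtain ⟨p, q, -, -, h⟩ := push_ne_zero k1
    obtain ⟨_, _, _, _, h⟩ := conformal_of_restrictAdj h₁ hker₁ h
    exact ⟨_, _, _, _, h⟩

/-- The sign of a vertex of `K_{2,l}`. -/
def k2Sign (l : ℕ) : Fin 2 ⊕ Fin l → ℤ := Sum.elim (fun _ => 1) fun _ => -1

lemma k2Sign_ne_zero {l : ℕ} (x : Fin 2 ⊕ Fin l) : k2Sign l x ≠ 0 := by
  rcases x with x | x <;> simp [k2Sign]

lemma k2Sign_adj {l : ℕ} {x y : Fin 2 ⊕ Fin l} (h : (K2 l).Adj x y) :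
    k2Sign l x = - k2Sign l y := by
  rcases x with x | x <;> rcases y with y | y <;> simp_all [k2Sign]

lemma k2Sign_not_adj {l : ℕ} {x y : Fin 2 ⊕ Fin l} (h : ¬ (K2 l).Adj x y) :
    k2Sign l x = k2Sign l y := by
  rcases x with x | x <;> rcases y with y | y <;> simp_all [k2Sign]

/-- The extra edge is glued on as a complete graph on two vertices. -/
lemma IsK2lPlusEdge.hasConformalSquares (h : IsK2lPlusEdge H) : HasConformalSquares H := by
  obtain ⟨l, a, b, -, hab, hnadj, ⟨e⟩⟩ := h
  refine HasConformalSquares.of_iso ?_ e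
  refine hasConformalSquares_of_gluing (Γ₁ := K2 l) (Γ₂ := (⊤ : SimpleGraph (Fin 2)))
    (hasConformalSquares_K2 l) (hasConformalSquares_of_subsingleton_neighbors ?_) (k2Sign l)
    ![1, -1] (fun _ _ => k2Sign_adj) ?_ hab hnadj (c := 0) (d := 1) (by decide)
    (k2Sign_ne_zero a) (by simp) (k2Sign_not_adj hnadj) (by simp) (f := id) (g := ![a, b])
    Function.injective_id ?_ ?_ ?_
  · simp only [top_adj]; decide
  · simp only [top_adj]; decide
  · intro i j hij
    fin_cases i <;> fin_cases j <;> simp_all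
  · intro x i
    fin_cases i <;> simp
  · intro p q hpq
    rw [sup_adj, edge_adj] at hpq
    rcases hpq with h | ⟨⟨rfl, rfl⟩ | ⟨rfl, rfl⟩, -⟩
    · exact .inl ⟨p, q, h, rfl, rfl⟩
    · exact .inr ⟨0, 1, by simp, rfl, rfl⟩
    · exact .inr ⟨1, 0, by simp, rfl, rfl⟩

/-- The edge e belongs to the K_{2,s} already, so the graph is a gluing of K_{2,r} without e and
K_{2,s}. -/
lemma IsDoubleK2.hasConformalSquares [Finite V] (h : IsDoubleK2 H) : HasConformalSquares H := by
  obtain ⟨r, s, a, b, c, d, -, -, hab, hnadj, -, hcd, f, g, hf, hg, -, hfg, hH⟩ := h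
  refine hasConformalSquares_of_gluing (hasConformalSquares_K2 r) (hasConformalSquares_K2 s)
    (k2Sign r) (k2Sign s) (fun _ _ => k2Sign_adj) (fun _ _ => k2Sign_adj) hab hnadj hcd.ne
    (k2Sign_ne_zero a) (k2Sign_ne_zero c) (k2Sign_not_adj hnadj) (k2Sign_adj hcd) hf hg hfg ?_
  intro p q hpq
  rcases (hH p q).1 hpq with ⟨x, y, h, rfl, rfl⟩ | h
  · rw [sup_adj, edge_adj] at h
    rcases h with h | ⟨⟨rfl, rfl⟩ | ⟨rfl, rfl⟩, -⟩
    · exact .inl ⟨x, y, h, rfl, rfl⟩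
    · exact .inr ⟨c, d, hcd, ((hfg _ _).2 (.inl ⟨rfl, rfl⟩)).symm,
        ((hfg _ _).2 (.inr ⟨rfl, rfl⟩)).symm⟩
    · exact .inr ⟨d, c, hcd.symm, ((hfg _ _).2 (.inr ⟨rfl, rfl⟩)).symm,
        ((hfg _ _).2 (.inl ⟨rfl, rfl⟩)).symm⟩
  · exact .inr h

/-- For the weighting lifted to `R`, the identified vertex gives r₁ + r₂ = 0 for the row sums at x₁,
x₂, and the opposite colours give r₁ - r₂ = 0. So the lift is a kernel weighting of `R`. -/
lemma hasConformalSquares_of_identification [Finite V] {W : Type*} [Finite W] {R : SimpleGraph W}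
    (hR : HasConformalSquares R) (col : R.Coloring Bool) {x₁ x₂ : W} (hcol : col x₁ ≠ col x₂)
    (hnadj : ¬ R.Adj x₁ x₂) (hid : IsVertexIdentification R x₁ x₂ H) : HasConformalSquares H := by
  classical
  cases nonempty_fintype V
  cases nonempty_fintype W
  obtain ⟨π, -, hπ, hH⟩ := hid
  intro z hz x y hxy
  set z' := restrictAdj R fun x y => z (π x) (π y) with hz'
  have hlift : ∀ a b a' b', R.Adj a b → R.Adj a' b' → π a' = π a → π b' = π b →
      a' = a ∧ b' = b := by
    intro a b a' b' h h' ha hb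
    have k1 := col.valid h
    have k2 := col.valid h'
    have k3 := h.ne
    have k4 := h'.ne
    have k5 : ¬ R.Adj x₂ x₁ := fun h => hnadj h.symm
    rw [hπ] at ha hb
    have dich : ∀ {s t r : Bool}, s ≠ t → t ≠ r → s = r := by decide
    rcases ha with rfl | ⟨rfl, rfl⟩ | ⟨rfl, rfl⟩ <;> rcases hb with rfl | ⟨rfl, rfl⟩ | ⟨rfl, rfl⟩
    · exact ⟨rfl, rfl⟩
    · exact absurd (dich k2.symm k1) hcol
    · exact absurd (dich k2.symm k1) hcol.symm
    · exact absurd (dich k2 k1.symm) hcol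
    · exact absurd rfl k3
    · exact absurd h k5
    · exact absurd (dich k2 k1.symm) hcol.symm
    · exact absurd h hnadj
    · exact absurd rfl k3
  have hpush : ∀ p q, push π z' p q = z p q := by
    intro p q
    by_cases h : z p q = 0
    · rw [h]
      by_contra h0
      obtain ⟨a, b, rfl, rfl, h'⟩ := push_ne_zero h0
      rw [hz', (restrictAdj_ne_zero h').2] at h'
      exact h' h
    · obtain ⟨a, b, hab, rfl, rfl⟩ := (hH p q).1 (hz.adj _ _ h)
      rw [push_eq a b rfl rfl fun a' b' ha hb h' =>
        hlift a b a' b' hab (restrictAdj_ne_zero h').1 ha hb]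
      simp [restrictAdj, hab]
  have hrow : ∀ p, (∑ w, if π w = p then ∑ y, z' w y else 0) = 0 := by
    intro p
    rw [← sum_push]
    simp_rw [hpush]
    rw [← finsum_eq_sum_of_fintype, hz.sum]
  have hx : x₁ ≠ x₂ := fun h => hcol (by rw [h])
  have hother : ∀ w, w ≠ x₁ → w ≠ x₂ → ∑ y, z' w y = 0 := by
    intro w h1 h2
    have := hrow (π w)
    rw [Finset.sum_eq_single w] at this
    · simpa using this
    · intro w' _ hw'
      refine if_neg fun h => ?_
      rcases (hπ _ _).1 h with h | h | h
      exacts [hw' h, h2 h.2, h1 h.2]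
    · simp
  have hsum : ∑ y, z' x₁ y + ∑ y, z' x₂ y = 0 := by
    have := hrow (π x₁)
    rw [Fintype.sum_eq_add x₁ x₂ hx] at this
    · simpa [(hπ x₂ x₁).2 (.inr (.inr ⟨rfl, rfl⟩))] using this
    · intro w hw
      refine if_neg fun h => ?_
      rcases (hπ _ _).1 h with h | h | h
      exacts [hw.1 h, hw.1 h.1, hw.2 h.1]
  let ε : W → ℤ := fun w => if col w = true then 1 else -1
  have hs := sum_sign_mul_sum_eq_zero (restrictAdj_symm (Γ := R)
    (z := fun x y => z (π x) (π y)) fun _ _ => hz.symm _ _) ε (by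
      intro x y h
      have := col.valid (restrictAdj_ne_zero h).1
      revert this
      simp only [ε]
      cases col x <;> cases col y <;> simp)
  rw [← hz', Fintype.sum_eq_add x₁ x₂ hx fun w hw => by
    rw [hother w hw.1 hw.2, mul_zero]] at hs
  have hdiff : ∑ y, z' x₁ y - ∑ y, z' x₂ y = 0 := by
    revert hs hcol
    simp only [ε]
    cases col x₁ <;> cases col x₂ <;> simp <;> intro hs <;> omega
  have hker : IsKernel R z' := by
    refine .of_restrictAdj (fun _ _ => hz.symm _ _) fun w => ?_
    rw [finsum_eq_sum_of_fintype, ← hz']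
    by_cases h1 : w = x₁
    · subst h1; omega
    by_cases h2 : w = x₂
    · subst h2; omega
    exact hother w h1 h2
  rw [← hpush] at hxy
  obtain ⟨p, q, -, -, h⟩ := push_ne_zero hxy
  obtain ⟨_, _, _, _, h⟩ := conformal_of_restrictAdj hR hker h
  exact ⟨_, _, _, _, h⟩

lemma IsNecklaceK2.hasConformalSquares {V : Type u} [Finite V] {H : SimpleGraph V}
    (h : IsNecklaceK2 H) : HasConformalSquares H := by
  obtain ⟨W, hW, R, x₁, x₂, -, -, -, -, hbip, hblocks, -, -, -, -, -, -, -, hnadj, hodd, hid⟩ := h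
  have hR : HasConformalSquares R := by
    refine hasConformalSquares_of_blocks (fun B D _ _ h => absurd (hbip.of_hom B.hom) h) ?_
    intro B hB
    rcases hblocks B hB with h | h
    exacts [h.hasConformalSquares, h.hasConformalSquares]
  obtain ⟨c⟩ := hbip
  let col : R.Coloring Bool := R.recolorOfEquiv finTwoEquiv c
  refine hasConformalSquares_of_identification hR col ?_ hnadj hid
  -- `dist` is zero for unreachable pairs, and zero is not odd.
  have hreach : R.Reachable x₁ x₂ := by
    by_contra h
    rw [dist_eq_zero_of_not_reachable h] at hodd
    exact absurd hodd (by decide)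
  obtain ⟨p, hp⟩ := hreach.exists_walk_length_eq_dist
  rw [← hp, col.odd_length_iff_not_congr] at hodd
  revert hodd
  cases col x₁ <;> cases col x₂ <;> simp

end FamilyKernels

/-! ### Gröbner bases of toric ideals -/

section Algebra

open MvPolynomial

variable {σ : Type u} {τ : Type v} {K : Type*} [Field K] {a : σ → τ → ℕ}

/-- The monomial `x^p` is not the smallest one in its fiber. -/
def IsNonstandard (a : σ → τ → ℕ) (m : MonomialOrder.{u, u} σ) (p : σ →₀ ℕ) : Prop :=
  ∃ q, Finsupp.linearCombination ℕ a q = Finsupp.linearCombination ℕ a p ∧ m.toSyn q < m.toSyn p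

/-- For every term order, the nonstandard monomials are generated in degree two. -/
def HasQuadraticInitialIdeals (a : σ → τ → ℕ) : Prop :=
  ∀ (m : MonomialOrder.{u, u} σ) (p : σ →₀ ℕ), IsNonstandard a m p →
    ∃ q ≤ p, q.degree = 2 ∧ IsNonstandard a m q

lemma IsNonstandard.mono {m : MonomialOrder.{u, u} σ} {p q : σ →₀ ℕ} (h : IsNonstandard a m p)
    (hpq : p ≤ q) : IsNonstandard a m q := by
  obtain ⟨r, hr, hlt⟩ := h
  obtain ⟨s, rfl⟩ := exists_add_of_le hpq
  exact ⟨r + s, by simp [hr], by simpa using hlt⟩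

lemma exists_standard (a : σ → τ → ℕ) (m : MonomialOrder.{u, u} σ) (p : σ →₀ ℕ) :
    ∃ q, Finsupp.linearCombination ℕ a q = Finsupp.linearCombination ℕ a p ∧
      ¬ IsNonstandard a m q := by
  obtain ⟨q, hq, hmin⟩ := (InvImage.wf m.toSyn wellFounded_lt).has_min
    {q | Finsupp.linearCombination ℕ a q = Finsupp.linearCombination ℕ a p} ⟨p, rfl⟩
  refine ⟨q, hq, ?_⟩
  rintro ⟨r, hr, hlt⟩
  exact hmin r (hr.trans hq) hlt

lemma toSyn_le_of_not_isNonstandard {m : MonomialOrder.{u, u} σ} {p q : σ →₀ ℕ}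
    (hp : ¬ IsNonstandard a m p)
    (h : Finsupp.linearCombination ℕ a q = Finsupp.linearCombination ℕ a p) :
    m.toSyn p ≤ m.toSyn q :=
  not_lt.mp fun hlt => hp ⟨q, h, hlt⟩

/-- The standard monomial of a fiber is its least element, hence unique. -/
lemma eq_of_not_isNonstandard {m : MonomialOrder.{u, u} σ} {p q : σ →₀ ℕ}
    (hp : ¬ IsNonstandard a m p) (hq : ¬ IsNonstandard a m q)
    (h : Finsupp.linearCombination ℕ a p = Finsupp.linearCombination ℕ a q) : p = q :=
  m.toSyn.injective (le_antisymm (toSyn_le_of_not_isNonstandard hp h.symm)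
    (toSyn_le_of_not_isNonstandard hq h))

/-- The term order is well-founded and refines divisibility. -/
lemma IsNonstandard.exists_minimal {m : MonomialOrder.{u, u} σ} {p : σ →₀ ℕ}
    (h : IsNonstandard a m p) : ∃ q ≤ p, Minimal (IsNonstandard a m) q := by
  obtain ⟨q, ⟨hqp, hq⟩, hmin⟩ := (InvImage.wf m.toSyn wellFounded_lt).has_min
    {q | q ≤ p ∧ IsNonstandard a m q} ⟨p, le_rfl, h⟩
  refine ⟨q, hqp, hq, fun r hr hrq => ?_⟩
  by_contra hne
  exact hmin r ⟨hrq.trans hqp, hr⟩ (m.toSyn_strictMono (lt_of_le_not_ge hrq hne))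

lemma coeff_binomial [DecidableEq σ] (p q r : σ →₀ ℕ) :
    coeff r (binomial K p q) = (if p = r then 1 else 0) - if q = r then 1 else 0 := by
  simp [binomial, coeff_sub, coeff_monomial]

lemma binomial_ne_zero {p q : σ →₀ ℕ} (h : p ≠ q) : binomial K p q ≠ 0 := by
  classical
  intro h0
  have := coeff_binomial (K := K) p q p
  simp [h0, h.symm] at this

lemma binomial_mem_toricIdeal {p q : σ →₀ ℕ}
    (h : Finsupp.linearCombination ℕ a p = Finsupp.linearCombination ℕ a q) :
    binomial K p q ∈ toricIdeal K a :=
  Ideal.subset_span ⟨p, q, h, rfl⟩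

lemma monomial_mul_binomial (d p q : σ →₀ ℕ) (r : K) :
    monomial d r * binomial K p q = r • binomial K (d + p) (d + q) := by
  simp [binomial, mul_sub, smul_sub, monomial_mul, smul_monomial]

open scoped Classical in
/-- The sum of the coefficients of a polynomial over the fiber of `b`. -/
noncomputable def fiberSum (K : Type*) [Field K] (a : σ → τ → ℕ) (b : τ → ℕ) :
    MvPolynomial σ K →ₗ[K] K :=
  (basisMonomials σ K).constr K fun p => if Finsupp.linearCombination ℕ a p = b then 1 else 0

open scoped Classical in
lemma fiberSum_monomial (b : τ → ℕ) (p : σ →₀ ℕ) (r : K) :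
    fiberSum K a b (monomial p r) = if Finsupp.linearCombination ℕ a p = b then r else 0 := by
  have h : monomial p r = r • basisMonomials σ K p := by
    simp [coe_basisMonomials, smul_monomial]
  rw [h, map_smul, fiberSum, Module.Basis.constr_basis]
  split_ifs <;> simp

open scoped Classical in
lemma fiberSum_eq_sum (b : τ → ℕ) (f : MvPolynomial σ K) :
    fiberSum K a b f = ∑ p ∈ f.support,
      if Finsupp.linearCombination ℕ a p = b then coeff p f else 0 := by
  conv_lhs => rw [f.as_sum, map_sum]
  exact Finset.sum_congr rfl fun p _ => fiberSum_monomial b p _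

/-- A monomial multiple of a generating binomial has both terms in one fiber, where they cancel. -/
lemma fiberSum_eq_zero {f : MvPolynomial σ K} (hf : f ∈ toricIdeal K a) (b : τ → ℕ) :
    fiberSum K a b f = 0 := by
  classical
  obtain ⟨c, hc, rfl⟩ := Submodule.mem_span_set.mp hf
  rw [Finsupp.sum, map_sum]
  refine Finset.sum_eq_zero fun g hg => ?_
  obtain ⟨p, q, hpq, rfl⟩ := hc hg
  rw [smul_eq_mul]
  generalize c (binomial K p q) = e
  induction e using MvPolynomial.induction_on' with
  | monomial d r =>
    rw [monomial_mul_binomial, map_smul, binomial, map_sub, fiberSum_monomial, fiberSum_monomial,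
      map_add, map_add, hpq, sub_self, smul_zero]
  | add e₁ e₂ h₁ h₂ => rw [add_mul, map_add, h₁, h₂, add_zero]

lemma binomial_mem_toricIdeal_iff {p q : σ →₀ ℕ} :
    binomial K p q ∈ toricIdeal K a ↔
      Finsupp.linearCombination ℕ a p = Finsupp.linearCombination ℕ a q := by
  classical
  refine ⟨fun h => ?_, binomial_mem_toricIdeal⟩
  have := fiberSum_eq_zero h (Finsupp.linearCombination ℕ a p)
  rw [binomial, map_sub, fiberSum_monomial, fiberSum_monomial, if_pos rfl] at this
  by_contra hne
  rw [if_neg (Ne.symm hne)] at this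
  simp at this

/-- A standard leading monomial is below all monomials of its fiber and above the support of `f`, so
it would be the only support element in its fiber. The fiber sum would then be the nonzero leading
coefficient. -/
lemma isNonstandard_degree (m : MonomialOrder.{u, u} σ) {f : MvPolynomial σ K}
    (hf : f ∈ toricIdeal K a) (h0 : f ≠ 0) : IsNonstandard a m (m.degree f) := by
  classical
  by_contra hstd
  have h := fiberSum_eq_zero hf (Finsupp.linearCombination ℕ a (m.degree f))
  rw [fiberSum_eq_sum, Finset.sum_eq_single (m.degree f), if_pos rfl] at h
  · exact m.coeff_degree_ne_zero_iff.mpr h0 h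
  · intro p hp hne
    refine if_neg fun hfib => hne ?_
    exact m.toSyn.injective (le_antisymm (m.le_degree hp) (toSyn_le_of_not_isNonstandard hstd hfib))
  · intro hn
    exact absurd (m.degree_mem_support h0) hn

lemma degree_binomial {m : MonomialOrder.{u, u} σ} {p q : σ →₀ ℕ} (h : m.toSyn q < m.toSyn p) :
    m.degree (binomial K p q) = p ∧ m.Monic (binomial K p q) := by
  classical
  have hne : q ≠ p := fun e => by simp [e] at h
  have hc : coeff p (binomial K p q) = 1 := by simp [coeff_binomial, hne]
  have hd : m.degree (binomial K p q) = p := by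
    refine m.toSyn.injective (le_antisymm (m.degree_le_iff.mpr fun r hr => ?_)
      (m.le_degree (mem_support_iff.mpr (by simp [hc]))))
    rw [mem_support_iff, coeff_binomial] at hr
    by_cases hpr : p = r
    · rw [hpr]
    · by_cases hqr : q = r
      · exact hqr ▸ h.le
      · simp [hpr, hqr] at hr
  exact ⟨hd, by rw [MonomialOrder.Monic, MonomialOrder.leadingCoeff, hd, hc]⟩

lemma toSyn_lt_of_isNonstandard {m : MonomialOrder.{u, u} σ} {p q : σ →₀ ℕ}
    (hp : IsNonstandard a m p) (hq : ¬ IsNonstandard a m q)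
    (h : Finsupp.linearCombination ℕ a p = Finsupp.linearCombination ℕ a q) :
    m.toSyn q < m.toSyn p :=
  lt_of_le_of_ne (toSyn_le_of_not_isNonstandard hq h)
    fun e => hq (m.toSyn.injective e ▸ hp)

lemma mem_support_binomial {p q r : σ →₀ ℕ} (h : r ∈ (binomial K p q).support) :
    r = p ∨ r = q := by
  classical
  rw [mem_support_iff, coeff_binomial] at h
  by_contra! hn
  simp [hn.1.symm, hn.2.symm] at h

/-- The binomials `x^p - x^q`, with `x^p` a minimal nonstandard monomial and `x^q` the standard
monomial of its fiber, form the reduced Gröbner basis. -/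
lemma isReducedGroebnerBasis_toricIdeal (K : Type*) [Field K] (a : σ → τ → ℕ)
    (m : MonomialOrder.{u, u} σ) :
    IsReducedGroebnerBasis m (toricIdeal K a) {f | ∃ p q, Minimal (IsNonstandard a m) p ∧
      ¬ IsNonstandard a m q ∧
      Finsupp.linearCombination ℕ a p = Finsupp.linearCombination ℕ a q ∧
      f = binomial K p q} where
  subset := by
    rintro _ ⟨p, q, -, -, h, rfl⟩
    exact binomial_mem_toricIdeal h
  span_leadingTerm := by
    refine le_antisymm (Ideal.span_mono (Set.image_mono ?_)) (Ideal.span_le.mpr ?_)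
    · rintro _ ⟨p, q, -, -, h, rfl⟩
      exact binomial_mem_toricIdeal h
    rintro _ ⟨f, hf, rfl⟩
    by_cases h0 : f = 0
    · simp [h0]
    obtain ⟨p, hpf, hp⟩ := (isNonstandard_degree m hf h0).exists_minimal
    obtain ⟨q, hqp, hq⟩ := exists_standard a m p
    obtain ⟨hd, hmon⟩ := degree_binomial (K := K) (toSyn_lt_of_isNonstandard hp.1 hq hqp.symm)
    have hlt : m.leadingTerm (binomial K p q) = monomial p 1 := by
      rw [MonomialOrder.leadingTerm, hd, hmon.leadingCoeff_eq_one]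
    have key : m.leadingTerm f =
        monomial (m.degree f - p) (m.leadingCoeff f) * m.leadingTerm (binomial K p q) := by
      rw [hlt, monomial_mul, mul_one, tsub_add_cancel_of_le hpf, MonomialOrder.leadingTerm]
    rw [key]
    exact Ideal.mul_mem_left _ _ (Ideal.subset_span ⟨_, ⟨p, q, hp, hq, hqp.symm, rfl⟩, rfl⟩)
  monic := by
    rintro _ ⟨p, q, hp, hq, h, rfl⟩
    exact (degree_binomial (toSyn_lt_of_isNonstandard hp.1 hq h)).2
  reduced := by
    rintro _ ⟨p, q, hp, hq, h, rfl⟩ _ ⟨p', q', hp', hq', h', rfl⟩ hne r hr hle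
    rw [(degree_binomial (toSyn_lt_of_isNonstandard hp'.1 hq' h')).1] at hle
    rcases mem_support_binomial hr with rfl | rfl
    · obtain rfl := hp.eq_of_le hp'.1 hle
      exact hne (by rw [eq_of_not_isNonstandard hq hq' (h.symm.trans h')])
    · exact hq (hp'.1.mono hle)

lemma IsReducedGroebnerBasis.exists_degree_le {m : MonomialOrder.{u, u} σ}
    {S : Set (MvPolynomial σ K)} (hS : IsReducedGroebnerBasis m (toricIdeal K a) S)
    {p : σ →₀ ℕ} (hp : IsNonstandard a m p) : ∃ g ∈ S, m.degree g ≤ p := by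
  classical
  obtain ⟨q, hqp, hlt⟩ := hp
  obtain ⟨hd, hmon⟩ := degree_binomial (K := K) hlt
  have hmem : monomial p (1 : K) ∈ Ideal.span (m.leadingTerm '' S) := by
    rw [hS.span_leadingTerm]
    refine Ideal.subset_span ⟨binomial K p q, binomial_mem_toricIdeal hqp.symm, ?_⟩
    rw [MonomialOrder.leadingTerm, hd, hmon.leadingCoeff_eq_one]
  have himg : m.leadingTerm '' S = (fun s => monomial s (1 : K)) '' (m.degree '' S) := by
    rw [Set.image_image]
    refine Set.image_congr fun g hg => ?_
    rw [MonomialOrder.leadingTerm, (hS.monic g hg).leadingCoeff_eq_one]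
  rw [himg, mem_ideal_span_monomial_image] at hmem
  obtain ⟨_, ⟨g, hg, rfl⟩, hle⟩ := hmem p (by simp)
  exact ⟨g, hg, hle⟩

/-- Every element of a reduced Gröbner basis of a toric ideal is a binomial with a minimal
nonstandard leading monomial. -/
lemma IsReducedGroebnerBasis.exists_eq_binomial {m : MonomialOrder.{u, u} σ}
    {S : Set (MvPolynomial σ K)} (hS : IsReducedGroebnerBasis m (toricIdeal K a) S)
    {f : MvPolynomial σ K} (hf : f ∈ S) :
    ∃ p q, Minimal (IsNonstandard a m) p ∧ m.toSyn q < m.toSyn p ∧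
      Finsupp.linearCombination ℕ a p = Finsupp.linearCombination ℕ a q ∧
      f = binomial K p q := by
  classical
  have h0 : f ≠ 0 := (hS.monic f hf).ne_zero
  have hns := isNonstandard_degree m (hS.subset hf) h0
  obtain ⟨q, hq, hstd⟩ := exists_standard a m (m.degree f)
  have hlt := toSyn_lt_of_isNonstandard hns hstd hq.symm
  refine ⟨m.degree f, q, ⟨hns, fun r hr hrf => ?_⟩, hlt, hq.symm, ?_⟩
  · obtain ⟨g, hg, hgr⟩ := hS.exists_degree_le hr
    by_cases hgf : g = f
    · exact hgf ▸ hgr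
    · exact absurd (hgr.trans hrf) (hS.reduced f hf g hg hgf _ (m.degree_mem_support h0))
  -- The leading exponent d of the difference is nonstandard, so it is not q; nor is it the leading
  -- exponent of f, which cancels. Thus d lies in the support of f, against reducedness.
  · by_contra hne
    have hsub : f - binomial K (m.degree f) q ≠ 0 := sub_ne_zero.mpr hne
    have hd := isNonstandard_degree m
      (sub_mem (hS.subset hf) (binomial_mem_toricIdeal hq.symm)) hsub
    have hdc := m.coeff_degree_ne_zero_iff.mpr hsub
    set d := m.degree (f - binomial K (m.degree f) q) with hdd
    have hdq : q ≠ d := fun e => hstd (e ▸ hd)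
    have hdf : m.degree f ≠ d := by
      intro e
      rw [← e, coeff_sub, (hS.monic f hf).coeff_degree, coeff_binomial] at hdc
      simp [e, hdq] at hdc
    have hds : d ∈ f.support := by
      rw [coeff_sub, coeff_binomial, if_neg hdf, if_neg hdq, sub_zero, sub_zero] at hdc
      exact mem_support_iff.mpr hdc
    obtain ⟨g, hg, hgd⟩ := hS.exists_degree_le hd
    by_cases hgf : g = f
    · exact hdf (m.toSyn.injective (le_antisymm (m.toSyn_monotone (hgf ▸ hgd)) (m.le_degree hds)))
    · exact hS.reduced f hf g hg hgf d hds hgd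

end Algebra

/-! ### Toric ideals generated by quadrics -/

section Quadrics

open MvPolynomial

variable {σ : Type u} {τ : Type v} {K : Type*} [Field K] {a : σ → τ → ℕ}

/-- As the generators have degree at least two, only scalar multiples of the quadratic ones
contribute in degree two. -/
lemma homogeneousComponent_two_mem_span {S : Set (MvPolynomial σ K)}
    (hS : ∀ g ∈ S, ∃ n, 2 ≤ n ∧ g.IsHomogeneous n) {f : MvPolynomial σ K}
    (hf : f ∈ Ideal.span S) :
    homogeneousComponent 2 f ∈ Submodule.span K {g ∈ S | g.IsHomogeneous 2} := by
  obtain ⟨c, hc, rfl⟩ := Submodule.mem_span_set.mp hf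
  rw [Finsupp.sum, map_sum]
  refine Submodule.sum_mem _ fun g hg => ?_
  obtain ⟨n, hn, hgn⟩ := hS g (hc hg)
  rw [smul_eq_mul]
  generalize c g = e
  induction e using MvPolynomial.induction_on' with
  | monomial d r =>
    have hmul := (isHomogeneous_monomial r (rfl : d.degree = d.degree)).mul hgn
    rw [homogeneousComponent_of_mem hmul]
    split_ifs with h
    · have hd : d = 0 := by
        rw [← Finsupp.degree_eq_zero_iff]
        omega
      have hn2 : n = 2 := by omega
      subst hd hn2
      have : monomial 0 r * g = r • g := by rw [← C_apply, C_mul']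
      rw [this]
      exact Submodule.smul_mem _ _ (Submodule.subset_span ⟨hc hg, hgn⟩)
    · exact Submodule.zero_mem _
  | add e₁ e₂ h₁ h₂ =>
    rw [add_mul, map_add]
    exact Submodule.add_mem _ h₁ h₂

lemma mem_span_of_isHomogeneous_two {S : Set (MvPolynomial σ K)}
    (hS : ∀ g ∈ S, ∃ n, 2 ≤ n ∧ g.IsHomogeneous n) {f : MvPolynomial σ K}
    (hf : f ∈ Ideal.span S) (hf2 : f.IsHomogeneous 2) :
    f ∈ Submodule.span K {g ∈ S | g.IsHomogeneous 2} := by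
  have h := homogeneousComponent_two_mem_span hS hf
  rwa [homogeneousComponent_eq_self hf2] at h

lemma span_le_ideal_span (S : Set (MvPolynomial σ K)) {f : MvPolynomial σ K}
    (hf : f ∈ Submodule.span K S) : f ∈ Ideal.span S :=
  Submodule.span_le_restrictScalars K (MvPolynomial σ K) S hf

lemma isHomogeneous_binomial {p q : σ →₀ ℕ} {n : ℕ} (hp : p.degree = n) (hq : q.degree = n) :
    (binomial K p q).IsHomogeneous n :=
  (isHomogeneous_monomial 1 hp).sub (isHomogeneous_monomial 1 hq)

lemma degree_eq_of_isHomogeneous_binomial {p q : σ →₀ ℕ} {n : ℕ} (hpq : p ≠ q)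
    (h : (binomial K p q).IsHomogeneous n) : p.degree = n := by
  classical
  by_contra hne
  have := h.coeff_eq_zero hne
  simp [coeff_binomial, hpq.symm] at this

lemma exists_eq_single_add {p : σ →₀ ℕ} {n : ℕ} (hp : p.degree = n + 1) :
    ∃ i q, p = Finsupp.single i 1 + q ∧ q.degree = n := by
  have h0 : p ≠ 0 := by
    rintro rfl
    simp at hp
  obtain ⟨i, hi⟩ := Finsupp.ne_iff.mp h0
  have hle : Finsupp.single i 1 ≤ p := by
    rw [Finsupp.single_le_iff]
    simpa [Nat.one_le_iff_ne_zero] using hi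
  obtain ⟨q, rfl⟩ := exists_add_of_le hle
  refine ⟨i, q, rfl, ?_⟩
  rw [map_add, Finsupp.degree_single] at hp
  omega

lemma exists_eq_single {p : σ →₀ ℕ} (hp : p.degree = 1) : ∃ i, p = Finsupp.single i 1 := by
  obtain ⟨i, q, rfl, hq⟩ := exists_eq_single_add hp
  exact ⟨i, by rw [(Finsupp.degree_eq_zero_iff q).mp hq, add_zero]⟩

/-- Distinct monomials in a fiber have degree at least two. -/
lemma two_le_degree (hdeg : ∀ p q : σ →₀ ℕ, Finsupp.linearCombination ℕ a p =
      Finsupp.linearCombination ℕ a q → p.degree = q.degree) (hinj : Function.Injective a)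
    {p q : σ →₀ ℕ} (h : Finsupp.linearCombination ℕ a p = Finsupp.linearCombination ℕ a q)
    (hne : p ≠ q) : 2 ≤ p.degree := by
  by_contra! hlt
  have hpq := hdeg p q h
  interval_cases hp : p.degree
  · rw [Finsupp.degree_eq_zero_iff] at hp
    rw [eq_comm, Finsupp.degree_eq_zero_iff] at hpq
    exact hne (hp.trans hpq.symm)
  · obtain ⟨i, rfl⟩ := exists_eq_single hp
    obtain ⟨j, rfl⟩ := exists_eq_single hpq.symm
    simp only [Finsupp.linearCombination_single, one_smul] at h
    exact hne (by rw [hinj h])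

lemma exists_single_add_single {p : σ →₀ ℕ} (hp : p.degree = 2) :
    ∃ i j, p = Finsupp.single i 1 + Finsupp.single j 1 := by
  obtain ⟨i, q, rfl, hq⟩ := exists_eq_single_add hp
  obtain ⟨j, rfl⟩ := exists_eq_single hq
  exact ⟨i, j, rfl⟩

lemma eq_of_support_subset (hinj : Function.Injective a)
    {p q : σ →₀ ℕ} (hp : p.degree = 2) (hq : q.degree = 2)
    (h : Finsupp.linearCombination ℕ a p = Finsupp.linearCombination ℕ a q)
    (hsub : p.support ⊆ q.support) : p = q := by
  classical
  obtain ⟨i, j, rfl⟩ := exists_single_add_single hp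
  obtain ⟨k, l, rfl⟩ := exists_single_add_single hq
  have hi : i = k ∨ i = l := by
    have := hsub (show i ∈ _ by simp [Finsupp.single_apply])
    by_contra! hn
    simp [hn.1.symm, hn.2.symm] at this
  have hj : j = k ∨ j = l := by
    have := hsub (show j ∈ _ by simp [Finsupp.single_apply])
    by_contra! hn
    simp [hn.1.symm, hn.2.symm] at this
  simp only [map_add, Finsupp.linearCombination_single, one_smul] at h
  rcases hi with rfl | rfl <;> rcases hj with rfl | rfl
  · rw [hinj (add_left_cancel h)]
  · rfl
  · rw [add_comm]
  · rw [hinj (add_right_cancel h)]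

/-- A lexicographic order whose large variables are those outside of `S`. -/
lemma exists_elimination_order [Finite σ] (S : Set σ) : ∃ m : MonomialOrder.{u, u} σ,
    ∀ p q : σ →₀ ℕ, m.toSyn q < m.toSyn p →
      (↑p.support : Set σ) ⊆ S → (↑q.support : Set σ) ⊆ S := by
  classical
  obtain ⟨n, ⟨e⟩⟩ := Finite.exists_equiv_fin σ
  let φ : σ → Bool ×ₗ Fin n := fun i => toLex (decide (i ∈ S), e i)
  have hφ : Function.Injective φ := fun i j h => e.injective (congrArg (fun x => (ofLex x).2) h)
  let _ : LinearOrder σ := LinearOrder.lift' φ hφ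
  refine ⟨MonomialOrder.lex, fun p q h hp j hj => ?_⟩
  -- At the first difference i the exponent of p is larger, so i lies in S. Variables outside S come
  -- before i (`false < true`), where p and q agree.
  rw [MonomialOrder.lex_lt_iff] at h
  obtain ⟨i, hi, hlt⟩ := Finsupp.Lex.lt_iff.mp h
  by_contra hjS
  have hiS : i ∈ S := hp (by
    rw [Finset.mem_coe, Finsupp.mem_support_iff]
    exact (Nat.zero_lt_of_lt hlt).ne')
  have hji : j < i := by
    change φ j < φ i
    rw [Prod.Lex.lt_iff]
    left
    simp [φ, hjS, hiS]
  refine hjS (hp ?_)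
  rw [Finset.mem_coe, Finsupp.mem_support_iff]
  rw [Finset.mem_coe, Finsupp.mem_support_iff] at hj
  exact fun h0 => hj ((hi j hji).trans h0)

lemma exists_homogeneous_of_mem (hdeg : ∀ p q : σ →₀ ℕ, Finsupp.linearCombination ℕ a p =
      Finsupp.linearCombination ℕ a q → p.degree = q.degree) (hinj : Function.Injective a)
    {p q : σ →₀ ℕ} (h : binomial K p q ∈ toricIdeal K a) :
    ∃ n, 2 ≤ n ∧ (binomial K p q).IsHomogeneous n := by
  by_cases hpq : p = q
  · refine ⟨2, le_rfl, ?_⟩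
    rw [hpq, binomial, sub_self]
    exact isHomogeneous_zero _ _ _
  · rw [binomial_mem_toricIdeal_iff] at h
    exact ⟨p.degree, two_le_degree hdeg hinj h hpq,
      isHomogeneous_binomial rfl (hdeg p q h).symm⟩

/-- The quadratic generators lie in the linear span of the quadratic members of `M`. These therefore
generate the ideal, and by minimality are all of `M`. -/
lemma IsMarkovBasis.isHomogeneous_two (hdeg : ∀ p q : σ →₀ ℕ, Finsupp.linearCombination ℕ a p =
      Finsupp.linearCombination ℕ a q → p.degree = q.degree) (hinj : Function.Injective a)
    (hquad : IsGeneratedByQuadrics (toricIdeal K a)) {M : Set (MvPolynomial σ K)}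
    (hM : IsMarkovBasis (toricIdeal K a) M) {f : MvPolynomial σ K} (hf : f ∈ M) :
    f.IsHomogeneous 2 := by
  obtain ⟨S, hS, hSI⟩ := hquad
  have hhom : ∀ g ∈ M, ∃ n, 2 ≤ n ∧ g.IsHomogeneous n := by
    intro g hg
    obtain ⟨p, q, rfl⟩ := hM.1.1 g hg
    exact exists_homogeneous_of_mem hdeg hinj (hM.1.2 ▸ Ideal.subset_span hg)
  refine (hM.2 (y := {g ∈ M | g.IsHomogeneous 2}) ⟨fun g hg => hM.1.1 g hg.1, ?_⟩
    (Set.sep_subset _ _) hf).2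
  refine le_antisymm (hM.1.2 ▸ Ideal.span_mono (Set.sep_subset _ _)) ?_
  rw [← hSI, Ideal.span_le]
  intro g hg
  refine span_le_ideal_span _ (mem_span_of_isHomogeneous_two hhom ?_ (hS g hg))
  rw [hM.1.2, ← hSI]
  exact Ideal.subset_span hg

lemma IsMarkovBasis.ne_zero {I : Ideal (MvPolynomial σ K)} {M : Set (MvPolynomial σ K)}
    (hM : IsMarkovBasis I M) {f : MvPolynomial σ K} (hf : f ∈ M) : f ≠ 0 := by
  have := hM.2 (y := M \ {0}) ⟨fun g hg => hM.1.1 g hg.1, by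
    rw [Ideal.span_sdiff_singleton_zero, hM.1.2]⟩ Set.sdiff_subset hf
  exact this.2

/-- Extend the binomial to a linear basis, made of binomials, of the space spanned by the quadratic
binomials of the ideal. A generating subset must span this space linearly, so independence gives
minimality. -/
lemma mem_universalMarkovBasis {p q : σ →₀ ℕ} (hpq : p ≠ q)
    (hspan : Ideal.span {f ∈ (toricIdeal K a : Set (MvPolynomial σ K)) |
      f.IsHomogeneous 2 ∧ ∃ p q, f = binomial K p q} = toricIdeal K a)
    (h : binomial K p q ∈ toricIdeal K a) (h2 : (binomial K p q).IsHomogeneous 2) :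
    binomial K p q ∈ universalMarkovBasis (toricIdeal K a) := by
  obtain ⟨b, hbt, hsb, htb, hli⟩ := exists_linearIndepOn_id_extension
    (K := K) (s := {binomial K p q}) (t := {f ∈ (toricIdeal K a : Set (MvPolynomial σ K)) |
      f.IsHomogeneous 2 ∧ ∃ p q, f = binomial K p q})
    (LinearIndepOn.singleton (by simpa using binomial_ne_zero hpq))
    (Set.singleton_subset_iff.mpr ⟨h, h2, p, q, rfl⟩)
  refine ⟨b, ⟨⟨fun g hg => (hbt hg).2.2, ?_⟩, ?_⟩, hsb rfl⟩
  · refine le_antisymm (hspan ▸ Ideal.span_mono hbt) ?_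
    rw [← hspan, Ideal.span_le]
    exact fun g hg => span_le_ideal_span _ (htb hg)
  · rintro c ⟨-, hc⟩ hcb g hg
    by_contra hgc
    have hgspan : g ∈ Submodule.span K {g ∈ c | g.IsHomogeneous 2} :=
      mem_span_of_isHomogeneous_two (fun g' hg' => ⟨2, le_rfl, (hbt (hcb hg')).2.1⟩)
        (hc ▸ (hbt hg).1) (hbt hg).2.1
    have hgspan' : g ∈ Submodule.span K c := Submodule.span_mono (Set.sep_subset _ _) hgspan
    have hlc := hli.mono (Set.insert_subset hg hcb)
    rw [linearIndepOn_id_insert hgc] at hlc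
    exact hlc.2 hgspan'

/-- Under an elimination order for the support of q, a smaller monomial in its fiber has support
inside that of q, hence equals q. So q is standard, and p is minimal nonstandard since its degree
two is the least possible. -/
lemma mem_universalGroebnerBasis [Finite σ] (hdeg : ∀ p q : σ →₀ ℕ,
      Finsupp.linearCombination ℕ a p = Finsupp.linearCombination ℕ a q → p.degree = q.degree)
    (hinj : Function.Injective a) {p q : σ →₀ ℕ} (hpq : p ≠ q)
    (h : Finsupp.linearCombination ℕ a p = Finsupp.linearCombination ℕ a q)
    (h2 : p.degree = 2) :
    binomial K p q ∈ universalGroebnerBasis (toricIdeal K a) := by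
  obtain ⟨m, hm⟩ := exists_elimination_order (q.support : Set σ)
  have hq2 : q.degree = 2 := (hdeg p q h).symm.trans h2
  have hq : ¬ IsNonstandard a m q := by
    rintro ⟨r, hr, hlt⟩
    have := eq_of_support_subset hinj ((hdeg r q hr).trans hq2) hq2 hr
      (by exact_mod_cast hm q r hlt subset_rfl)
    simp [this] at hlt
  have hp : IsNonstandard a m p := by
    by_contra hp
    exact hpq (eq_of_not_isNonstandard hp hq h)
  refine ⟨m, _, isReducedGroebnerBasis_toricIdeal K a m, p, q, ⟨hp, fun r hr hrp => ?_⟩, hq, h, rfl⟩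
  obtain ⟨s, hs, hlt⟩ := hr
  have hr2 := two_le_degree hdeg hinj hs.symm (fun e => by simp [e] at hlt)
  obtain ⟨t, rfl⟩ := exists_add_of_le hrp
  have ht : t = 0 := by
    rw [← Finsupp.degree_eq_zero_iff]
    rw [map_add] at h2
    omega
  simp [ht]

lemma hasQuadraticInitialIdeals (hdeg : ∀ p q : σ →₀ ℕ,
      Finsupp.linearCombination ℕ a p = Finsupp.linearCombination ℕ a q → p.degree = q.degree)
    (hinj : Function.Injective a) (hrob : IsGeneralizedRobust (toricIdeal K a))
    (hquad : IsGeneratedByQuadrics (toricIdeal K a)) : HasQuadraticInitialIdeals a := by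
  intro m p hp
  obtain ⟨p', hle, hp'⟩ := hp.exists_minimal
  obtain ⟨q, hq, hstd⟩ := exists_standard a m p'
  have hU : binomial K p' q ∈ universalMarkovBasis (toricIdeal K a) := by
    rw [← hrob]
    exact Or.inl ⟨m, _, isReducedGroebnerBasis_toricIdeal K a m, p', q, hp', hstd, hq.symm, rfl⟩
  obtain ⟨M, hM, hmem⟩ := hU
  refine ⟨p', hle, degree_eq_of_isHomogeneous_binomial (K := K) (q := q) ?_
    (hM.isHomogeneous_two hdeg hinj hquad hmem), hp'.1⟩
  rintro rfl
  exact hstd hp'.1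

/-- A toric ideal is generated by its quadratic binomials if all its initial ideals are generated
in degree two. -/
lemma HasQuadraticInitialIdeals.span_eq [Finite σ] (hdeg : ∀ p q : σ →₀ ℕ,
      Finsupp.linearCombination ℕ a p = Finsupp.linearCombination ℕ a q → p.degree = q.degree)
    (ha : HasQuadraticInitialIdeals a) :
    Ideal.span {f ∈ (toricIdeal K a : Set (MvPolynomial σ K)) |
      f.IsHomogeneous 2 ∧ ∃ p q, f = binomial K p q} = toricIdeal K a := by
  set J := Ideal.span {f ∈ (toricIdeal K a : Set (MvPolynomial σ K)) |
      f.IsHomogeneous 2 ∧ ∃ p q, f = binomial K p q} with hJ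
  refine le_antisymm (Ideal.span_le.mpr fun f hf => hf.1) ?_
  -- Any term order will do. Replacing a nonstandard quadratic divisor by a smaller monomial of its
  -- fiber reduces every monomial to the standard one modulo J.
  obtain ⟨m, -⟩ := exists_elimination_order (∅ : Set σ)
  have key : ∀ p, ∃ q, Finsupp.linearCombination ℕ a q = Finsupp.linearCombination ℕ a p ∧
      ¬ IsNonstandard a m q ∧ binomial K p q ∈ J := by
    intro p
    induction p using (InvImage.wf m.toSyn wellFounded_lt).induction with
    | _ p ih =>
      by_cases hp : IsNonstandard a m p
      · obtain ⟨w, hwp, hw2, w', hw', hlt⟩ := ha m p hp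
        obtain ⟨t, rfl⟩ := exists_add_of_le hwp
        obtain ⟨q, hq, hstd, hmem⟩ := ih (w' + t) (by simpa [InvImage] using hlt)
        refine ⟨q, by simp [hq, hw'], hstd, ?_⟩
        have hw : binomial K w w' ∈ J := Ideal.subset_span
          ⟨binomial_mem_toricIdeal hw'.symm,
            isHomogeneous_binomial hw2 ((hdeg _ _ hw').trans hw2), w, w', rfl⟩
        have hsplit : binomial K (w + t) q =
            monomial t 1 * binomial K w w' + binomial K (w' + t) q := by
          rw [monomial_mul_binomial, one_smul, add_comm t, add_comm t]
          simp [binomial]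
        rw [hsplit]
        exact add_mem (Ideal.mul_mem_left _ _ hw) hmem
      · exact ⟨p, rfl, hp, by simp [binomial]⟩
  refine Ideal.span_le.mpr ?_
  rintro _ ⟨p, q, hpq, rfl⟩
  obtain ⟨p', hp', hps, hpm⟩ := key p
  obtain ⟨q', hq', hqs, hqm⟩ := key q
  obtain rfl := eq_of_not_isNonstandard hps hqs (hp'.trans (hpq.trans hq'.symm))
  have : binomial K p q = binomial K p p' - binomial K q p' := by simp [binomial]
  rw [SetLike.mem_coe, this]
  exact sub_mem hpm hqm

lemma HasQuadraticInitialIdeals.isGeneralizedRobust [Finite σ] (hdeg : ∀ p q : σ →₀ ℕ,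
      Finsupp.linearCombination ℕ a p = Finsupp.linearCombination ℕ a q → p.degree = q.degree)
    (hinj : Function.Injective a) (ha : HasQuadraticInitialIdeals a) :
    IsGeneralizedRobust (toricIdeal K a) ∧ IsGeneratedByQuadrics (toricIdeal K a) := by
  have hspan := ha.span_eq (K := K) hdeg
  have hquad : IsGeneratedByQuadrics (toricIdeal K a) := ⟨_, fun f hf => hf.2.1, hspan⟩
  refine ⟨?_, hquad⟩
  have hsub : ∀ f ∈ universalGroebnerBasis (toricIdeal K a), ∃ p q, p ≠ q ∧
      Finsupp.linearCombination ℕ a p = Finsupp.linearCombination ℕ a q ∧ p.degree = 2 ∧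
      f = binomial K p q := by
    rintro f ⟨m, S, hS, hf⟩
    obtain ⟨p, q, hp, hlt, hpq, rfl⟩ := hS.exists_eq_binomial hf
    obtain ⟨w, hwp, hw2, hw⟩ := ha m p hp.1
    obtain rfl := hp.eq_of_le hw hwp
    exact ⟨_, _, fun e => by simp [e] at hlt, hpq, hw2, rfl⟩
  have hUMB : ∀ p q, p ≠ q →
      Finsupp.linearCombination ℕ a p = Finsupp.linearCombination ℕ a q → p.degree = 2 →
      binomial K p q ∈ universalMarkovBasis (toricIdeal K a) := fun p q hne h h2 =>
    mem_universalMarkovBasis hne hspan (binomial_mem_toricIdeal h)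
      (isHomogeneous_binomial h2 ((hdeg p q h).symm.trans h2))
  refine Set.Subset.antisymm ?_ ?_
  · rintro f (hf | hf)
    · obtain ⟨p, q, hne, h, h2, rfl⟩ := hsub f hf
      exact hUMB p q hne h h2
    · obtain ⟨p, q, hne, h, h2, hf⟩ := hsub _ hf
      have : f = binomial K q p := by
        rw [← neg_neg f, hf, binomial, binomial, neg_sub]
      rw [this]
      exact hUMB q p hne.symm h.symm ((hdeg p q h).symm.trans h2)
  · rintro f ⟨M, hM, hf⟩
    obtain ⟨p, q, rfl⟩ := hM.1.1 f hf
    have hne : p ≠ q := by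
      rintro rfl
      exact hM.ne_zero hf (by simp [binomial])
    refine Or.inl (mem_universalGroebnerBasis hdeg hinj hne ?_ ?_)
    · exact binomial_mem_toricIdeal_iff.mp (hM.1.2 ▸ Ideal.subset_span hf)
    · exact degree_eq_of_isHomogeneous_binomial hne (hM.isHomogeneous_two hdeg hinj hquad hf)

end Quadrics

/-! ### Kernel functions and monomials -/

section Translation

variable {V : Type u} {G : SimpleGraph V}

open scoped Classical in
/-- The exponent vector of a monomial, as a symmetric function on pairs of vertices. -/
noncomputable def edgeExponent (p : G.edgeSet →₀ ℕ) (x y : V) : ℤ :=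
  if h : G.Adj x y then (p ⟨s(x, y), G.mem_edgeSet.mpr h⟩ : ℤ) else 0

lemma edgeExponent_of_adj (p : G.edgeSet →₀ ℕ) {x y : V} (h : G.Adj x y) :
    edgeExponent p x y = p ⟨s(x, y), G.mem_edgeSet.mpr h⟩ := dif_pos h

lemma edgeExponent_symm (p : G.edgeSet →₀ ℕ) (x y : V) :
    edgeExponent p x y = edgeExponent p y x := by
  by_cases h : G.Adj x y
  · rw [edgeExponent_of_adj p h, edgeExponent_of_adj p h.symm]
    congr 3
    exact Sym2.eq_swap
  · rw [edgeExponent, edgeExponent, dif_neg h, dif_neg (fun h' => h h'.symm)]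

lemma sum_edgeExponent [Fintype V] (p : G.edgeSet →₀ ℕ) (x : V) :
    ∑ y, edgeExponent p x y = Finsupp.linearCombination ℕ (edgeVector G) p x := by
  classical
  induction p using Finsupp.induction_linear with
  | zero => simp [edgeExponent]
  | add p q hp hq =>
    have h : ∀ y, edgeExponent (p + q) x y = edgeExponent p x y + edgeExponent q x y := by
      intro y
      unfold edgeExponent
      split_ifs <;> simp
    simp only [h, Finset.sum_add_distrib, hp, hq, map_add, Pi.add_apply, Nat.cast_add]
  | single e n =>
    have h : ∀ y, edgeExponent (Finsupp.single e n) x y =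
        if (e : Sym2 V) = s(x, y) then n else 0 := by
      intro y
      unfold edgeExponent
      by_cases hxy : G.Adj x y
      · simp [hxy, Finsupp.single_apply, Subtype.ext_iff]
      · have : (e : Sym2 V) ≠ s(x, y) := fun he => hxy (by
          have := e.2
          rwa [he] at this)
        simp [hxy, this]
    simp only [h, Finsupp.linearCombination_single, Pi.smul_apply, edgeVector, smul_eq_mul]
    by_cases hx : x ∈ (e : Sym2 V)
    · obtain ⟨y, hy⟩ := hx
      rw [Finset.sum_eq_single y]
      · simp [hy]
      · intro y' _ hne
        have hyy : (e : Sym2 V) ≠ s(x, y') := by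
          rw [hy, Ne, Sym2.congr_right]
          exact hne.symm
        rw [if_neg hyy, Nat.cast_zero]
      · simp
    · rw [Set.indicator_of_notMem (by simpa using hx), Finset.sum_eq_zero]
      · simp
      · intro y _
        have hy : (e : Sym2 V) ≠ s(x, y) := fun he => hx (he ▸ Sym2.mem_mk_left x y)
        rw [if_neg hy, Nat.cast_zero]

lemma edgeVector_apply [DecidableEq V] {a b : V} (h : s(a, b) ∈ G.edgeSet) (x : V) :
    edgeVector G ⟨s(a, b), h⟩ x = (if x = a then 1 else 0) + if x = b then 1 else 0 := by
  have hab : a ≠ b := G.ne_of_adj h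
  unfold edgeVector
  by_cases hxa : x = a
  · subst hxa
    simp [hab]
  · by_cases hxb : x = b <;> simp [hxa, hxb, hab.symm, Set.indicator]

lemma edgeVector_injective : Function.Injective (edgeVector G) := by
  intro e f h
  refine Subtype.ext (Sym2.ext fun x => ?_)
  have := congrFun h x
  unfold edgeVector at this
  by_cases he : x ∈ (e : Sym2 V) <;> by_cases hf : x ∈ (f : Sym2 V) <;>
    simp_all [Set.indicator]

lemma degree_eq_of_linearCombination_edgeVector [Finite V] (p q : G.edgeSet →₀ ℕ)
    (h : Finsupp.linearCombination ℕ (edgeVector G) p =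
      Finsupp.linearCombination ℕ (edgeVector G) q) : p.degree = q.degree := by
  classical
  have := Fintype.ofFinite V
  have key : ∀ p : G.edgeSet →₀ ℕ,
      ∑ x, Finsupp.linearCombination ℕ (edgeVector G) p x = 2 * p.degree := by
    intro p
    induction p using Finsupp.induction_linear with
    | zero => simp
    | add p q hp hq => simp [Finset.sum_add_distrib, hp, hq, mul_add]
    | single e n =>
      obtain ⟨⟨a, b⟩, he⟩ := e
      rw [Finsupp.linearCombination_single, Finsupp.degree_single]
      simp only [Pi.smul_apply, smul_eq_mul, ← Finset.mul_sum]
      have : ∀ x, edgeVector G ⟨Quot.mk _ (a, b), he⟩ x =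
        (if x = a then 1 else 0) + if x = b then 1 else 0 := edgeVector_apply he
      simp [this, Finset.sum_add_distrib, mul_comm]
  have h₁ := key p
  rw [h, key q] at h₁
  omega

lemma isKernel_edgeExponent_sub [Finite V] {p q : G.edgeSet →₀ ℕ}
    (h : Finsupp.linearCombination ℕ (edgeVector G) p =
      Finsupp.linearCombination ℕ (edgeVector G) q) :
    IsKernel G fun x y => edgeExponent p x y - edgeExponent q x y where
  symm x y := by rw [edgeExponent_symm p, edgeExponent_symm q]
  adj x y hz := by
    by_contra hxy
    simp [edgeExponent, hxy] at hz
  sum x := by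
    have := Fintype.ofFinite V
    rw [finsum_eq_sum_of_fintype, Finset.sum_sub_distrib, sum_edgeExponent, sum_edgeExponent, h,
      sub_self]

lemma single_add_single_le {σ : Type*} {i j : σ} (hij : i ≠ j) {p : σ →₀ ℕ} (hi : p i ≠ 0)
    (hj : p j ≠ 0) : Finsupp.single i 1 + Finsupp.single j 1 ≤ p := by
  classical
  intro k
  simp only [Finsupp.add_apply, Finsupp.single_apply]
  split_ifs with h₁ h₂ h₂
  · exact absurd (h₁.trans h₂.symm) hij
  · subst h₁; omega
  · subst h₂; omega
  · omega

/-- Conformal decompositions show that initial ideals are generated in degree two. -/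
lemma HasConformalSquares.hasQuadraticInitialIdeals [Finite V] (hG : HasConformalSquares G) :
    HasQuadraticInitialIdeals (edgeVector G) := by
  classical
  intro m p hp
  by_contra! hno
  -- If no nonstandard quadratic monomial divides p, then p is least in its fiber; the induction is
  -- on the degree of the truncated difference q - p.
  suffices key : ∀ n (q : G.edgeSet →₀ ℕ), (q - p).degree = n →
      Finsupp.linearCombination ℕ (edgeVector G) q =
        Finsupp.linearCombination ℕ (edgeVector G) p → m.toSyn p ≤ m.toSyn q by
    obtain ⟨q, hq, hlt⟩ := hp
    exact absurd (key _ q rfl hq) (not_le.mpr hlt)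
  intro n
  induction n using Nat.strong_induction_on with
  | _ n ih =>
    intro q hn hq
    by_cases hpq : p = q
    · rw [hpq]
    obtain ⟨⟨⟨x, y⟩, he⟩, hne⟩ := Finsupp.ne_iff.mp hpq
    have hxy : G.Adj x y := he
    have hval : ∀ {u v : V} (h : G.Adj u v), edgeExponent p u v - edgeExponent q u v =
        (p ⟨s(u, v), G.mem_edgeSet.mpr h⟩ : ℤ) - q ⟨s(u, v), G.mem_edgeSet.mpr h⟩ := fun h => by
      rw [edgeExponent_of_adj p h, edgeExponent_of_adj q h]
    have hker := isKernel_edgeExponent_sub hq.symm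
    obtain ⟨a, b, c, d, hab, hbc, hcd, hda⟩ := hG _ hker x y (by
      rw [hval hxy, sub_ne_zero]
      exact_mod_cast hne)
    have Aab := hker.adj _ _ hab.ne'
    have Abc := hker.adj _ _ hbc.ne
    have Acd := hker.adj _ _ hcd.ne'
    have Ada := hker.adj _ _ hda.ne
    have hca : c ≠ a := by
      rintro rfl
      have := hker.symm b c
      omega
    have hdb : d ≠ b := by
      rintro rfl
      have := hker.symm c d
      omega
    simp only [hval Aab, hval Abc, hval Acd, hval Ada] at hab hbc hcd hda
    -- The opposite edges of the square give w dividing the positive part of p - q and w' dividing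
    -- the negative part, in one fiber. As a divisor of p, w is standard. Exchanging w' for w in q
    -- does not increase q and brings it closer to p by two.
    obtain ⟨w, hw⟩ : ∃ w : G.edgeSet →₀ ℕ, w = Finsupp.single ⟨s(a, b), G.mem_edgeSet.mpr Aab⟩ 1 +
      Finsupp.single ⟨s(c, d), G.mem_edgeSet.mpr Acd⟩ 1 := ⟨_, rfl⟩
    obtain ⟨w', hw'⟩ : ∃ w : G.edgeSet →₀ ℕ, w = Finsupp.single ⟨s(b, c), G.mem_edgeSet.mpr Abc⟩ 1 +
      Finsupp.single ⟨s(d, a), G.mem_edgeSet.mpr Ada⟩ 1 := ⟨_, rfl⟩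
    have hwp : w ≤ p - q := by
      refine hw ▸ single_add_single_le ?_ ?_ ?_
      · intro h
        have := Subtype.ext_iff.mp h
        simp only [Sym2.eq_iff] at this
        rcases this with h | h
        · exact hca h.1.symm
        · exact Abc.ne h.2
      · rw [Finsupp.tsub_apply]; omega
      · rw [Finsupp.tsub_apply]; omega
    have hwq : w' ≤ q - p := by
      refine hw' ▸ single_add_single_le ?_ ?_ ?_
      · intro h
        have := Subtype.ext_iff.mp h
        simp only [Sym2.eq_iff] at this
        rcases this with h | h
        · exact hdb h.1.symm
        · exact Aab.ne h.1.symm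
      · rw [Finsupp.tsub_apply]; omega
      · rw [Finsupp.tsub_apply]; omega
    have hww : Finsupp.linearCombination ℕ (edgeVector G) w' =
        Finsupp.linearCombination ℕ (edgeVector G) w := by
      simp only [hw, hw', map_add, Finsupp.linearCombination_single, one_smul]
      funext v
      simp only [Pi.add_apply, edgeVector_apply]
      omega
    have hstd : m.toSyn w ≤ m.toSyn w' := by
      refine toSyn_le_of_not_isNonstandard (a := edgeVector G)
        (hno w (hwp.trans tsub_le_self) ?_) hww
      simp [hw]
    obtain ⟨r, hr⟩ := exists_add_of_le (hwq.trans (tsub_le_self : q - p ≤ q))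
    have hlt : (w + r - p).degree + 2 = (q - p).degree := by
      have : (w + r - p) + w' = q - p := by
        ext e
        have h₁ := hwp e
        have h₂ := hwq e
        have h₃ := DFunLike.congr_fun hr e
        simp only [Finsupp.tsub_apply, Finsupp.add_apply] at h₁ h₂ h₃ ⊢
        omega
      rw [← this, map_add]
      simp [hw']
    have := ih _ (by omega) (w + r) rfl (by rw [← hq, hr, map_add, map_add, hww])
    refine this.trans ?_
    rw [hr, map_add, map_add]
    exact add_le_add_left hstd _

/-- Two pairs of edges covering the same vertices form a 4-cycle. -/
lemma exists_square_of_edgeVector_add {e f g h : G.edgeSet}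
    (heq : edgeVector G e + edgeVector G f = edgeVector G g + edgeVector G h)
    (hne : e ≠ g) (hne' : e ≠ h) :
    ∃ (a b c d : V), c ≠ a ∧ d ≠ b ∧ ∀ z : Sym2 V → Prop, z e → z f → z g → z h →
      z s(a, b) ∧ z s(b, c) ∧ z s(c, d) ∧ z s(d, a) := by
  classical
  have hfg : f ≠ g := by
    rintro rfl
    exact hne' (edgeVector_injective (add_right_cancel (heq.trans (add_comm _ _))))
  have hfh : f ≠ h := by
    rintro rfl
    exact hne (edgeVector_injective (add_right_cancel heq))
  obtain ⟨a, b, hab⟩ : ∃ a b, (e : Sym2 V) = s(a, b) := ⟨_, _, (Quot.out_eq (e : Sym2 V)).symm⟩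
  have hcov : ∀ v, (if v ∈ (e : Sym2 V) then 1 else 0) + (if v ∈ (f : Sym2 V) then 1 else 0) =
      (if v ∈ (g : Sym2 V) then 1 else 0) + if v ∈ (h : Sym2 V) then 1 else 0 := by
    intro v
    simpa [edgeVector, Set.indicator_apply] using congrFun heq v
  -- Following the covered vertices: a lies in g = ac, say; then c lies in f = cd, which leaves b
  -- and d for h.
  wlog hag : a ∈ (g : Sym2 V) generalizing g h
  · have hah : a ∈ (h : Sym2 V) := by
      have := hcov a
      simp only [hab, Sym2.mem_mk_left, hag, if_true, if_false] at this
      by_contra hn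
      simp only [hn, if_false] at this
      omega
    obtain ⟨a', b', c', d', h₁, h₂, H⟩ := this (g := h) (h := g) (heq.trans (add_comm _ _)) hne' hne
      hfh hfg (fun v => (hcov v).trans (add_comm _ _)) hah
    exact ⟨a', b', c', d', h₁, h₂, fun z he hf hg hh => H z he hf hh hg⟩
  obtain ⟨c, hac⟩ := hag
  have Aab : G.Adj a b := by simpa [hab] using e.2
  have Aac : G.Adj a c := by simpa [hac] using g.2
  have hcb : c ≠ b := by
    rintro rfl
    exact hne (Subtype.ext (hab.trans hac.symm))
  have hcf : c ∈ (f : Sym2 V) := by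
    have := hcov c
    simp only [hab, hac, Sym2.mem_iff, Aac.ne.symm, hcb, or_true, or_self, if_true, if_false]
      at this
    by_contra hn
    simp only [hn, if_false] at this
    omega
  obtain ⟨d, hcd⟩ := hcf
  have Acd : G.Adj c d := by simpa [hcd] using f.2
  have hda : d ≠ a := by
    rintro rfl
    exact hfg (Subtype.ext (hcd.trans (Sym2.eq_swap.trans hac.symm)))
  have hbh : b ∈ (h : Sym2 V) := by
    have := hcov b
    simp only [hab, hac, Sym2.mem_iff, Aab.ne.symm, hcb.symm, or_true, or_self, if_true, if_false]
      at this
    by_contra hn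
    simp only [hn, if_false] at this
    omega
  have hdh : d ∈ (h : Sym2 V) ∧ d ≠ b := by
    have := hcov d
    simp only [hab, hac, hcd, Sym2.mem_iff, hda, Acd.ne.symm, or_true, false_or, or_self, if_true,
      if_false] at this
    split_ifs at this <;> first | omega | exact ⟨by assumption, by assumption⟩
  have hh : (h : Sym2 V) = s(b, d) := (Sym2.mem_and_mem_iff hdh.2.symm).mp ⟨hbh, hdh.1⟩
  refine ⟨a, b, d, c, hda, hcb, fun z he hf hg hh' => ⟨hab ▸ he, hh ▸ hh', ?_, ?_⟩⟩
  · rw [Sym2.eq_swap]; exact hcd ▸ hf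
  · rw [Sym2.eq_swap]; exact hac ▸ hg

/-- Split z into its positive and negative parts. Under an elimination order for the support of z,
the larger part has a nonstandard quadratic divisor, and the smaller monomial in the fiber of that
divisor is again supported there; the two quadratic monomials form the square. -/
lemma exists_square_in_support [Finite V] (hG : HasQuadraticInitialIdeals (edgeVector G))
    {z : V → V → ℤ} (hz : IsKernel G z) {x y : V} (hxy : z x y ≠ 0) :
    ∃ a b c d, c ≠ a ∧ d ≠ b ∧ z a b ≠ 0 ∧ z b c ≠ 0 ∧ z c d ≠ 0 ∧ z d a ≠ 0 := by
  classical
  have := Fintype.ofFinite V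
  let zE : Sym2 V → ℤ := Sym2.lift ⟨z, hz.symm⟩
  let p : G.edgeSet →₀ ℕ := Finsupp.equivFunOnFinite.symm fun e => (zE e).toNat
  let q : G.edgeSet →₀ ℕ := Finsupp.equivFunOnFinite.symm fun e => (-zE e).toNat
  have hp : ∀ e : G.edgeSet, p e = (zE e).toNat := fun e => rfl
  have hq : ∀ e : G.edgeSet, q e = (-zE e).toNat := fun e => rfl
  have hsub : ∀ x y, edgeExponent p x y - edgeExponent q x y = z x y := by
    intro x y
    by_cases h : G.Adj x y
    · rw [edgeExponent_of_adj p h, edgeExponent_of_adj q h, hp, hq]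
      exact Int.toNat_sub_toNat_neg _
    · have h0 : z x y = 0 := by
        by_contra hn
        exact h (hz.adj x y hn)
      simp [edgeExponent, h, h0]
  have hfib : Finsupp.linearCombination ℕ (edgeVector G) p =
      Finsupp.linearCombination ℕ (edgeVector G) q := by
    funext v
    have h0 := hz.sum v
    rw [finsum_eq_sum_of_fintype] at h0
    simp only [← hsub, Finset.sum_sub_distrib, sum_edgeExponent] at h0
    omega
  have hpq : p ≠ q := by
    intro h
    apply hxy
    rw [← hsub, h, sub_self]
  obtain ⟨m, hm⟩ := exists_elimination_order {e : G.edgeSet | zE e ≠ 0}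
  have hps : (p.support : Set G.edgeSet) ⊆ {e | zE e ≠ 0} := by
    intro e he
    rw [Finset.mem_coe, Finsupp.mem_support_iff, hp] at he
    intro h0
    simp [h0] at he
  have hqs : (q.support : Set G.edgeSet) ⊆ {e | zE e ≠ 0} := by
    intro e he
    rw [Finset.mem_coe, Finsupp.mem_support_iff, hq] at he
    intro h0
    simp [h0] at he
  obtain ⟨w, hw2, hws, w', hw', hlt⟩ : ∃ w : G.edgeSet →₀ ℕ, w.degree = 2 ∧
      (w.support : Set G.edgeSet) ⊆ {e | zE e ≠ 0} ∧ IsNonstandard (edgeVector G) m w := by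
    have aux : ∀ r : G.edgeSet →₀ ℕ, (r.support : Set G.edgeSet) ⊆ {e | zE e ≠ 0} →
        IsNonstandard (edgeVector G) m r → ∃ w : G.edgeSet →₀ ℕ, w.degree = 2 ∧
      (w.support : Set G.edgeSet) ⊆ {e | zE e ≠ 0} ∧ IsNonstandard (edgeVector G) m w := by
      intro r hr hns
      obtain ⟨w, hwr, hw2, hw⟩ := hG m r hns
      exact ⟨w, hw2, (Finset.coe_subset.mpr (Finsupp.support_mono hwr)).trans hr, hw⟩
    rcases lt_or_gt_of_ne (fun h => hpq (m.toSyn.injective h)) with h | h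
    · exact aux q hqs ⟨p, hfib, h⟩
    · exact aux p hps ⟨q, hfib.symm, h⟩
  have hws' := hm w w' hlt hws
  obtain ⟨e, f, rfl⟩ := exists_single_add_single hw2
  obtain ⟨g, h, rfl⟩ := exists_single_add_single
    ((degree_eq_of_linearCombination_edgeVector _ _ hw').trans hw2)
  simp only [map_add, Finsupp.linearCombination_single, one_smul] at hw'
  have heg : e ≠ g := by
    rintro rfl
    rw [edgeVector_injective (add_left_cancel hw')] at hlt
    exact lt_irrefl _ hlt
  have heh : e ≠ h := by
    rintro rfl
    rw [add_comm] at hw'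
    rw [edgeVector_injective (add_left_cancel hw'), add_comm] at hlt
    exact lt_irrefl _ hlt
  have hmem : ∀ i j : G.edgeSet,
      ((Finsupp.single i 1 + Finsupp.single j 1 : G.edgeSet →₀ ℕ).support : Set G.edgeSet) ⊆
        {e | zE e ≠ 0} → zE i ≠ 0 ∧ zE j ≠ 0 := fun i j hs =>
    ⟨hs (by simp), hs (by simp)⟩
  obtain ⟨he, hf⟩ := hmem e f hws
  obtain ⟨hg, hh⟩ := hmem g h hws'
  obtain ⟨a, b, c, d, hca, hdb, H⟩ := exists_square_of_edgeVector_add hw'.symm heg heh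
  exact ⟨a, b, c, d, hca, hdb, H (fun e => zE e ≠ 0) he hf hg hh⟩

end Translation

/-! ### From initial ideals to squares -/

section Squares

variable {V : Type u} {G : SimpleGraph V}

lemma IsKernel.sub_mul [Finite V] {z c : V → V → ℤ} (hz : IsKernel G z) (hc : IsKernel G c)
    (t : ℤ) : IsKernel G fun x y => z x y - t * c x y where
  symm x y := by rw [hz.symm, hc.symm]
  adj x y h := by
    by_cases h0 : z x y = 0
    · refine hc.adj x y fun hc0 => h ?_
      rw [h0, hc0, mul_zero, sub_zero]
    · exact hz.adj x y h0
  sum x := by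
    have := Fintype.ofFinite V
    have h₁ := hz.sum x
    have h₂ := hc.sum x
    rw [finsum_eq_sum_of_fintype] at h₁ h₂ ⊢
    rw [Finset.sum_sub_distrib, ← Finset.mul_sum, h₁, h₂, mul_zero, sub_zero]

/-- The alternating weight of a 4-cycle. -/
lemma exists_isKernel_square [Finite V] {a b c d : V} (hab : G.Adj a b) (hbc : G.Adj b c)
    (hcd : G.Adj c d) (hda : G.Adj d a) (hca : c ≠ a) (hdb : d ≠ b) :
    ∃ w, IsKernel G w ∧ w a b = 1 ∧ ∀ x y, w x y ≠ 0 →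
      s(x, y) = s(a, b) ∨ s(x, y) = s(b, c) ∨ s(x, y) = s(c, d) ∨ s(x, y) = s(d, a) := by
  classical
  refine ⟨_, isKernel_altWeight
    (.cons hab (.cons hbc (.cons hcd (.cons hda (.nil : G.Walk a a))))) ⟨2, rfl⟩, ?_, ?_⟩
  · simp [altWeight, hab.ne, hbc.ne, hca.symm, hdb.symm, hda.ne.symm]
  · intro x y h
    have := mem_edges_of_altWeight_ne_zero _ h
    simpa using this

/-- It suffices to find one 4-cycle in the support of each kernel element. -/
lemma hasSquares_of_exists [Finite V] (hG : ∀ z, IsKernel G z → ∀ x y, z x y ≠ 0 →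
    ∃ a b c d, c ≠ a ∧ d ≠ b ∧ z a b ≠ 0 ∧ z b c ≠ 0 ∧ z c d ≠ 0 ∧ z d a ≠ 0) :
    HasSquares G := by
  classical
  have := Fintype.ofFinite V
  suffices key : ∀ (n : ℕ) (z : V → V → ℤ), {x : V × V | z x.1 x.2 ≠ 0}.ncard = n →
      IsKernel G z → ∀ a b, z a b ≠ 0 →
      ∃ c d, c ≠ a ∧ d ≠ b ∧ z b c ≠ 0 ∧ z c d ≠ 0 ∧ z d a ≠ 0 from
    fun z hz => key _ z rfl hz
  intro n
  induction n using Nat.strong_induction_on with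
  | _ n ih =>
    intro z hn hz x y hxy
    obtain ⟨a, b, c, d, hca, hdb, hab, hbc, hcd, hda⟩ := hG z hz x y hxy
    by_cases hmem : s(x, y) = s(a, b) ∨ s(x, y) = s(b, c) ∨ s(x, y) = s(c, d) ∨ s(x, y) = s(d, a)
    · have hs := hz.symm
      simp only [Sym2.eq_iff] at hmem
      rcases hmem with (⟨rfl, rfl⟩ | ⟨rfl, rfl⟩) | (⟨rfl, rfl⟩ | ⟨rfl, rfl⟩) |
        (⟨rfl, rfl⟩ | ⟨rfl, rfl⟩) | (⟨rfl, rfl⟩ | ⟨rfl, rfl⟩)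
      · exact ⟨c, d, hca, hdb, hbc, hcd, hda⟩
      · exact ⟨d, c, hdb, hca, hs d y ▸ hda, hs c d ▸ hcd, hs x c ▸ hbc⟩
      · exact ⟨d, a, hdb, hca.symm, hcd, hda, hab⟩
      · exact ⟨a, d, hca.symm, hdb, hs a y ▸ hab, hs d a ▸ hda, hs x d ▸ hcd⟩
      · exact ⟨a, b, hca.symm, hdb.symm, hda, hab, hbc⟩
      · exact ⟨b, a, hdb.symm, hca.symm, hs b y ▸ hbc, hs a b ▸ hab, hs x a ▸ hda⟩
      · exact ⟨b, c, hdb.symm, hca, hab, hbc, hcd⟩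
      · exact ⟨c, b, hca, hdb.symm, hs c y ▸ hcd, hs b c ▸ hbc, hs x b ▸ hab⟩
    -- If the square misses xy, subtract the multiple of it that kills ab: the support shrinks but
    -- keeps xy, and induction applies.
    · obtain ⟨w, hw, hwab, hws⟩ := exists_isKernel_square (hz.adj _ _ hab) (hz.adj _ _ hbc)
        (hz.adj _ _ hcd) (hz.adj _ _ hda) hca hdb
      have hsub : ∀ u v, z u v - z a b * w u v ≠ 0 → z u v ≠ 0 := by
        intro u v h h0
        have hwu : w u v ≠ 0 := fun hw0 => h (by rw [h0, hw0, mul_zero, sub_zero])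
        have hs := hz.symm
        rcases hws u v hwu with h' | h' | h' | h' <;> rw [Sym2.eq_iff] at h' <;>
          rcases h' with ⟨rfl, rfl⟩ | ⟨rfl, rfl⟩
        · exact hab h0
        · exact hab (hs _ _ ▸ h0)
        · exact hbc h0
        · exact hbc (hs _ _ ▸ h0)
        · exact hcd h0
        · exact hcd (hs _ _ ▸ h0)
        · exact hda h0
        · exact hda (hs _ _ ▸ h0)
      have hwxy : w x y = 0 := by
        by_contra h
        exact hmem (hws x y h)
      have hlt : {e : V × V | z e.1 e.2 - z a b * w e.1 e.2 ≠ 0}.ncard < n := by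
        rw [← hn]
        refine Set.ncard_lt_ncard ⟨fun e he => hsub _ _ he, fun hle => ?_⟩ (Set.toFinite _)
        exact hle (a := (a, b)) hab (by simp [hwab])
      obtain ⟨p, q, hp, hq, h₁, h₂, h₃⟩ := ih _ hlt _ rfl (hz.sub_mul hw (z a b)) x y
        (by rw [hwxy, mul_zero, sub_zero]; exact hxy)
      exact ⟨p, q, hp, hq, hsub _ _ h₁, hsub _ _ h₂, hsub _ _ h₃⟩

lemma HasQuadraticInitialIdeals.hasSquares [Finite V]
    (hG : HasQuadraticInitialIdeals (edgeVector G)) : HasSquares G :=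
  hasSquares_of_exists fun _ hz _ _ hxy => exists_square_in_support hG hz hxy

end Squares

end ToricGraph

theorem theorem3p11 {V : Type u} [Finite V] (K : Type v) [Field K] (G : SimpleGraph V)
    (hconn : G.Connected) (hG : ¬ G.IsBipartite) :
    (ToricGraph.IsGeneralizedRobust (ToricGraph.graphIdeal K G) ∧
      ToricGraph.IsGeneratedByQuadrics (ToricGraph.graphIdeal K G)) ↔
    ∃ B : G.Subgraph, ToricGraph.IsBlock G B ∧ ¬ B.coe.IsBipartite ∧
      (ToricGraph.IsK4 B.coe ∨ ToricGraph.IsK2lPlusEdge B.coe ∨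
        ToricGraph.IsDoubleK2 B.coe ∨ ToricGraph.IsNecklaceK2 B.coe) ∧
      ∀ B' : G.Subgraph, ToricGraph.IsBlock G B' → B' ≠ B →
        B'.coe.IsBipartite ∧ (ToricGraph.IsK2l B'.coe ∨ ToricGraph.IsCutEdge G B') := by
  open ToricGraph in
  constructor
  · rintro ⟨hrob, hquad⟩
    have hsq : HasSquares G := (hasQuadraticInitialIdeals
      degree_eq_of_linearCombination_edgeVector edgeVector_injective hrob hquad).hasSquares
    obtain ⟨B, hB, hBn⟩ := exists_not_isBipartite_block hG
    have : Nontrivial V := by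
      by_contra hV
      rw [not_nontrivial_iff_subsingleton] at hV
      exact hG ⟨.mk (fun _ => 0) fun {u v} h => absurd (Subsingleton.elim u v) h.ne⟩
    refine ⟨B, hB, hBn, ?_, fun D hD hne => ?_⟩
    -- A K_{2,l} with an extra edge and a double-K_{2,(r,s)} become bipartite on deleting an end of
    -- e, so they are covered by the necklace case.
    · by_cases hx : ∃ x, (del B.coe x).IsBipartite
      · obtain ⟨x, hx⟩ := hx
        exact .inr (.inr (.inr
          (isNecklaceK2_of_del_isBipartite (hsq.coe_subgraph B) hB.1 hBn hx)))
      · exact .inl (isK4_of_isBiconnected (hsq.coe_subgraph B) hB.1 (not_exists.mp hx))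
    · have hDb : D.coe.IsBipartite := by
        by_contra hDn
        exact hne (IsBlock.eq_of_not_isBipartite hsq hconn hD hB hDn hBn)
      exact ⟨hDb, hD.isK2l_or_isCutEdge hsq
        (fun u => hconn.preconnected.exists_adj_of_nontrivial u) hDb⟩
  · rintro ⟨B, hB, hBn, hBt, hrest⟩
    have hconf : HasConformalSquares G := by
      refine hasConformalSquares_of_blocks (fun D E hD hE hDn hEn => ?_) fun D hD => ?_
      · have hDB : D = B := by
          by_contra hne
          exact hDn (hrest D hD hne).1
        have hEB : E = B := by
          by_contra hne
          exact hEn (hrest E hE hne).1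
        rw [hDB, hEB]
      · by_cases hDB : D = B
        · subst hDB
          rcases hBt with h | h | h | h
          · exact h.hasConformalSquares
          · exact h.hasConformalSquares
          · exact h.hasConformalSquares
          · exact h.hasConformalSquares
        · rcases (hrest D hD hDB).2 with h | h
          · exact h.hasConformalSquares
          · exact h.hasConformalSquares
    exact hconf.hasQuadraticInitialIdeals.isGeneralizedRobust
      degree_eq_of_linearCombination_edgeVector edgeVector_injective
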